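/- **Setting.** Let $T>0$ and $\tfrac12<H_1<H_2<1$. Define $$\psi(u,s)=\partial_u\int_0^u (u-t)^{\frac12-H_1}t^{\frac12-H_1}(s-t)^{2H_2-2}\,dt\qquad(0<u<s<T),$$ and, for $0<s<u<T$, $\rho(u,s)=\varphi(u,s)+\tau(u,s)$ with $$\varphi(u,s)=\partial_u\int_s^u (u-t)^{\frac12-H_1}t^{\frac12-H_1}(t-s)^{2H_2-2}\,dt,\qquad \tau(u,s)=\partial_u\int_0^s (u-t)^{\frac12-H_1}t^{\frac12-H_1}(s-t)^{2H_2-2}\,dt .$$ (For fixed $s$, $\rho(t,s)$ is given by the same formulas for all $t>s$.) Let $K(u,s)=K_-(u,s)$ for $0<s<u<T$ and $K(u,s)=K_+(u,s)$ for $0<u<s<T$, where $$K_-(u,s)=u^{H_1-\frac12}(T-u)^{\frac12-H_1}\rho(u,s)+(H_1-\tfrac12)u^{\frac12-H_1}\int_u^T\frac{u^{2H_1-1}\rho(u,s)-t^{2H_1-1}\rho(t,s)}{(t-u)^{H_1+\frac12}}\,dt,$$ $$\begin{aligned}K_+(u,s)={}&u^{H_1-\frac12}(s-u)^{\frac12-H_1}\psi(u,s)+(H_1-\tfrac12)u^{\frac12-H_1}\int_u^s\frac{u^{2H_1-1}\psi(u,s)-t^{2H_1-1}\psi(t,s)}{(t-u)^{H_1+\frac12}}\,dt\\&-(H_1-\tfrac12)u^{\frac12-H_1}\int_s^T(t-u)^{-\frac12-H_1}t^{2H_1-1}\rho(t,s)\,dt.\end{aligned}$$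 Let $B$ be the Euler beta function, ${}_2F_1$ the Gauss hypergeometric function, $\alpha=2H_2-H_1-\tfrac12$, $\beta=1-\alpha$, and $$\begin{aligned} D_1&=2(1-H_1)B(\tfrac32-H_1,\tfrac32-H_1),& D_2&=(1-H_2)B(\tfrac32-H_1,\tfrac32-H_1),\\ D_3&=2(H_2-H_1)B(\tfrac32-H_1,2H_2-1),& D_5&=(H_1-\tfrac12)B(\tfrac32-H_1,2H_2-1),\\ D_4&=\frac{(H_1-\frac12)(\frac32-H_1)}{2H_2-H_1+\frac12}B(\tfrac32-H_1,2H_2-1). \end{aligned}$$ For $z\in[0,1]$ put $$\begin{aligned} F_1(z)&={}_2F_1(2-2H_2,\tfrac32-H_1;3-2H_1;z),\\ F_2(z)&={}_2F_1(1+2H_2-2H_1,\tfrac32-H_1;4-2H_1;z),\\ F_3(z)&={}_2F_1(H_1-\tfrac12,\tfrac32-H_1;2H_2-H_1+\tfrac12;1-z),\\ F_4(z)&={}_2F_1(2H_2-2H_1+1,2H_2-1;2H_2-H_1+\tfrac32;1-z),\\ F_5(z)&={}_2F_1(2H_2-2H_1,2H_2-1;2H_2-H_1+\tfrac12;z), \end{aligned}$$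 where at argument $1$ the value is the sum of the (convergent) hypergeometric series. For $z\in[0,1]$, with $z_y=z+(1-z)y$, put $$\Phi_1(z)=\int_0^1\frac{F_1(z)-F_1(z_y)}{y^{H_1+\frac12}}\,dy,\qquad \Phi_2(z)=\int_0^1\frac{zF_2(z)-z_y(1-y)^{\alpha-1}F_2(z_y)}{y^{H_1+\frac12}}\,dy .$$ For $z\in(0,1)$, $R>0$, with $w=1+(1-z)x$, put $$\begin{aligned} \Psi_1(z,R)&=\int_0^R x^{-H_1-\frac12}\Bigl[(D_3+D_5z)F_3(z)-(1+x)^{\alpha-1}w^{H_1-\frac12}\bigl(D_3+D_5\tfrac zw\bigr)F_3(\tfrac zw)\Bigr]dx,\\ \Psi_2(z,R)&=D_4z^{\alpha}(1-z)\int_0^R x^{-H_1-\frac12}\Bigl[F_4(z)-(1+x)^{\alpha}w^{2H_1-2H_2-1}F_4(\tfrac zw)\Bigr]dx,\\ \Psi_3(z,R)&=-D_5z^{\alpha}\int_0^R x^{-H_1-\frac12}\Bigl[F_5(z)-(1+x)^{\alpha-1}w^{2H_1-2H_2}F_5(\tfrac zw)\Bigr]dx,\\ \Lambda_1(z,R)&=\int_0^R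 x^{\alpha-1}(1+x)^{-H_1-\frac12}w^{H_1-\frac32}\bigl[(D_3+D_5)+D_3(1-z)x\bigr]F_3(\tfrac1w)\,dx,\\ \Lambda_2(z,R)&=D_4(1-z)\int_0^R x^{\alpha}(1+x)^{-H_1-\frac12}w^{2H_1-2H_2-1}F_4(\tfrac1w)\,dx,\\ \Lambda_3(z,R)&=-D_5\int_0^R x^{\alpha-1}(1+x)^{-H_1-\frac12}w^{2H_1-2H_2}F_5(\tfrac1w)\,dx. \end{aligned}$$ Finally, let $L=L_-$ for $0<s<u<T$ and $L=L_+$ for $0<u<s<T$, where, with $z=\tfrac su$ and $R=\tfrac{T-u}{u-s}$, $$L_-(u,s)=(T-u)^{\frac12-H_1}(u-s)^{H_1-\frac12}\Bigl[(D_3+D_5z)F_3(z)+D_4z^{\alpha}(1-z)F_4(z)-D_5z^{\alpha}F_5(z)\Bigr]+(H_1-\tfrac12)\sum_{j=1}^3\Psi_j(z,R),$$ and, with $z=\tfrac us$ and $R=\tfrac{T-s}{s-u}$, $$\begin{aligned}L_+(u,s)={}&D_1u^{\frac12-H_1}s^{2H_2-2}(s-u)^{\frac32+H_1-2H_2}\bigl[F_1(z)+(H_1-\tfrac12)\Phi_1(z)\bigr]+D_2z^{\frac32-H_1}F_2(z)\\&+(H_1-\tfrac12)D_2z^{\frac12-H_1}\Phi_2(z)-(H_1-\tfrac12)z^{\frac12-H_1}\sum_{j=1}^3\Lambda_j(z,R).\end{aligned}$$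 **Theorem.** All derivatives and integrals above exist (the integrals converge absolutely). Moreover: 1. $\alpha,\beta\in(0,1)$, and $F_1,F_3\in C^{\alpha}([0,1])$, $F_2,F_4,F_5\in C^{\beta}([0,1])$ (Hölder spaces). 2. $\Phi_1,\Phi_2$ are bounded and continuous on $[0,1]$; $\Psi_j,\Lambda_j$ ($j=1,2,3$) are bounded and continuous on $(0,1)\times(0,\infty)$. 3. For all $u,s\in(0,T)$ with $u\ne s$, $\;K(u,s)=|u-s|^{2H_2-2H_1-1}L(u,s)$. 4. There is a number $\ell$ such that for every $t\in(0,T)$ $$\lim_{\substack{(u,s)\to(t,t)\\0<s<u<T}}L_-(u,s)=\lim_{\substack{(u,s)\to(t,t)\\0<u<s<T}}L_+(u,s)=\ell ;$$ that is, the one-sided limits exist, do not depend on $t$, and coincide. 5. Hence $L$ extends to a continuous function on $(0,T)^2$, including the diagonal. -/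

import Mathlib

open Set Filter Topology MeasureTheory

noncomputable section

namespace TwoFBM

/-! ### The kernel `K` -/

/-- The inner integral whose derivative in `u` is `ψ(u,s)`, for `0 < u < s`. -/
def psiInner (H₁ H₂ u s : ℝ) : ℝ :=
  ∫ t in (0 : ℝ)..u, (u - t) ^ (1 / 2 - H₁) * t ^ (1 / 2 - H₁) * (s - t) ^ (2 * H₂ - 2)

/-- The inner integral whose derivative in `u` is `φ(u,s)`, for `0 < s < u`. -/
def phiInner (H₁ H₂ u s : ℝ) : ℝ :=
  ∫ t in s..u, (u - t) ^ (1 / 2 - H₁) * t ^ (1 / 2 - H₁) * (t - s) ^ (2 * H₂ - 2)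

/-- The inner integral whose derivative in `u` is `τ(u,s)`, for `0 < s < u`. -/
def tauInner (H₁ H₂ u s : ℝ) : ℝ :=
  ∫ t in (0 : ℝ)..s, (u - t) ^ (1 / 2 - H₁) * t ^ (1 / 2 - H₁) * (s - t) ^ (2 * H₂ - 2)

/-- `ψ(u,s)`, for `0 < u < s < T`. -/
def psi (H₁ H₂ u s : ℝ) : ℝ := deriv (fun v => psiInner H₁ H₂ v s) u

/-- `φ(u,s)`, for `0 < s < u < T`. -/
def phi (H₁ H₂ u s : ℝ) : ℝ := deriv (fun v => phiInner H₁ H₂ v s) u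

/-- `τ(u,s)`, for `0 < s < u < T`. -/
def tau (H₁ H₂ u s : ℝ) : ℝ := deriv (fun v => tauInner H₁ H₂ v s) u

/-- `ρ = φ + τ`. -/
def rho (H₁ H₂ u s : ℝ) : ℝ := phi H₁ H₂ u s + tau H₁ H₂ u s

/-- Integrand (in `t`, over `(u,T)`) of the integral in `K₋`. -/
def KminusIntegrand (H₁ H₂ u s t : ℝ) : ℝ :=
  (u ^ (2 * H₁ - 1) * rho H₁ H₂ u s - t ^ (2 * H₁ - 1) * rho H₁ H₂ t s) /
    (t - u) ^ (H₁ + 1 / 2)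

/-- Integrand (in `t`, over `(u,s)`) of the first integral in `K₊`. -/
def KplusIntegrand₁ (H₁ H₂ u s t : ℝ) : ℝ :=
  (u ^ (2 * H₁ - 1) * psi H₁ H₂ u s - t ^ (2 * H₁ - 1) * psi H₁ H₂ t s) /
    (t - u) ^ (H₁ + 1 / 2)

/-- Integrand (in `t`, over `(s,T)`) of the second integral in `K₊`. -/
def KplusIntegrand₂ (H₁ H₂ u s t : ℝ) : ℝ :=
  (t - u) ^ (-1 / 2 - H₁) * t ^ (2 * H₁ - 1) * rho H₁ H₂ t s

/-- `K₋(u,s)`, for `0 < s < u < T`. -/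
def Kminus (H₁ H₂ T u s : ℝ) : ℝ :=
  u ^ (H₁ - 1 / 2) * (T - u) ^ (1 / 2 - H₁) * rho H₁ H₂ u s
    + (H₁ - 1 / 2) * u ^ (1 / 2 - H₁) * ∫ t in u..T, KminusIntegrand H₁ H₂ u s t

/-- `K₊(u,s)`, for `0 < u < s < T`. -/
def Kplus (H₁ H₂ T u s : ℝ) : ℝ :=
  u ^ (H₁ - 1 / 2) * (s - u) ^ (1 / 2 - H₁) * psi H₁ H₂ u s
    + (H₁ - 1 / 2) * u ^ (1 / 2 - H₁) * (∫ t in u..s, KplusIntegrand₁ H₁ H₂ u s t)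
    - (H₁ - 1 / 2) * u ^ (1 / 2 - H₁) * ∫ t in s..T, KplusIntegrand₂ H₁ H₂ u s t

/-- The kernel `K(u,s)`; only its values at `u ≠ s` are meaningful. -/
def K (H₁ H₂ T u s : ℝ) : ℝ :=
  if s < u then Kminus H₁ H₂ T u s else Kplus H₁ H₂ T u s

/-! ### Constants and hypergeometric functions -/

/-- The Hölder exponent `α`. -/
def alpha (H₁ H₂ : ℝ) : ℝ := 2 * H₂ - H₁ - 1 / 2

/-- The Hölder exponent `β = 1 - α`. -/
def beta (H₁ H₂ : ℝ) : ℝ := 3 / 2 - 2 * H₂ + H₁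

/- `ProbabilityTheory.beta` is the Euler beta function `Γ(a)Γ(b)/Γ(a+b)`. -/

def D₁ (H₁ : ℝ) : ℝ := 2 * (1 - H₁) * ProbabilityTheory.beta (3 / 2 - H₁) (3 / 2 - H₁)

def D₂ (H₁ H₂ : ℝ) : ℝ := (1 - H₂) * ProbabilityTheory.beta (3 / 2 - H₁) (3 / 2 - H₁)

def D₃ (H₁ H₂ : ℝ) : ℝ := 2 * (H₂ - H₁) * ProbabilityTheory.beta (3 / 2 - H₁) (2 * H₂ - 1)

def D₄ (H₁ H₂ : ℝ) : ℝ :=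
  (H₁ - 1 / 2) * (3 / 2 - H₁) / (2 * H₂ - H₁ + 1 / 2) *
    ProbabilityTheory.beta (3 / 2 - H₁) (2 * H₂ - 1)

def D₅ (H₁ H₂ : ℝ) : ℝ := (H₁ - 1 / 2) * ProbabilityTheory.beta (3 / 2 - H₁) (2 * H₂ - 1)

/- In each of the following `c - a - b ∈ (0,1)`, so that the Gauss series also converges when its
argument is `1`; its sum there is the value of the continuous extension. -/

def F₁ (H₁ H₂ z : ℝ) : ℝ := ₂F₁ (2 - 2 * H₂) (3 / 2 - H₁) (3 - 2 * H₁) z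

def F₂ (H₁ H₂ z : ℝ) : ℝ := ₂F₁ (1 + 2 * H₂ - 2 * H₁) (3 / 2 - H₁) (4 - 2 * H₁) z

def F₃ (H₁ H₂ z : ℝ) : ℝ := ₂F₁ (H₁ - 1 / 2) (3 / 2 - H₁) (2 * H₂ - H₁ + 1 / 2) (1 - z)

def F₄ (H₁ H₂ z : ℝ) : ℝ :=
  ₂F₁ (2 * H₂ - 2 * H₁ + 1) (2 * H₂ - 1) (2 * H₂ - H₁ + 3 / 2) (1 - z)

def F₅ (H₁ H₂ z : ℝ) : ℝ := ₂F₁ (2 * H₂ - 2 * H₁) (2 * H₂ - 1) (2 * H₂ - H₁ + 1 / 2) z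

/-! ### The functions `Φ_j` on `[0,1]` -/

def Phi₁Integrand (H₁ H₂ z y : ℝ) : ℝ :=
  (F₁ H₁ H₂ z - F₁ H₁ H₂ (z + (1 - z) * y)) / y ^ (H₁ + 1 / 2)

def Phi₂Integrand (H₁ H₂ z y : ℝ) : ℝ :=
  (z * F₂ H₁ H₂ z
      - (z + (1 - z) * y) * (1 - y) ^ (2 * H₂ - H₁ - 3 / 2) * F₂ H₁ H₂ (z + (1 - z) * y))
    / y ^ (H₁ + 1 / 2)

def Phi₁ (H₁ H₂ z : ℝ) : ℝ := ∫ y in (0 : ℝ)..1, Phi₁Integrand H₁ H₂ z y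

def Phi₂ (H₁ H₂ z : ℝ) : ℝ := ∫ y in (0 : ℝ)..1, Phi₂Integrand H₁ H₂ z y

/-! ### The functions `Ψ_j` on `(0,1) × (0,∞)` -/

/-- `w = 1 + (1 - z) x`; thus `z_x = z / w` and `y_x = 1 / w`. -/
def w (z x : ℝ) : ℝ := 1 + (1 - z) * x

def Psi₁Integrand (H₁ H₂ z x : ℝ) : ℝ :=
  x ^ (-H₁ - 1 / 2) *
    ((D₃ H₁ H₂ + D₅ H₁ H₂ * z) * F₃ H₁ H₂ z
      - (1 + x) ^ (2 * H₂ - H₁ - 3 / 2) * w z x ^ (H₁ - 1 / 2)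
          * (D₃ H₁ H₂ + D₅ H₁ H₂ * (z / w z x)) * F₃ H₁ H₂ (z / w z x))

def Psi₂Integrand (H₁ H₂ z x : ℝ) : ℝ :=
  (F₄ H₁ H₂ z
      - (1 + x) ^ (2 * H₂ - H₁ - 1 / 2) * w z x ^ (2 * H₁ - 2 * H₂ - 1) * F₄ H₁ H₂ (z / w z x))
    / x ^ (H₁ + 1 / 2)

def Psi₃Integrand (H₁ H₂ z x : ℝ) : ℝ :=
  (F₅ H₁ H₂ z
      - (1 + x) ^ (2 * H₂ - H₁ - 3 / 2) * w z x ^ (2 * H₁ - 2 * H₂) * F₅ H₁ H₂ (z / w z x))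
    / x ^ (H₁ + 1 / 2)

def Psi₁ (H₁ H₂ z R : ℝ) : ℝ := ∫ x in (0 : ℝ)..R, Psi₁Integrand H₁ H₂ z x

def Psi₂ (H₁ H₂ z R : ℝ) : ℝ :=
  D₄ H₁ H₂ * z ^ (2 * H₂ - H₁ - 1 / 2) * (1 - z) * ∫ x in (0 : ℝ)..R, Psi₂Integrand H₁ H₂ z x

def Psi₃ (H₁ H₂ z R : ℝ) : ℝ :=
  -D₅ H₁ H₂ * z ^ (2 * H₂ - H₁ - 1 / 2) * ∫ x in (0 : ℝ)..R, Psi₃Integrand H₁ H₂ z x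

/-! ### The functions `Λ_j` on `(0,1) × (0,∞)` -/

def Lambda₁Integrand (H₁ H₂ z x : ℝ) : ℝ :=
  x ^ (2 * H₂ - H₁ - 3 / 2) * (1 + x) ^ (-H₁ - 1 / 2) * w z x ^ (H₁ - 3 / 2)
    * ((D₃ H₁ H₂ + D₅ H₁ H₂) + D₃ H₁ H₂ * (1 - z) * x) * F₃ H₁ H₂ (1 / w z x)

def Lambda₂Integrand (H₁ H₂ z x : ℝ) : ℝ :=
  x ^ (2 * H₂ - H₁ - 1 / 2) * (1 + x) ^ (-H₁ - 1 / 2) * w z x ^ (2 * H₁ - 2 * H₂ - 1)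
    * F₄ H₁ H₂ (1 / w z x)

def Lambda₃Integrand (H₁ H₂ z x : ℝ) : ℝ :=
  x ^ (2 * H₂ - H₁ - 3 / 2) * (1 + x) ^ (-H₁ - 1 / 2) * w z x ^ (2 * H₁ - 2 * H₂)
    * F₅ H₁ H₂ (1 / w z x)

def Lambda₁ (H₁ H₂ z R : ℝ) : ℝ := ∫ x in (0 : ℝ)..R, Lambda₁Integrand H₁ H₂ z x

def Lambda₂ (H₁ H₂ z R : ℝ) : ℝ :=
  D₄ H₁ H₂ * (1 - z) * ∫ x in (0 : ℝ)..R, Lambda₂Integrand H₁ H₂ z x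

def Lambda₃ (H₁ H₂ z R : ℝ) : ℝ :=
  -D₅ H₁ H₂ * ∫ x in (0 : ℝ)..R, Lambda₃Integrand H₁ H₂ z x

/-! ### The factor `L` -/

/-- `L₋(u,s)`, for `0 < s < u < T`. -/
def Lminus (H₁ H₂ T u s : ℝ) : ℝ :=
  (T - u) ^ (1 / 2 - H₁) * (u - s) ^ (H₁ - 1 / 2) *
      ((D₃ H₁ H₂ + D₅ H₁ H₂ * (s / u)) * F₃ H₁ H₂ (s / u)
        + D₄ H₁ H₂ * (s / u) ^ (2 * H₂ - H₁ - 1 / 2) * (1 - s / u) * F₄ H₁ H₂ (s / u)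
        - D₅ H₁ H₂ * (s / u) ^ (2 * H₂ - H₁ - 1 / 2) * F₅ H₁ H₂ (s / u))
    + (H₁ - 1 / 2) *
      (Psi₁ H₁ H₂ (s / u) ((T - u) / (u - s)) + Psi₂ H₁ H₂ (s / u) ((T - u) / (u - s))
        + Psi₃ H₁ H₂ (s / u) ((T - u) / (u - s)))

/-- `L₊(u,s)`, for `0 < u < s < T`. -/
def Lplus (H₁ H₂ T u s : ℝ) : ℝ :=
  D₁ H₁ * u ^ (1 / 2 - H₁) * s ^ (2 * H₂ - 2) * (s - u) ^ (3 / 2 + H₁ - 2 * H₂) *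
      (F₁ H₁ H₂ (u / s) + (H₁ - 1 / 2) * Phi₁ H₁ H₂ (u / s))
    + D₂ H₁ H₂ * (u / s) ^ (3 / 2 - H₁) * F₂ H₁ H₂ (u / s)
    + (H₁ - 1 / 2) * D₂ H₁ H₂ * (u / s) ^ (1 / 2 - H₁) * Phi₂ H₁ H₂ (u / s)
    - (H₁ - 1 / 2) * (u / s) ^ (1 / 2 - H₁) *
      (Lambda₁ H₁ H₂ (u / s) ((T - s) / (s - u)) + Lambda₂ H₁ H₂ (u / s) ((T - s) / (s - u))
        + Lambda₃ H₁ H₂ (u / s) ((T - s) / (s - u)))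

/-- The factor `L(u,s)`; only its values at `u ≠ s` are meaningful. -/
def L (H₁ H₂ T u s : ℝ) : ℝ :=
  if s < u then Lminus H₁ H₂ T u s else Lplus H₁ H₂ T u s

/-- `f` is Hölder continuous on `[0,1]` with exponent `r`. -/
def HolderOnUnit (r : ℝ) (f : ℝ → ℝ) : Prop :=
  ∃ C : ℝ, ∀ x ∈ Icc (0 : ℝ) 1, ∀ y ∈ Icc (0 : ℝ) 1, |f x - f y| ≤ C * |x - y| ^ r

/-- `f` is continuous and bounded on `S`. -/
def BddContOn {X : Type*} [TopologicalSpace X] (f : X → ℝ) (S : Set X) : Prop :=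
  ContinuousOn f S ∧ ∃ C : ℝ, ∀ x ∈ S, |f x| ≤ C

end TwoFBM

end

open TwoFBM

/-!
On `[0, 1]` each `F_j`, times a Beta value, is an Euler integral
`∫₀¹ t ^ (p - 1) (1 - t) ^ (q - 1) (1 - z t) ^ (-a) dt` with `0 ≤ a < q` and `q - a < 1` (with
`1 - z` in place of `z` for `F₃` and `F₄`); since the terms of the series are nonnegative this
remains true at `z = 1` (`hypergeometric_mul_beta`). The involution `t ↦ (1 - t) / (1 - z t)`
gives Euler's transformation (`eulerIntegral_transform`). It shows that the derivative of the Euler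
integral is `(1 - z) ^ (q - a - 1)` times a bounded function, which yields Hölder continuity of
exponent `q - a` (`holderOnUnit_eulerIntegral`), and that exponent is `α` or `β`. After scaling, the
inner integrals of `ψ`, `φ` and `τ` are Euler integrals too, so the same transformation computes
their derivatives: `u ^ (2 H₁ - 1) ψ(u, s)` in terms of `F₁`, `F₂` and `u / s` (`psi_eq`), and
`u ^ (H₁ - 1/2) ρ(u, s) = (u - s) ^ (α - 1) G(s / u)` with an explicit profile `G` built from
`F₃`, `F₄`, `F₅` (`rho_eq`).

The factorization `K = |u - s| ^ (2 H₂ - 2 H₁ - 1) L` then is a change of variables. Putting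
`t = u + (u - s) x` in `K₋`, and `t = s + (s - u) x` in the last integral of `K₊`, turns `t` into
`u w`, respectively `s w`, and the argument `s / t` into `z / w`, respectively `1 / w`; in the
remaining integral, `t = u + (s - u) y` (`Kminus_eq`, `Kplus_eq`).

Convergence, boundedness and continuity all come from integrable bounds that are uniform in `z`, up
to and including `z = 1`. For `Ψ_j` they rest on `0 ≤ z - z / w ≤ x / (1 + x)` and on the fact that
the weights in front of `F_j(z / w)` differ from `1` by at most `x / (1 + x)` (for `j = 2`, only
after multiplication by `1 - z`). Because the Hölder exponents `α` and `β` exceed `H₁ - 1/2`, the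
singularity `x ^ (-H₁ - 1/2)` becomes integrable at the origin
(`dominatedOn_weighted_difference`); the `Φ_j` are treated in the same way on `(0, 1)`, and the
`Λ_j` are bounded directly (`dominatedOn_mul_comp`).

Near the diagonal `z → 1` and `R → ∞`, and dominated convergence gives both one-sided limits. At
`z = 1` one has `w = 1`, the second members of the two families vanish, and the integrals that remain
reduce to Beta integrals (`tendsto_Psi`, `tendsto_Lambda`, `Phi₂_one`). With the Gauss values of
`F₂(1)` and `F₅(1)` both limits are products of Gamma values; they agree by the reflection formula
and `sin² (π β) - sin² (π γ) = sin (π δ) sin (π (β + γ))`, where `γ = H₁ - 1/2` and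
`δ = 2 - 2 H₂ = β - γ` (`beta_identity`, `limit_eq`).
-/

namespace TwoFBM

/-! ### Euler integrals -/

theorem ofReal_betaIntegrand (p q : ℝ) {t : ℝ} (ht : t ∈ uIoc (0 : ℝ) 1) :
    (t : ℂ) ^ ((p : ℂ) - 1) * (1 - (t : ℂ)) ^ ((q : ℂ) - 1)
      = ((t ^ (p - 1) * (1 - t) ^ (q - 1) : ℝ) : ℂ) := by
  rw [uIoc_of_le zero_le_one] at ht
  rw [Complex.ofReal_mul, Complex.ofReal_cpow ht.1.le, Complex.ofReal_cpow (by linarith [ht.2])]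
  push_cast
  rfl

theorem intervalIntegrable_beta {p q : ℝ} (hp : 0 < p) (hq : 0 < q) :
    IntervalIntegrable (fun t : ℝ => t ^ (p - 1) * (1 - t) ^ (q - 1)) volume 0 1 := by
  have h := Complex.betaIntegral_convergent (u := p) (v := q) (by simpa) (by simpa)
  have h2 : IntervalIntegrable (fun t : ℝ => ((t ^ (p - 1) * (1 - t) ^ (q - 1) : ℝ) : ℂ))
      volume 0 1 := h.congr fun t ht => ofReal_betaIntegrand p q ht
  rw [intervalIntegrable_iff] at h2 ⊢
  exact h2.re

theorem integral_beta {p q : ℝ} (hp : 0 < p) (hq : 0 < q) :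
    ∫ t in (0 : ℝ)..1, t ^ (p - 1) * (1 - t) ^ (q - 1) = ProbabilityTheory.beta p q := by
  rw [ProbabilityTheory.beta_eq_betaIntegralReal p q hp hq, Complex.betaIntegral,
    intervalIntegral.integral_congr_ae (Eventually.of_forall fun t ht =>
      ofReal_betaIntegrand p q ht), intervalIntegral.integral_ofReal, Complex.ofReal_re]

/-- The integrand of Euler's integral `∫₀¹ t ^ (p - 1) (1 - t) ^ (q - 1) (1 - z t) ^ (-a) dt`. -/
noncomputable def eulerIntegrand (p q a z t : ℝ) : ℝ :=
  t ^ (p - 1) * (1 - t) ^ (q - 1) * (1 - z * t) ^ (-a)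

/-- Euler's integral, equal to `B(p, q) ₂F₁(a, p; p + q; z)`. -/
noncomputable def eulerIntegral (p q a z : ℝ) : ℝ := ∫ t in (0 : ℝ)..1, eulerIntegrand p q a z t

theorem eulerIntegrand_nonneg (p q a : ℝ) {z t : ℝ} (hz : z ≤ 1) (ht : t ∈ Ioo (0 : ℝ) 1) :
    0 ≤ eulerIntegrand p q a z t := by
  have h1 : 0 ≤ 1 - t := by linarith [ht.2]
  have h2 : 0 ≤ 1 - z * t := by nlinarith [ht.1, ht.2]
  exact mul_nonneg (mul_nonneg (Real.rpow_nonneg ht.1.le _) (Real.rpow_nonneg h1 _))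
    (Real.rpow_nonneg h2 _)

theorem eulerIntegrand_one (p q a : ℝ) {t : ℝ} (ht : t ∈ Ioo (0 : ℝ) 1) :
    eulerIntegrand p q a 1 t = t ^ (p - 1) * (1 - t) ^ (q - a - 1) := by
  have h1 : 0 < 1 - t := by linarith [ht.2]
  rw [eulerIntegrand, one_mul, mul_assoc, ← Real.rpow_add h1]
  congr 2
  ring

theorem eulerIntegrand_mono (p q : ℝ) {a z z' t : ℝ} (ha : 0 ≤ a) (hzz : z ≤ z') (hz : z' ≤ 1)
    (ht : t ∈ Ioo (0 : ℝ) 1) : eulerIntegrand p q a z t ≤ eulerIntegrand p q a z' t := by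
  have h1 : 0 ≤ 1 - t := by linarith [ht.2]
  have h2 : 0 < 1 - z' * t := by nlinarith [ht.1, ht.2]
  refine mul_le_mul_of_nonneg_left ?_ (mul_nonneg (Real.rpow_nonneg ht.1.le _)
    (Real.rpow_nonneg h1 _))
  exact Real.rpow_le_rpow_of_nonpos h2 (by nlinarith [ht.1]) (by linarith)

theorem continuousOn_eulerIntegrand (p q a : ℝ) {z : ℝ} (hz : z ≤ 1) :
    ContinuousOn (eulerIntegrand p q a z) (Ioo 0 1) := by
  intro t ht
  have h1 : 1 - t ≠ 0 := by linarith [ht.2]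
  have h2 : 1 - z * t ≠ 0 := by nlinarith [ht.1, ht.2]
  refine ContinuousAt.continuousWithinAt ?_
  unfold eulerIntegrand
  refine ((continuousAt_id.rpow_const (Or.inl ht.1.ne')).mul ?_).mul ?_
  · exact ContinuousAt.rpow_const (by fun_prop) (Or.inl h1)
  · exact ContinuousAt.rpow_const (by fun_prop) (Or.inl h2)

theorem aestronglyMeasurable_eulerIntegrand (p q a : ℝ) {z : ℝ} (hz : z ≤ 1) :
    AEStronglyMeasurable (eulerIntegrand p q a z) (volume.restrict (Ioo 0 1)) :=
  (continuousOn_eulerIntegrand p q a hz).aestronglyMeasurable measurableSet_Ioo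

theorem eulerIntegral_eq (p q a z : ℝ) :
    eulerIntegral p q a z = ∫ t in Ioo (0 : ℝ) 1, eulerIntegrand p q a z t := by
  rw [eulerIntegral, intervalIntegral.integral_of_le zero_le_one, integral_Ioc_eq_integral_Ioo]

theorem integrableOn_eulerIntegrand_one {p q a : ℝ} (hp : 0 < p) (hq : a < q) :
    IntegrableOn (eulerIntegrand p q a 1) (Ioo 0 1) := by
  have h := intervalIntegrable_beta hp (sub_pos.2 hq)
  rw [intervalIntegrable_iff_integrableOn_Ioo_of_le zero_le_one] at h
  exact h.congr_fun (fun t ht => (eulerIntegrand_one p q a ht).symm) measurableSet_Ioo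

theorem integrableOn_eulerIntegrand {p q a z : ℝ} (hp : 0 < p) (ha : 0 ≤ a) (hq : a < q)
    (hz : z ≤ 1) : IntegrableOn (eulerIntegrand p q a z) (Ioo 0 1) := by
  refine (integrableOn_eulerIntegrand_one hp hq).mono'
    (aestronglyMeasurable_eulerIntegrand p q a hz) ?_
  filter_upwards [ae_restrict_mem measurableSet_Ioo] with t ht
  rw [Real.norm_of_nonneg (eulerIntegrand_nonneg p q a hz ht)]
  exact eulerIntegrand_mono p q ha hz le_rfl ht

/-- Away from `z = 1` the factor `(1 - z t) ^ (-a)` is bounded, whatever `a` is. -/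
theorem integrableOn_eulerIntegrand_of_lt {p q z : ℝ} (a : ℝ) (hp : 0 < p) (hq : 0 < q)
    (hz : z < 1) : IntegrableOn (eulerIntegrand p q a z) (Ioo 0 1) := by
  have h := intervalIntegrable_beta hp hq
  rw [← intervalIntegrable_iff_integrableOn_Ioo_of_le zero_le_one]
  refine h.mul_continuousOn ?_
  intro t ht
  rw [uIcc_of_le zero_le_one] at ht
  refine (ContinuousAt.rpow_const (by fun_prop) (Or.inl ?_)).continuousWithinAt
  have : 0 < 1 - z * t := by
    rcases le_or_gt z 0 with h0 | h0
    · nlinarith [ht.1]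
    · nlinarith [ht.2]
  exact this.ne'

theorem eulerIntegral_one {p q a : ℝ} (hp : 0 < p) (hq : a < q) :
    eulerIntegral p q a 1 = ProbabilityTheory.beta p (q - a) := by
  rw [← integral_beta hp (sub_pos.2 hq), eulerIntegral_eq,
    intervalIntegral.integral_of_le zero_le_one, integral_Ioc_eq_integral_Ioo]
  exact setIntegral_congr_fun measurableSet_Ioo fun t ht => eulerIntegrand_one p q a ht

theorem eulerIntegral_le {p q a z : ℝ} (hp : 0 < p) (ha : 0 ≤ a) (hq : a < q) (hz : z ≤ 1) :
    eulerIntegral p q a z ≤ ProbabilityTheory.beta p (q - a) := by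
  rw [← eulerIntegral_one hp hq, eulerIntegral_eq, eulerIntegral_eq]
  exact setIntegral_mono_on (integrableOn_eulerIntegrand hp ha hq hz)
    (integrableOn_eulerIntegrand_one hp hq) measurableSet_Ioo
    fun t ht => eulerIntegrand_mono p q ha hz le_rfl ht

theorem continuousOn_eulerIntegral {p q a : ℝ} (hp : 0 < p) (ha : 0 ≤ a) (hq : a < q) :
    ContinuousOn (eulerIntegral p q a) (Iic 1) := by
  intro z₀ hz₀
  simp only [ContinuousWithinAt, eulerIntegral_eq, funext (eulerIntegral_eq p q a)]
  refine tendsto_integral_filter_of_dominated_convergence (eulerIntegrand p q a 1) ?_ ?_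
    (integrableOn_eulerIntegrand_one hp hq) ?_
  · filter_upwards [self_mem_nhdsWithin] with z hz
    exact aestronglyMeasurable_eulerIntegrand p q a hz
  · filter_upwards [self_mem_nhdsWithin] with z hz
    filter_upwards [ae_restrict_mem measurableSet_Ioo] with t ht
    rw [Real.norm_of_nonneg (eulerIntegrand_nonneg p q a hz ht)]
    exact eulerIntegrand_mono p q ha hz le_rfl ht
  · filter_upwards [ae_restrict_mem measurableSet_Ioo] with t ht
    have h2 : 1 - z₀ * t ≠ 0 := by nlinarith [ht.1, ht.2, mem_Iic.1 hz₀]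
    refine Tendsto.mono_left ?_ nhdsWithin_le_nhds
    unfold eulerIntegrand
    refine Tendsto.const_mul _ ?_
    exact (ContinuousAt.rpow_const (f := fun z : ℝ => 1 - z * t) (by fun_prop) (Or.inl h2)).tendsto

theorem hasDerivAt_eulerIntegral {p q a z : ℝ} (hp : 0 < p) (hq : 0 < q) (ha : 0 ≤ a)
    (hz : z < 1) :
    HasDerivAt (eulerIntegral p q a) (a * eulerIntegral (p + 1) q (a + 1) z) z := by
  -- on `(-∞, r)`, with `z < r < 1`, the derivative of the integrand is largest at `r`
  set r := (1 + z) / 2 with hr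
  have hr1 : r < 1 := by rw [hr]; linarith
  have hzr : z < r := by rw [hr]; linarith
  have key := hasDerivAt_integral_of_dominated_loc_of_deriv_le (μ := volume.restrict (Ioo 0 1))
    (F := fun z t => eulerIntegrand p q a z t) (x₀ := z) (s := Iio r)
    (F' := fun z t => a * eulerIntegrand (p + 1) q (a + 1) z t)
    (bound := fun t => a * eulerIntegrand (p + 1) q (a + 1) r t) (Iio_mem_nhds hzr) ?_ ?_ ?_ ?_ ?_ ?_
  · have h2 := key.2
    rw [integral_const_mul, ← eulerIntegral_eq] at h2
    rwa [funext (eulerIntegral_eq p q a)]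
  · filter_upwards [Iio_mem_nhds hz] with x hx
    exact aestronglyMeasurable_eulerIntegrand p q a (le_of_lt hx)
  · exact integrableOn_eulerIntegrand_of_lt a hp hq hz
  · exact (aestronglyMeasurable_eulerIntegrand _ _ _ hz.le).const_mul a
  · filter_upwards [ae_restrict_mem measurableSet_Ioo] with t ht x hx
    have hx1 : x ≤ 1 := (lt_trans hx hr1).le
    rw [Real.norm_of_nonneg (mul_nonneg ha (eulerIntegrand_nonneg _ _ _ hx1 ht))]
    exact mul_le_mul_of_nonneg_left
      (eulerIntegrand_mono _ _ (by linarith) (le_of_lt hx) hr1.le ht) ha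
  · exact (integrableOn_eulerIntegrand_of_lt (a + 1) (by linarith) hq hr1).const_mul a
  · filter_upwards [ae_restrict_mem measurableSet_Ioo] with t ht x hx
    have h2 : 1 - x * t ≠ 0 := by nlinarith [ht.1, ht.2, mem_Iio.1 hx]
    unfold eulerIntegrand
    have h3 : HasDerivAt (fun x : ℝ => 1 - x * t) (-t) x := by
      simpa using ((hasDerivAt_id x).mul_const t).const_sub 1
    have h4 := (h3.rpow_const (p := -a) (Or.inl h2)).const_mul (t ^ (p - 1) * (1 - t) ^ (q - 1))
    refine h4.congr_deriv ?_
    rw [show p + 1 - 1 = (p - 1) + 1 by ring, Real.rpow_add ht.1, Real.rpow_one,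
      show -(a + 1) = -a - 1 by ring]
    ring

/-- Euler's transformation, by the involution `t ↦ (1 - t) / (1 - z t)` of the unit interval. -/
theorem eulerIntegral_transform (p q a : ℝ) {z : ℝ} (hz : z < 1) :
    eulerIntegral p q a z = (1 - z) ^ (q - a) * eulerIntegral q p (p + q - a) z := by
  have hpos : ∀ t ∈ Ioo (0 : ℝ) 1, 0 < 1 - z * t := by
    intro t ht
    nlinarith [ht.1, ht.2]
  have hz' : 0 < 1 - z := by linarith
  set f : ℝ → ℝ := fun t => (1 - t) / (1 - z * t) with hf
  have hmem : ∀ t ∈ Ioo (0 : ℝ) 1, f t ∈ Ioo (0 : ℝ) 1 := by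
    intro t ht
    have := hpos t ht
    refine ⟨div_pos (by linarith [ht.2]) this, ?_⟩
    rw [hf, div_lt_one this]
    nlinarith [ht.1]
  have hinv : ∀ t ∈ Ioo (0 : ℝ) 1, f (f t) = t := by
    intro t ht
    have h1 := hpos t ht
    have h2 := hpos _ (hmem t ht)
    have h3 : 1 - z * ((1 - t) / (1 - z * t)) = (1 - z) / (1 - z * t) := by field_simp; ring
    simp only [hf]
    have h4 : 1 - (1 - t) / (1 - z * t) = t * (1 - z) / (1 - z * t) := by
      rw [eq_div_iff h1.ne', sub_mul, div_mul_cancel₀ _ h1.ne']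
      ring
    rw [h3, h4, div_div_div_cancel_right₀ h1.ne', mul_div_cancel_right₀ _ hz'.ne']
  have himg : f '' Ioo 0 1 = Ioo 0 1 := by
    refine Subset.antisymm (image_subset_iff.2 hmem) fun t ht => ⟨f t, hmem t ht, hinv t ht⟩
  have hinj : InjOn f (Ioo 0 1) := fun x hx y hy hxy => by rw [← hinv x hx, hxy, hinv y hy]
  have hder : ∀ t ∈ Ioo (0 : ℝ) 1,
      HasDerivWithinAt f (-((1 - z) / (1 - z * t) ^ 2)) (Ioo 0 1) t := by
    intro t ht
    have h1 := (hpos t ht).ne'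
    have h2 : HasDerivAt (fun t : ℝ => 1 - t) (-1) t := by
      simpa using (hasDerivAt_id t).const_sub 1
    have h3 : HasDerivAt (fun t : ℝ => 1 - z * t) (-z) t := by
      simpa using ((hasDerivAt_id t).const_mul z).const_sub 1
    refine (h2.div h3 h1).hasDerivWithinAt.congr_deriv ?_
    field_simp
    ring
  rw [eulerIntegral_eq, eulerIntegral_eq]
  conv_lhs => rw [← himg]
  rw [integral_image_eq_integral_abs_deriv_smul measurableSet_Ioo hder hinj,
    ← integral_const_mul]
  refine setIntegral_congr_fun measurableSet_Ioo fun t ht => ?_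
  have h1 := hpos t ht
  have ht' : 0 < 1 - t := by linarith [ht.2]
  have e1 : 1 - f t = t * (1 - z) / (1 - z * t) := by
    simp only [hf]
    rw [eq_div_iff h1.ne', sub_mul, div_mul_cancel₀ _ h1.ne']
    ring
  have e2 : 1 - z * f t = (1 - z) / (1 - z * t) := by simp only [hf]; field_simp; ring
  simp only [eulerIntegrand, smul_eq_mul]
  rw [e1, e2, abs_neg, abs_of_pos (by positivity), hf]
  dsimp only
  rw [Real.div_rpow ht'.le h1.le, Real.div_rpow (by have := ht.1; positivity) h1.le,
    Real.div_rpow hz'.le h1.le, Real.mul_rpow ht.1.le hz'.le,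
    ← Real.rpow_natCast (1 - z * t) 2]
  have e3 : (1 - z) ^ (q - a) = (1 - z) * ((1 - z) ^ (q - 1) * (1 - z) ^ (-a)) := by
    rw [← Real.rpow_add hz']
    nth_rewrite 2 [← Real.rpow_one (1 - z)]
    rw [← Real.rpow_add hz']
    congr 1
    ring
  have e4 : (1 - z * t) ^ (-(p + q - a)) = ((1 - z * t) ^ ((2 : ℕ) : ℝ))⁻¹ *
      ((1 - z * t) ^ (p - 1))⁻¹ * ((1 - z * t) ^ (q - 1))⁻¹ * ((1 - z * t) ^ (-a))⁻¹ := by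
    simp only [← Real.rpow_neg h1.le, ← Real.rpow_add h1]
    congr 1
    push_cast
    ring
  rw [e3, e4]
  simp only [div_eq_mul_inv]
  ring

/-! ### Gauss' series on the closed unit interval -/

theorem hasSum_one_sub_rpow (a : ℝ) {x : ℝ} (hx : |x| < 1) :
    HasSum (fun n : ℕ => ((n.factorial : ℝ)⁻¹ * (ascPochhammer ℝ n).eval a) * x ^ n)
      ((1 - x) ^ (-a)) := by
  have h := (Real.one_div_one_sub_rpow_hasFPowerSeriesOnBall_zero a).hasSum_sub (y := x)
    (by simpa [enorm_eq_nnnorm, ← NNReal.coe_lt_coe] using hx)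
  have e : (1 : ℝ) / (1 - x) ^ a = (1 - x) ^ (-a) := by
    rw [Real.rpow_neg (by linarith [(abs_lt.1 hx).2]), one_div]
  rw [e] at h
  refine h.congr_fun fun n => ?_
  have h1 := Ring.factorial_nsmul_multichoose_eq_ascPochhammer a n
  rw [Polynomial.ascPochhammer_smeval_eq_eval, nsmul_eq_mul, Ring.multichoose_eq] at h1
  have h2 : (n.factorial : ℝ) ≠ 0 := by positivity
  rw [FormalMultilinearSeries.ofScalars_apply_eq, ← h1, inv_mul_cancel_left₀ h2, sub_zero,
    smul_eq_mul]

theorem beta_add_nat {p q : ℝ} (hp : 0 < p) (hq : 0 < q) (n : ℕ) :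
    ProbabilityTheory.beta (p + n) q = ProbabilityTheory.beta p q *
      ((ascPochhammer ℝ n).eval p * ((ascPochhammer ℝ n).eval (p + q))⁻¹) := by
  induction n with
  | zero => simp
  | succ n ih =>
    have h1 : 0 < p + n := by positivity
    have h2 : 0 < p + q + n := by positivity
    have h3 : (0 : ℝ) < (ascPochhammer ℝ n).eval (p + q) := ascPochhammer_pos n _ (by positivity)
    have h4 : ProbabilityTheory.beta (p + (n + 1 : ℕ)) q
        = (p + n) / (p + q + n) * ProbabilityTheory.beta (p + n) q := by
      have h5 := (Real.Gamma_pos_of_pos (show 0 < p + n + q by positivity)).ne'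
      rw [ProbabilityTheory.beta, ProbabilityTheory.beta,
        show p + ((n + 1 : ℕ) : ℝ) = p + n + 1 by push_cast; ring,
        Real.Gamma_add_one h1.ne', show p + n + 1 + q = p + n + q + 1 by ring,
        Real.Gamma_add_one (by positivity : p + n + q ≠ 0)]
      have h6 : p + n + q ≠ 0 := by positivity
      rw [show p + q + n = p + n + q by ring]
      field_simp
    rw [h4, ih, ascPochhammer_succ_eval, ascPochhammer_succ_eval]
    field_simp

/-- Euler's integral representation, up to and including `z = 1`, where the series is integrated
termwise with the integrand itself as dominating function. -/
theorem hypergeometric_mul_beta {p q a z : ℝ} (hp : 0 < p) (ha : 0 ≤ a) (hq : a < q)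
    (hz : z ∈ Icc (0 : ℝ) 1) :
    ₂F₁ a p (p + q) z * ProbabilityTheory.beta p q = eulerIntegral p q a z := by
  have hq0 : 0 < q := ha.trans_lt hq
  set c : ℕ → ℝ := fun n => (n.factorial : ℝ)⁻¹ * (ascPochhammer ℝ n).eval a with hc
  have hc0 : ∀ n, 0 ≤ c n := by
    intro n
    refine mul_nonneg (by positivity) ?_
    rcases ha.eq_or_lt with h | h
    · rw [← h]
      rcases n with _ | n <;> simp
    · exact (ascPochhammer_pos n a h).le
  set F : ℕ → ℝ → ℝ := fun n t => c n * z ^ n * (t ^ (p + n - 1) * (1 - t) ^ (q - 1)) with hF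
  have hF0 : ∀ n, ∀ t ∈ Ioo (0 : ℝ) 1, 0 ≤ F n t := by
    intro n t ht
    have h1 : 0 ≤ 1 - t := by linarith [ht.2]
    exact mul_nonneg (mul_nonneg (hc0 n) (pow_nonneg hz.1 n))
      (mul_nonneg (Real.rpow_nonneg ht.1.le _) (Real.rpow_nonneg h1 _))
  have hint : ∀ n, IntegrableOn (F n) (Ioo 0 1) := by
    intro n
    have h := intervalIntegrable_beta (show 0 < p + n by positivity) hq0
    rw [intervalIntegrable_iff_integrableOn_Ioo_of_le zero_le_one] at h
    exact h.const_mul _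
  have hsum : ∀ t ∈ Ioo (0 : ℝ) 1, HasSum (fun n => F n t) (eulerIntegrand p q a z t) := by
    intro t ht
    have h1 : |z * t| < 1 := by
      rw [abs_of_nonneg (mul_nonneg hz.1 ht.1.le)]
      nlinarith [hz.1, hz.2, ht.1, ht.2]
    refine ((hasSum_one_sub_rpow a h1).mul_left (t ^ (p - 1) * (1 - t) ^ (q - 1))).congr_fun ?_
    intro n
    rw [hF, mul_pow]
    dsimp only
    rw [show p + (n : ℝ) - 1 = (p - 1) + n by ring, Real.rpow_add ht.1, Real.rpow_natCast]
    ring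
  have key : HasSum (fun n => ∫ t in Ioo (0 : ℝ) 1, F n t)
      (∫ t in Ioo (0 : ℝ) 1, eulerIntegrand p q a z t) := by
    refine hasSum_integral_of_dominated_convergence F (fun n => (hint n).1) ?_ ?_ ?_ ?_
    · intro n
      filter_upwards [ae_restrict_mem measurableSet_Ioo] with t ht
      rw [Real.norm_of_nonneg (hF0 n t ht)]
    · filter_upwards [ae_restrict_mem measurableSet_Ioo] with t ht
      exact (hsum t ht).summable
    · refine (integrableOn_eulerIntegrand hp ha hq hz.2).congr_fun ?_ measurableSet_Ioo
      exact fun t ht => (hsum t ht).tsum_eq.symm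
    · filter_upwards [ae_restrict_mem measurableSet_Ioo] with t ht
      exact hsum t ht
  rw [eulerIntegral_eq, ← key.tsum_eq, ordinaryHypergeometric_eq_tsum, ← tsum_mul_right]
  refine tsum_congr fun n => ?_
  have h1 : ∫ t in Ioo (0 : ℝ) 1, F n t = c n * z ^ n * ProbabilityTheory.beta (p + n) q := by
    rw [hF]
    dsimp only
    rw [integral_const_mul, ← integral_beta (show 0 < p + n by positivity) hq0,
      intervalIntegral.integral_of_le zero_le_one, integral_Ioc_eq_integral_Ioo]
  rw [h1, beta_add_nat hp hq0, hc, smul_eq_mul]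
  ring

/-! ### Hölder continuity -/

theorem HolderOnUnit.continuousOn {r : ℝ} {f : ℝ → ℝ} (hr : 0 < r) (hf : HolderOnUnit r f) :
    ContinuousOn f (Icc 0 1) := by
  obtain ⟨C, hC⟩ := hf
  intro x hx
  rw [ContinuousWithinAt, tendsto_iff_dist_tendsto_zero]
  have h : Tendsto (fun y : ℝ => C * |y - x| ^ r) (𝓝[Icc 0 1] x) (𝓝 (C * |x - x| ^ r)) := by
    refine Tendsto.mono_left (ContinuousAt.tendsto ?_) nhdsWithin_le_nhds
    refine ContinuousAt.mul continuousAt_const ?_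
    exact ContinuousAt.rpow_const (by fun_prop) (Or.inr hr.le)
  rw [sub_self, abs_zero, Real.zero_rpow hr.ne', mul_zero] at h
  refine squeeze_zero' (Eventually.of_forall fun _ => dist_nonneg) ?_ h
  filter_upwards [self_mem_nhdsWithin] with y hy
  exact hC y hy x hx

theorem HolderOnUnit.exists_abs_le {r : ℝ} {f : ℝ → ℝ} (hr : 0 < r) (hf : HolderOnUnit r f) :
    ∃ C : ℝ, ∀ x ∈ Icc (0 : ℝ) 1, |f x| ≤ C :=
  isCompact_Icc.exists_bound_of_continuousOn (hf.continuousOn hr)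

/-- A Hölder constant that is nonnegative and also bounds the function itself. -/
theorem HolderOnUnit.exists_const {r : ℝ} {f : ℝ → ℝ} (hr : 0 < r) (hf : HolderOnUnit r f) :
    ∃ C : ℝ, 0 ≤ C ∧ (∀ x ∈ Icc (0 : ℝ) 1, |f x| ≤ C) ∧
      ∀ x ∈ Icc (0 : ℝ) 1, ∀ y ∈ Icc (0 : ℝ) 1, |f x - f y| ≤ C * |x - y| ^ r := by
  obtain ⟨M, hM⟩ := hf.exists_abs_le hr
  obtain ⟨C, hC⟩ := hf
  refine ⟨max C M, ?_, fun x hx => (hM x hx).trans (le_max_right _ _), fun x hx y hy =>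
    (hC x hx y hy).trans (mul_le_mul_of_nonneg_right (le_max_left _ _) (by positivity))⟩
  exact (abs_nonneg _).trans ((hM 0 ⟨le_rfl, zero_le_one⟩).trans (le_max_right _ _))

theorem HolderOnUnit.const_mul {r : ℝ} {f : ℝ → ℝ} (hf : HolderOnUnit r f) (c : ℝ) :
    HolderOnUnit r fun x => c * f x := by
  obtain ⟨C, hC⟩ := hf
  refine ⟨|c| * C, fun x hx y hy => ?_⟩
  rw [← mul_sub, abs_mul, mul_assoc]
  exact mul_le_mul_of_nonneg_left (hC x hx y hy) (abs_nonneg c)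

theorem HolderOnUnit.congr {r : ℝ} {f g : ℝ → ℝ} (hf : HolderOnUnit r f)
    (h : ∀ x ∈ Icc (0 : ℝ) 1, f x = g x) : HolderOnUnit r g := by
  obtain ⟨C, hC⟩ := hf
  exact ⟨C, fun x hx y hy => by rw [← h x hx, ← h y hy]; exact hC x hx y hy⟩

theorem HolderOnUnit.comp_one_sub {r : ℝ} {f : ℝ → ℝ} (hf : HolderOnUnit r f) :
    HolderOnUnit r fun x => f (1 - x) := by
  obtain ⟨C, hC⟩ := hf
  refine ⟨C, fun x hx y hy => ?_⟩
  have h := hC (1 - x) ⟨by linarith [hx.2], by linarith [hx.1]⟩ (1 - y)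
    ⟨by linarith [hy.2], by linarith [hy.1]⟩
  rwa [show 1 - x - (1 - y) = -(x - y) by ring, abs_neg] at h

theorem HolderOnUnit.affine_mul {r : ℝ} {f : ℝ → ℝ} (hr : 0 < r) (hr1 : r ≤ 1)
    (hf : HolderOnUnit r f) (c d : ℝ) : HolderOnUnit r fun x => (c + d * x) * f x := by
  obtain ⟨C, hC0, hCb, hC⟩ := hf.exists_const hr
  refine ⟨(|c| + |d|) * C + |d| * C, fun x hx y hy => ?_⟩
  have h1 : |x - y| ≤ |x - y| ^ r := by
    refine Real.self_le_rpow_of_le_one (abs_nonneg _) ?_ hr1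
    rw [abs_le]
    constructor <;> linarith [hx.1, hx.2, hy.1, hy.2]
  have h2 : |c + d * x| ≤ |c| + |d| := by
    refine (abs_add_le _ _).trans (add_le_add le_rfl ?_)
    rw [abs_mul, abs_of_nonneg hx.1]
    nlinarith [abs_nonneg d, hx.2]
  calc |(c + d * x) * f x - (c + d * y) * f y|
      = |(c + d * x) * (f x - f y) + d * (x - y) * f y| := by congr 1; ring
    _ ≤ |c + d * x| * |f x - f y| + |d| * |x - y| * |f y| := by
        refine (abs_add_le _ _).trans ?_
        rw [abs_mul, abs_mul, abs_mul]
    _ ≤ (|c| + |d|) * (C * |x - y| ^ r) + |d| * |x - y| ^ r * C := by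
        gcongr
        · exact hC x hx y hy
        · exact hCb y hy
    _ = ((|c| + |d|) * C + |d| * C) * |x - y| ^ r := by ring

/-- By Euler's transformation the derivative is at most a multiple of `(1 - z) ^ (q - a - 1)`;
comparison with `(1 - z) ^ (q - a)` gives the modulus of continuity. -/
theorem holderOnUnit_eulerIntegral {p q a : ℝ} (hp : 0 < p) (ha : 0 ≤ a) (hq : a < q)
    (hq1 : q - a < 1) : HolderOnUnit (q - a) (eulerIntegral p q a) := by
  have hq0 : 0 < q := ha.trans_lt hq
  set σ := q - a with hσ
  have hσ0 : 0 < σ := sub_pos.2 hq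
  set M := a * ProbabilityTheory.beta q (1 - σ) / σ with hM
  have hM0 : 0 ≤ M := by
    have := ProbabilityTheory.beta_pos hq0 (sub_pos.2 hq1)
    positivity
  have hcont : ContinuousOn (eulerIntegral p q a) (Icc 0 1) :=
    (continuousOn_eulerIntegral hp ha hq).mono fun x hx => hx.2
  have hanti : AntitoneOn (fun z => eulerIntegral p q a z + M * (1 - z) ^ σ) (Icc 0 1) := by
    have hd : ∀ z ∈ Ioo (0 : ℝ) 1, HasDerivAt (fun z => eulerIntegral p q a z + M * (1 - z) ^ σ)
        (a * eulerIntegral (p + 1) q (a + 1) z + M * (-1 * σ * (1 - z) ^ (σ - 1))) z := by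
      intro z hz
      refine (hasDerivAt_eulerIntegral hp hq0 ha hz.2).add (HasDerivAt.const_mul M ?_)
      have h3 : HasDerivAt (fun z : ℝ => 1 - z) (-1) z := by
        simpa using (hasDerivAt_id z).const_sub 1
      exact h3.rpow_const (Or.inl (by linarith [hz.2]))
    refine antitoneOn_of_deriv_nonpos (convex_Icc 0 1) ?_ ?_ ?_
    · refine hcont.add (continuousOn_const.mul ?_)
      exact ContinuousOn.rpow_const (by fun_prop) fun x _ => Or.inr hσ0.le
    · rw [interior_Icc]
      exact fun z hz => (hd z hz).differentiableAt.differentiableWithinAt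
    · rw [interior_Icc]
      intro z hz
      rw [(hd z hz).deriv, eulerIntegral_transform _ _ _ hz.2]
      have h1 : 0 ≤ (1 - z) ^ (σ - 1) := Real.rpow_nonneg (by linarith [hz.2]) _
      have h2 := eulerIntegral_le (p := q) (q := p + 1) (a := p + 1 + q - (a + 1)) hq0
        (by linarith) (by linarith) hz.2.le
      rw [show p + 1 - (p + 1 + q - (a + 1)) = 1 - σ by rw [hσ]; ring] at h2
      rw [show q - (a + 1) = σ - 1 by rw [hσ]; ring]
      have h3 : M * σ = a * ProbabilityTheory.beta q (1 - σ) := by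
        rw [hM]; field_simp
      calc _ = (1 - z) ^ (σ - 1) * (a * eulerIntegral q (p + 1) (p + 1 + q - (a + 1)) z
            - M * σ) := by ring
        _ ≤ 0 := by
          rw [h3]
          exact mul_nonpos_of_nonneg_of_nonpos h1
            (by linarith [mul_le_mul_of_nonneg_left h2 ha])
  have hmono : ∀ x ≤ (1 : ℝ), ∀ y ≤ (1 : ℝ), x ≤ y →
      eulerIntegral p q a x ≤ eulerIntegral p q a y := by
    intro x hx y hy hxy
    rw [eulerIntegral_eq, eulerIntegral_eq]
    exact setIntegral_mono_on (integrableOn_eulerIntegrand hp ha hq hx)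
      (integrableOn_eulerIntegrand hp ha hq hy) measurableSet_Ioo
      fun t ht => eulerIntegrand_mono p q ha hxy hy ht
  have hle : ∀ x ∈ Icc (0 : ℝ) 1, ∀ y ∈ Icc (0 : ℝ) 1, x ≤ y →
      |eulerIntegral p q a x - eulerIntegral p q a y| ≤ M * |x - y| ^ σ := by
    intro x hx y hy hxy
    have h1 := hanti hx hy hxy
    have h2 := hmono x hx.2 y hy.2 hxy
    have h3 := Real.rpow_add_le_add_rpow (p := σ) (a := 1 - y) (b := y - x)
      (by linarith [hy.2]) (by linarith) hσ0.le hq1.le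
    rw [show 1 - y + (y - x) = 1 - x by ring] at h3
    rw [abs_sub_comm, abs_of_nonneg (by linarith), abs_sub_comm x y, abs_of_nonneg (by linarith)]
    dsimp only at h1
    linarith [mul_le_mul_of_nonneg_left h3 hM0]
  refine ⟨M, fun x hx y hy => ?_⟩
  rcases le_total x y with h | h
  · exact hle x hx y hy h
  · rw [abs_sub_comm, abs_sub_comm x y]
    exact hle y hy x hx h

/-! ### The derivatives `ψ`, `φ` and `τ` -/

/-- Affine substitution `t = a + c x`, where `c` may be negative. -/
theorem integral_affine {f g : ℝ → ℝ} {a b c R : ℝ} (hc : c ≠ 0) (hR : 0 ≤ R)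
    (hb : b = a + c * R) (hfg : ∀ x ∈ Ioo 0 R, f (a + c * x) = g x)
    (hg : IntervalIntegrable g volume 0 R) :
    IntervalIntegrable f volume a b ∧ ∫ t in a..b, f t = c * ∫ x in (0 : ℝ)..R, g x := by
  constructor
  · have h1 := (hg.comp_mul_left (c := c⁻¹)).comp_sub_right a
    simp only [div_inv_eq_mul, zero_mul, zero_add] at h1
    rw [show R * c + a = b by rw [hb]; ring] at h1
    refine h1.congr_uIoo fun t ht => ?_
    have hx : c⁻¹ * (t - a) ∈ Ioo 0 R := by
      rcases lt_or_gt_of_ne hc with h | h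
      · rw [uIoo_of_ge (by rw [hb]; nlinarith), hb] at ht
        have h2 := inv_lt_zero.2 h
        refine ⟨by nlinarith [ht.2], ?_⟩
        have h3 : c⁻¹ * (c * R) = R := inv_mul_cancel_left₀ hc R
        nlinarith [ht.1]
      · rw [uIoo_of_le (by rw [hb]; nlinarith), hb] at ht
        have h2 := inv_pos.2 h
        refine ⟨by nlinarith [ht.1], ?_⟩
        rw [inv_mul_lt_iff₀ h]
        linarith [ht.2]
    dsimp only
    rw [← hfg _ hx, mul_inv_cancel_left₀ hc, add_sub_cancel]
  · have h := intervalIntegral.smul_integral_comp_add_mul (a := 0) (b := R) f c a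
    rw [mul_zero, add_zero, ← hb, smul_eq_mul] at h
    rw [← h, intervalIntegral.integral_congr_Ioo_of_le hR hfg]

theorem intervalIntegrable_eulerIntegrand {p q a z : ℝ} (hp : 0 < p) (hq : 0 < q) (hz : z < 1) :
    IntervalIntegrable (eulerIntegrand p q a z) volume 0 1 := by
  rw [intervalIntegrable_iff_integrableOn_Ioo_of_le zero_le_one]
  exact integrableOn_eulerIntegrand_of_lt a hp hq hz

/-- A contiguity relation, from `1 = (1 - z t) + z t` under the integral sign. -/
theorem eulerIntegral_add_mul {p q z : ℝ} (a : ℝ) (hp : 0 < p) (hq : 0 < q) (hz : z < 1) :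
    eulerIntegral p q a z + z * eulerIntegral (p + 1) q (a + 1) z
      = eulerIntegral p q (a + 1) z := by
  rw [eulerIntegral, eulerIntegral, eulerIntegral, ← intervalIntegral.integral_const_mul,
    ← intervalIntegral.integral_add (intervalIntegrable_eulerIntegrand hp hq hz)
      ((intervalIntegrable_eulerIntegrand (by linarith) hq hz).const_mul z)]
  refine intervalIntegral.integral_congr_Ioo_of_le zero_le_one fun t ht => ?_
  have h1 : 0 < 1 - z * t := by nlinarith [ht.1, ht.2]
  simp only [eulerIntegrand]
  rw [show p + 1 - 1 = (p - 1) + 1 by ring, Real.rpow_add ht.1, Real.rpow_one,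
    show -a = -(a + 1) + 1 by ring, Real.rpow_add h1, Real.rpow_one]
  ring

theorem F₁_eq {H₁ H₂ z : ℝ} (hH₁ : 1 / 2 < H₁) (hH₁₂ : H₁ < H₂) (hH₂ : H₂ < 1)
    (hz : z ∈ Icc (0 : ℝ) 1) :
    F₁ H₁ H₂ z * ProbabilityTheory.beta (3 / 2 - H₁) (3 / 2 - H₁)
      = eulerIntegral (3 / 2 - H₁) (3 / 2 - H₁) (2 - 2 * H₂) z := by
  rw [← hypergeometric_mul_beta (by linarith) (by linarith) (by linarith) hz, F₁,
    show 3 / 2 - H₁ + (3 / 2 - H₁) = 3 - 2 * H₁ by ring]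

theorem beta_succ_right {p q : ℝ} (hp : 0 < p) (hq : 0 < q) :
    ProbabilityTheory.beta p (q + 1) = q / (p + q) * ProbabilityTheory.beta p q := by
  have h5 := (Real.Gamma_pos_of_pos (show 0 < p + q by positivity)).ne'
  have h6 : p + q ≠ 0 := by positivity
  rw [ProbabilityTheory.beta, ProbabilityTheory.beta, Real.Gamma_add_one hq.ne', ← add_assoc,
    Real.Gamma_add_one h6]
  field_simp

theorem beta_comm (p q : ℝ) : ProbabilityTheory.beta p q = ProbabilityTheory.beta q p := by
  rw [ProbabilityTheory.beta, ProbabilityTheory.beta, add_comm q, mul_comm (Real.Gamma q)]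

theorem F₂_eq' {H₁ H₂ z : ℝ} (hH₁ : 1 / 2 < H₁) (hH₁₂ : H₁ < H₂) (hH₂ : H₂ < 1)
    (hz : z ∈ Icc (0 : ℝ) 1) :
    F₂ H₁ H₂ z * ProbabilityTheory.beta (3 / 2 - H₁) (5 / 2 - H₁)
      = eulerIntegral (3 / 2 - H₁) (5 / 2 - H₁) (1 + 2 * H₂ - 2 * H₁) z := by
  rw [← hypergeometric_mul_beta (by linarith) (by linarith) (by linarith) hz, F₂,
    show 3 / 2 - H₁ + (5 / 2 - H₁) = 4 - 2 * H₁ by ring]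

theorem F₂_eq {H₁ H₂ z : ℝ} (hH₁ : 1 / 2 < H₁) (hH₁₂ : H₁ < H₂) (hH₂ : H₂ < 1)
    (hz : z ∈ Icc (0 : ℝ) 1) :
    D₂ H₁ H₂ * F₂ H₁ H₂ z
      = (2 - 2 * H₂) * eulerIntegral (3 / 2 - H₁) (5 / 2 - H₁) (1 + 2 * H₂ - 2 * H₁) z := by
  have h1 : 0 < 3 / 2 - H₁ := by linarith
  rw [← F₂_eq' hH₁ hH₁₂ hH₂ hz, show 5 / 2 - H₁ = 3 / 2 - H₁ + 1 by ring,
    beta_succ_right h1 h1, D₂]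
  rw [show (3 / 2 - H₁) / (3 / 2 - H₁ + (3 / 2 - H₁)) = 1 / 2 by
    rw [div_eq_iff (by linarith)]; ring]
  ring

theorem F₃_eq {H₁ H₂ z : ℝ} (hH₁ : 1 / 2 < H₁) (hH₁₂ : H₁ < H₂) (hH₂ : H₂ < 1)
    (hz : z ∈ Icc (0 : ℝ) 1) :
    F₃ H₁ H₂ z * ProbabilityTheory.beta (3 / 2 - H₁) (2 * H₂ - 1)
      = eulerIntegral (3 / 2 - H₁) (2 * H₂ - 1) (H₁ - 1 / 2) (1 - z) := by
  rw [← hypergeometric_mul_beta (by linarith) (by linarith) (by linarith)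
    ⟨by linarith [hz.2], by linarith [hz.1]⟩, F₃,
    show 3 / 2 - H₁ + (2 * H₂ - 1) = 2 * H₂ - H₁ + 1 / 2 by ring]

theorem F₄_eq' {H₁ H₂ z : ℝ} (hH₁ : 1 / 2 < H₁) (hH₁₂ : H₁ < H₂) (hH₂ : H₂ < 1)
    (hz : z ∈ Icc (0 : ℝ) 1) :
    F₄ H₁ H₂ z * ProbabilityTheory.beta (2 * H₂ - 1) (5 / 2 - H₁)
      = eulerIntegral (2 * H₂ - 1) (5 / 2 - H₁) (2 * H₂ - 2 * H₁ + 1) (1 - z) := by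
  rw [← hypergeometric_mul_beta (by linarith) (by linarith) (by linarith)
    ⟨by linarith [hz.2], by linarith [hz.1]⟩, F₄,
    show 2 * H₂ - 1 + (5 / 2 - H₁) = 2 * H₂ - H₁ + 3 / 2 by ring]

theorem F₄_eq {H₁ H₂ z : ℝ} (hH₁ : 1 / 2 < H₁) (hH₁₂ : H₁ < H₂) (hH₂ : H₂ < 1)
    (hz : z ∈ Icc (0 : ℝ) 1) :
    D₄ H₁ H₂ * F₄ H₁ H₂ z = (H₁ - 1 / 2) *
      eulerIntegral (2 * H₂ - 1) (5 / 2 - H₁) (2 * H₂ - 2 * H₁ + 1) (1 - z) := by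
  have h1 : 0 < 3 / 2 - H₁ := by linarith
  have h2 : 0 < 2 * H₂ - 1 := by linarith
  rw [← F₄_eq' hH₁ hH₁₂ hH₂ hz, show 5 / 2 - H₁ = 3 / 2 - H₁ + 1 by ring,
    beta_succ_right h2 h1, D₄, beta_comm (2 * H₂ - 1),
    show 2 * H₂ - 1 + (3 / 2 - H₁) = 2 * H₂ - H₁ + 1 / 2 by ring]
  ring

theorem F₅_eq' {H₁ H₂ z : ℝ} (hH₁ : 1 / 2 < H₁) (hH₁₂ : H₁ < H₂) (hH₂ : H₂ < 1)
    (hz : z ∈ Icc (0 : ℝ) 1) :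
    F₅ H₁ H₂ z * ProbabilityTheory.beta (2 * H₂ - 1) (3 / 2 - H₁)
      = eulerIntegral (2 * H₂ - 1) (3 / 2 - H₁) (2 * H₂ - 2 * H₁) z := by
  rw [← hypergeometric_mul_beta (by linarith) (by linarith) (by linarith) hz, F₅,
    show 2 * H₂ - 1 + (3 / 2 - H₁) = 2 * H₂ - H₁ + 1 / 2 by ring]

theorem F₅_eq {H₁ H₂ z : ℝ} (hH₁ : 1 / 2 < H₁) (hH₁₂ : H₁ < H₂) (hH₂ : H₂ < 1)
    (hz : z ∈ Icc (0 : ℝ) 1) :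
    D₅ H₁ H₂ * F₅ H₁ H₂ z = (H₁ - 1 / 2) *
      eulerIntegral (2 * H₂ - 1) (3 / 2 - H₁) (2 * H₂ - 2 * H₁) z := by
  rw [← F₅_eq' hH₁ hH₁₂ hH₂ hz, D₅, beta_comm (2 * H₂ - 1)]
  ring

theorem psiInner_eq {H₁ u s : ℝ} (H₂ : ℝ) (hH : H₁ < 1) (hu : 0 < u) (hus : u < s) :
    IntervalIntegrable (fun t => (u - t) ^ (1 / 2 - H₁) * t ^ (1 / 2 - H₁) * (s - t) ^ (2 * H₂ - 2))
      volume 0 u ∧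
    psiInner H₁ H₂ u s = u ^ (2 - 2 * H₁) * s ^ (2 * H₂ - 2) *
      eulerIntegral (3 / 2 - H₁) (3 / 2 - H₁) (2 - 2 * H₂) (u / s) := by
  have hs : 0 < s := hu.trans hus
  have hz : u / s < 1 := (div_lt_one hs).2 hus
  have h := integral_affine (f := fun t => (u - t) ^ (1 / 2 - H₁) * t ^ (1 / 2 - H₁) *
    (s - t) ^ (2 * H₂ - 2)) (g := fun y => u ^ (1 - 2 * H₁) * s ^ (2 * H₂ - 2) *
      eulerIntegrand (3 / 2 - H₁) (3 / 2 - H₁) (2 - 2 * H₂) (u / s) y) (a := 0) (b := u) (c := u)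
    (R := 1) hu.ne' zero_le_one (by ring) ?_
    ((intervalIntegrable_eulerIntegrand (by linarith) (by linarith) hz).const_mul _)
  · refine ⟨h.1, ?_⟩
    rw [psiInner, h.2, intervalIntegral.integral_const_mul, eulerIntegral,
      show 2 - 2 * H₁ = 1 + (1 - 2 * H₁) by ring, Real.rpow_add hu, Real.rpow_one]
    ring
  · intro y hy
    have hy1 : 0 < 1 - y := by linarith [hy.2]
    have hzy : 0 < 1 - u / s * y := by
      have := div_pos hu hs
      nlinarith [hy.1, hy.2]
    simp only [eulerIntegrand]
    rw [show u - (0 + u * y) = u * (1 - y) by ring, zero_add,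
      show s - u * y = s * (1 - u / s * y) by field_simp,
      Real.mul_rpow hu.le hy1.le, Real.mul_rpow hu.le hy.1.le, Real.mul_rpow hs.le hzy.le,
      show 1 - 2 * H₁ = (1 / 2 - H₁) + (1 / 2 - H₁) by ring, Real.rpow_add hu,
      show 3 / 2 - H₁ - 1 = 1 / 2 - H₁ by ring, show -(2 - 2 * H₂) = 2 * H₂ - 2 by ring]
    ring

/-- The Euler integral in the derivative diverges at `z = u / s = 1`; Euler's transformation splits
off the factor `(1 - z) ^ (α - 1)` and leaves `F₂`. -/
theorem hasDerivAt_psiInner {H₁ H₂ u s : ℝ} (hH₁ : 1 / 2 < H₁) (hH₁₂ : H₁ < H₂) (hH₂ : H₂ < 1)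
    (hu : 0 < u) (hus : u < s) :
    HasDerivAt (fun v => psiInner H₁ H₂ v s)
      (u ^ (1 - 2 * H₁) * s ^ (2 * H₂ - 2) * (D₁ H₁ * F₁ H₁ H₂ (u / s)
        + D₂ H₁ H₂ * (u / s) * (1 - u / s) ^ (2 * H₂ - H₁ - 3 / 2) * F₂ H₁ H₂ (u / s))) u := by
  have hs : 0 < s := hu.trans hus
  have hz : u / s < 1 := (div_lt_one hs).2 hus
  have hz0 : 0 < u / s := div_pos hu hs
  have hev : (fun v => psiInner H₁ H₂ v s) =ᶠ[𝓝 u] fun v => v ^ (2 - 2 * H₁) * s ^ (2 * H₂ - 2) *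
      eulerIntegral (3 / 2 - H₁) (3 / 2 - H₁) (2 - 2 * H₂) (v / s) := by
    filter_upwards [Ioo_mem_nhds hu hus] with v hv
    exact (psiInner_eq H₂ (by linarith) hv.1 hv.2).2
  refine HasDerivAt.congr_of_eventuallyEq ?_ hev
  have h1 := (Real.hasDerivAt_rpow_const (p := 2 - 2 * H₁) (Or.inl hu.ne')).mul_const
    (s ^ (2 * H₂ - 2))
  have h2 := HasDerivAt.comp u (hasDerivAt_eulerIntegral (p := 3 / 2 - H₁) (q := 3 / 2 - H₁)
    (a := 2 - 2 * H₂) (by linarith) (by linarith) (by linarith) hz) ((hasDerivAt_id u).div_const s)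
  refine (h1.mul h2).congr_deriv ?_
  dsimp only [Function.comp_def, id]
  rw [eulerIntegral_transform _ _ (2 - 2 * H₂ + 1) hz, mul_left_comm (2 - 2 * H₂),
    ← F₁_eq hH₁ hH₁₂ hH₂ ⟨hz0.le, hz.le⟩, D₁,
    show 3 / 2 - H₁ + 1 + (3 / 2 - H₁) - (2 - 2 * H₂ + 1) = 1 + 2 * H₂ - 2 * H₁ by ring,
    show 3 / 2 - H₁ + 1 = 5 / 2 - H₁ by ring,
    ← F₂_eq hH₁ hH₁₂ hH₂ ⟨hz0.le, hz.le⟩,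
    show 3 / 2 - H₁ - (2 - 2 * H₂ + 1) = 2 * H₂ - H₁ - 3 / 2 by ring,
    show 2 - 2 * H₁ - 1 = 1 - 2 * H₁ by ring,
    show 2 - 2 * H₁ = 1 + (1 - 2 * H₁) by ring, Real.rpow_add hu, Real.rpow_one]
  field_simp
  ring

theorem psi_eq {H₁ H₂ u s : ℝ} (hH₁ : 1 / 2 < H₁) (hH₁₂ : H₁ < H₂) (hH₂ : H₂ < 1)
    (hu : 0 < u) (hus : u < s) :
    u ^ (2 * H₁ - 1) * psi H₁ H₂ u s = s ^ (2 * H₂ - 2) * (D₁ H₁ * F₁ H₁ H₂ (u / s)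
        + D₂ H₁ H₂ * (u / s) * (1 - u / s) ^ (2 * H₂ - H₁ - 3 / 2) * F₂ H₁ H₂ (u / s)) := by
  rw [psi, (hasDerivAt_psiInner hH₁ hH₁₂ hH₂ hu hus).deriv, ← mul_assoc, ← mul_assoc,
    ← Real.rpow_add hu]
  rw [show 2 * H₁ - 1 + (1 - 2 * H₁) = 0 by ring, Real.rpow_zero, one_mul]

/-- The substitution `t = u - (u - s) y` runs from `u` down to `s`, so that `t ^ (1/2 - H₁)` becomes
the factor with argument `1 - s / u`. -/
theorem phiInner_eq {H₁ H₂ u s : ℝ} (hH₁ : H₁ < 1) (hH₂ : 1 / 2 < H₂) (hs : 0 < s) (hsu : s < u) :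
    IntervalIntegrable (fun t => (u - t) ^ (1 / 2 - H₁) * t ^ (1 / 2 - H₁) * (t - s) ^ (2 * H₂ - 2))
      volume s u ∧
    phiInner H₁ H₂ u s = (u - s) ^ (2 * H₂ - H₁ - 1 / 2) * u ^ (1 / 2 - H₁) *
      eulerIntegral (3 / 2 - H₁) (2 * H₂ - 1) (H₁ - 1 / 2) (1 - s / u) := by
  have hu : 0 < u := hs.trans hsu
  have hus : 0 < u - s := sub_pos.2 hsu
  have hz : 0 < s / u := div_pos hs hu
  have h := integral_affine (f := fun t => (u - t) ^ (1 / 2 - H₁) * t ^ (1 / 2 - H₁) *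
    (t - s) ^ (2 * H₂ - 2)) (g := fun y => (u - s) ^ (2 * H₂ - H₁ - 3 / 2) * u ^ (1 / 2 - H₁) *
      eulerIntegrand (3 / 2 - H₁) (2 * H₂ - 1) (H₁ - 1 / 2) (1 - s / u) y) (a := u) (b := s)
    (c := -(u - s)) (R := 1) (neg_ne_zero.2 hus.ne') zero_le_one (by ring) ?_
    ((intervalIntegrable_eulerIntegrand (by linarith) (by linarith) (by linarith)).const_mul _)
  · refine ⟨h.1.symm, ?_⟩
    rw [phiInner, intervalIntegral.integral_symm, h.2, intervalIntegral.integral_const_mul,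
      eulerIntegral, show 2 * H₂ - H₁ - 1 / 2 = 1 + (2 * H₂ - H₁ - 3 / 2) by ring,
      Real.rpow_add hus, Real.rpow_one]
    ring
  · intro y hy
    have hy1 : 0 < 1 - y := by linarith [hy.2]
    have hzy : 0 < 1 - (1 - s / u) * y := by nlinarith [hy.1, hy.2]
    simp only [eulerIntegrand]
    rw [show u - (u + -(u - s) * y) = (u - s) * y by ring,
      show u + -(u - s) * y - s = (u - s) * (1 - y) by ring,
      show u + -(u - s) * y = u * (1 - (1 - s / u) * y) by field_simp; ring,
      Real.mul_rpow hus.le hy1.le, Real.mul_rpow hus.le hy.1.le, Real.mul_rpow hu.le hzy.le,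
      show 2 * H₂ - H₁ - 3 / 2 = (1 / 2 - H₁) + (2 * H₂ - 2) by ring, Real.rpow_add hus,
      show 3 / 2 - H₁ - 1 = 1 / 2 - H₁ by ring, show -(H₁ - 1 / 2) = 1 / 2 - H₁ by ring,
      show 2 * H₂ - 1 - 1 = 2 * H₂ - 2 by ring]
    ring

theorem hasDerivAt_const_div {s u : ℝ} (hu : u ≠ 0) :
    HasDerivAt (fun v : ℝ => s / v) (-(s / u ^ 2)) u := by
  have h := (hasDerivAt_inv hu).const_mul s
  refine h.congr_deriv ?_
  field_simp

theorem hasDerivAt_phiInner {H₁ H₂ u s : ℝ} (hH₁ : 1 / 2 < H₁) (hH₁₂ : H₁ < H₂) (hH₂ : H₂ < 1)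
    (hs : 0 < s) (hsu : s < u) :
    HasDerivAt (fun v => phiInner H₁ H₂ v s)
      (u ^ (1 / 2 - H₁) * (u - s) ^ (2 * H₂ - H₁ - 3 / 2) *
        ((D₃ H₁ H₂ + D₅ H₁ H₂ * (s / u)) * F₃ H₁ H₂ (s / u)
        + D₄ H₁ H₂ * (s / u) ^ (2 * H₂ - H₁ - 1 / 2) * (1 - s / u) * F₄ H₁ H₂ (s / u))) u := by
  have hu : 0 < u := hs.trans hsu
  have hus : 0 < u - s := sub_pos.2 hsu
  have hz : 0 < s / u := div_pos hs hu
  have hz1 : s / u < 1 := (div_lt_one hu).2 hsu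
  have hev : (fun v => phiInner H₁ H₂ v s) =ᶠ[𝓝 u] fun v =>
      (v - s) ^ (2 * H₂ - H₁ - 1 / 2) * v ^ (1 / 2 - H₁) *
      eulerIntegral (3 / 2 - H₁) (2 * H₂ - 1) (H₁ - 1 / 2) (1 - s / v) := by
    filter_upwards [Ioi_mem_nhds hsu] with v hv
    exact (phiInner_eq (by linarith) (by linarith) hs hv).2
  refine HasDerivAt.congr_of_eventuallyEq ?_ hev
  have h0 := ((hasDerivAt_id u).sub_const s).rpow_const (p := 2 * H₂ - H₁ - 1 / 2)
    (Or.inl hus.ne')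
  have h1 := Real.hasDerivAt_rpow_const (p := 1 / 2 - H₁) (Or.inl hu.ne')
  have h2 := HasDerivAt.comp u (hasDerivAt_eulerIntegral (p := 3 / 2 - H₁) (q := 2 * H₂ - 1)
    (a := H₁ - 1 / 2) (z := 1 - s / u) (by linarith) (by linarith) (by linarith) (by linarith))
    ((hasDerivAt_const_div (s := s) hu.ne').const_sub 1)
  refine ((h0.mul h1).mul h2).congr_deriv ?_
  dsimp only [Function.comp_def, id, Pi.mul_apply]
  rw [eulerIntegral_transform _ _ (H₁ - 1 / 2 + 1) (by linarith : 1 - s / u < 1)]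
  have e4 := F₄_eq hH₁ hH₁₂ hH₂ ⟨hz.le, hz1.le⟩
  have e3 := F₃_eq hH₁ hH₁₂ hH₂ ⟨hz.le, hz1.le⟩
  rw [← e3, show 3 / 2 - H₁ + 1 + (2 * H₂ - 1) - (H₁ - 1 / 2 + 1) = 2 * H₂ - 2 * H₁ + 1 by ring,
    show 3 / 2 - H₁ + 1 = 5 / 2 - H₁ by ring,
    show 2 * H₂ - 1 - (H₁ - 1 / 2 + 1) = 2 * H₂ - H₁ - 3 / 2 by ring,
    show 2 * H₂ - H₁ - 1 / 2 - 1 = 2 * H₂ - H₁ - 3 / 2 by ring, sub_sub_cancel,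
    mul_left_comm (H₁ - 1 / 2), ← e4, D₃, D₅,
    show 2 * H₂ - H₁ - 1 / 2 = (2 * H₂ - H₁ - 3 / 2) + 1 by ring, Real.rpow_add hus,
    Real.rpow_add hz, Real.rpow_one, Real.rpow_one, Real.rpow_sub hu _ 1, Real.rpow_one]
  field_simp
  ring

theorem tauInner_eq {H₁ H₂ u s : ℝ} (hH₁ : H₁ < 1) (hH₂ : 1 / 2 < H₂) (hs : 0 < s) (hsu : s < u) :
    IntervalIntegrable (fun t => (u - t) ^ (1 / 2 - H₁) * t ^ (1 / 2 - H₁) * (s - t) ^ (2 * H₂ - 2))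
      volume 0 s ∧
    tauInner H₁ H₂ u s = s ^ (2 * H₂ - H₁ - 1 / 2) * u ^ (1 / 2 - H₁) *
      eulerIntegral (3 / 2 - H₁) (2 * H₂ - 1) (H₁ - 1 / 2) (s / u) := by
  have hu : 0 < u := hs.trans hsu
  have hz : s / u < 1 := (div_lt_one hu).2 hsu
  have hz0 : 0 < s / u := div_pos hs hu
  have h := integral_affine (f := fun t => (u - t) ^ (1 / 2 - H₁) * t ^ (1 / 2 - H₁) *
    (s - t) ^ (2 * H₂ - 2)) (g := fun y => s ^ (2 * H₂ - H₁ - 3 / 2) * u ^ (1 / 2 - H₁) *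
      eulerIntegrand (3 / 2 - H₁) (2 * H₂ - 1) (H₁ - 1 / 2) (s / u) y) (a := 0) (b := s)
    (c := s) (R := 1) hs.ne' zero_le_one (by ring) ?_
    ((intervalIntegrable_eulerIntegrand (by linarith) (by linarith) hz).const_mul _)
  · refine ⟨h.1, ?_⟩
    rw [tauInner, h.2, intervalIntegral.integral_const_mul, eulerIntegral,
      show 2 * H₂ - H₁ - 1 / 2 = 1 + (2 * H₂ - H₁ - 3 / 2) by ring,
      Real.rpow_add hs, Real.rpow_one]
    ring
  · intro y hy
    have hy1 : 0 < 1 - y := by linarith [hy.2]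
    have hzy : 0 < 1 - s / u * y := by nlinarith [hy.1, hy.2]
    simp only [eulerIntegrand]
    rw [zero_add, show u - s * y = u * (1 - s / u * y) by field_simp,
      show s - s * y = s * (1 - y) by ring,
      Real.mul_rpow hs.le hy1.le, Real.mul_rpow hs.le hy.1.le, Real.mul_rpow hu.le hzy.le,
      show 2 * H₂ - H₁ - 3 / 2 = (1 / 2 - H₁) + (2 * H₂ - 2) by ring, Real.rpow_add hs,
      show 3 / 2 - H₁ - 1 = 1 / 2 - H₁ by ring, show -(H₁ - 1 / 2) = 1 / 2 - H₁ by ring,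
      show 2 * H₂ - 1 - 1 = 2 * H₂ - 2 by ring]
    ring

/-- The contiguity relation combines the terms from differentiating `u ^ (1/2 - H₁)` and the Euler
integral into a single Euler integral, a multiple of `F₅`. -/
theorem hasDerivAt_tauInner {H₁ H₂ u s : ℝ} (hH₁ : 1 / 2 < H₁) (hH₁₂ : H₁ < H₂) (hH₂ : H₂ < 1)
    (hs : 0 < s) (hsu : s < u) :
    HasDerivAt (fun v => tauInner H₁ H₂ v s)
      (u ^ (1 / 2 - H₁) * (u - s) ^ (2 * H₂ - H₁ - 3 / 2) *
        -(D₅ H₁ H₂ * (s / u) ^ (2 * H₂ - H₁ - 1 / 2) * F₅ H₁ H₂ (s / u))) u := by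
  have hu : 0 < u := hs.trans hsu
  have hus : 0 < u - s := sub_pos.2 hsu
  have hz : 0 < s / u := div_pos hs hu
  have hz1 : s / u < 1 := (div_lt_one hu).2 hsu
  have hz1' : 0 < 1 - s / u := sub_pos.2 hz1
  have hev : (fun v => tauInner H₁ H₂ v s) =ᶠ[𝓝 u] fun v =>
      s ^ (2 * H₂ - H₁ - 1 / 2) * v ^ (1 / 2 - H₁) *
      eulerIntegral (3 / 2 - H₁) (2 * H₂ - 1) (H₁ - 1 / 2) (s / v) := by
    filter_upwards [Ioi_mem_nhds hsu] with v hv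
    exact (tauInner_eq (by linarith) (by linarith) hs hv).2
  refine HasDerivAt.congr_of_eventuallyEq ?_ hev
  have h1 := (Real.hasDerivAt_rpow_const (p := 1 / 2 - H₁) (Or.inl hu.ne')).const_mul
    (s ^ (2 * H₂ - H₁ - 1 / 2))
  have h2 := HasDerivAt.comp u (hasDerivAt_eulerIntegral (p := 3 / 2 - H₁) (q := 2 * H₂ - 1)
    (a := H₁ - 1 / 2) (z := s / u) (by linarith) (by linarith) (by linarith) hz1)
    (hasDerivAt_const_div (s := s) hu.ne')
  refine (h1.mul h2).congr_deriv ?_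
  dsimp only [Function.comp_def, id]
  have e5 := F₅_eq hH₁ hH₁₂ hH₂ ⟨hz.le, hz1.le⟩
  have hc := eulerIntegral_add_mul (H₁ - 1 / 2) (show 0 < 3 / 2 - H₁ by linarith)
    (show 0 < 2 * H₂ - 1 by linarith) hz1
  rw [eulerIntegral_transform _ _ (H₁ - 1 / 2 + 1) hz1,
    eulerIntegral_transform (3 / 2 - H₁) _ (H₁ - 1 / 2 + 1) hz1,
    show 3 / 2 - H₁ + (2 * H₂ - 1) - (H₁ - 1 / 2 + 1) = 2 * H₂ - 2 * H₁ by ring] at hc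
  rw [eulerIntegral_transform _ _ (H₁ - 1 / 2 + 1) hz1, eq_sub_of_add_eq hc,
    mul_right_comm (D₅ H₁ H₂), e5, show u - s = u * (1 - s / u) by field_simp,
    Real.mul_rpow hu.le hz1'.le, Real.div_rpow hs.le hu.le,
    show 2 * H₂ - 1 - (H₁ - 1 / 2 + 1) = 2 * H₂ - H₁ - 3 / 2 by ring,
    Real.rpow_sub hu _ 1, Real.rpow_one,
    show (u : ℝ) ^ (2 * H₂ - H₁ - 1 / 2) = u ^ (2 * H₂ - H₁ - 3 / 2) * u by
      rw [show 2 * H₂ - H₁ - 1 / 2 = 2 * H₂ - H₁ - 3 / 2 + 1 by ring, Real.rpow_add hu,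
        Real.rpow_one]]
  have hu' : u ^ (2 * H₂ - H₁ - 3 / 2) ≠ 0 := (Real.rpow_pos_of_pos hu _).ne'
  field_simp
  ring

/-- `G(z)`, the profile of `ρ`: `u ^ (H₁ - 1/2) ρ(u, s) = (u - s) ^ (α - 1) G(s / u)`. -/
noncomputable def rhoProfile (H₁ H₂ z : ℝ) : ℝ :=
  (D₃ H₁ H₂ + D₅ H₁ H₂ * z) * F₃ H₁ H₂ z
    + D₄ H₁ H₂ * z ^ (2 * H₂ - H₁ - 1 / 2) * (1 - z) * F₄ H₁ H₂ z
    - D₅ H₁ H₂ * z ^ (2 * H₂ - H₁ - 1 / 2) * F₅ H₁ H₂ z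

theorem rho_eq {H₁ H₂ u s : ℝ} (hH₁ : 1 / 2 < H₁) (hH₁₂ : H₁ < H₂) (hH₂ : H₂ < 1)
    (hs : 0 < s) (hsu : s < u) :
    u ^ (H₁ - 1 / 2) * rho H₁ H₂ u s
      = (u - s) ^ (2 * H₂ - H₁ - 3 / 2) * rhoProfile H₁ H₂ (s / u) := by
  have hu : 0 < u := hs.trans hsu
  rw [rho, phi, tau, (hasDerivAt_phiInner hH₁ hH₁₂ hH₂ hs hsu).deriv,
    (hasDerivAt_tauInner hH₁ hH₁₂ hH₂ hs hsu).deriv, rhoProfile,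
    show (1 : ℝ) / 2 - H₁ = -(H₁ - 1 / 2) by ring, Real.rpow_neg hu.le]
  have := (Real.rpow_pos_of_pos hu (H₁ - 1 / 2)).ne'
  field_simp
  ring

/-! ### Dominated families of integrals -/

/-- The substitution `y = x / (1 + x)` between `(0, ∞)` and `(0, 1)`. -/
theorem beta_prime {p q : ℝ} (hp : 0 < p) (hq : 0 < q) :
    IntegrableOn (fun x : ℝ => x ^ (p - 1) * (1 + x) ^ (-p - q)) (Ioi 0) ∧
      ∫ x in Ioi (0 : ℝ), x ^ (p - 1) * (1 + x) ^ (-p - q) = ProbabilityTheory.beta p q := by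
  set f : ℝ → ℝ := fun x => x / (1 + x) with hf
  have himg : f '' Ioi 0 = Ioo 0 1 := by
    ext y
    constructor
    · rintro ⟨x, hx, rfl⟩
      have hx' : 0 < x := hx
      exact ⟨by simp only [hf]; positivity, by simp only [hf]; rw [div_lt_one] <;> linarith⟩
    · rintro ⟨h0, h1⟩
      have h2 : 0 < 1 - y := by linarith
      refine ⟨y / (1 - y), div_pos h0 h2, ?_⟩
      simp only [hf]
      field_simp
      ring
  have hinj : InjOn f (Ioi 0) := by
    intro x hx y hy hxy
    have hx' : 0 < x := hx
    have hy' : 0 < y := hy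
    simp only [hf] at hxy
    rw [div_eq_div_iff (by positivity) (by positivity)] at hxy
    linarith
  have hder : ∀ x ∈ Ioi (0 : ℝ), HasDerivWithinAt f (1 / (1 + x) ^ 2) (Ioi 0) x := by
    intro x hx
    have hx' : 0 < x := hx
    have h3 : HasDerivAt (fun x : ℝ => 1 + x) 1 x := by
      simpa using (hasDerivAt_id x).const_add 1
    refine ((hasDerivAt_id x).div h3 (by positivity)).hasDerivWithinAt.congr_deriv ?_
    simp
  have hcongr : ∀ x ∈ Ioi (0 : ℝ), |1 / (1 + x) ^ 2| • (f x ^ (p - 1) * (1 - f x) ^ (q - 1))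
      = x ^ (p - 1) * (1 + x) ^ (-p - q) := by
    intro x hx
    have hx' : 0 < x := hx
    have h1 : 0 < 1 + x := by positivity
    have e1 : 1 - f x = (1 + x)⁻¹ := by simp only [hf]; field_simp; ring
    rw [e1, hf]
    dsimp only
    rw [abs_of_pos (by positivity), smul_eq_mul, Real.div_rpow hx'.le h1.le,
      show -p - q = -(p - 1) + -(q - 1) + -(2 : ℕ) by push_cast; ring,
      Real.rpow_add h1, Real.rpow_add h1,
      Real.rpow_neg h1.le, Real.rpow_neg h1.le, Real.rpow_neg h1.le, Real.inv_rpow h1.le,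
      Real.rpow_natCast]
    ring
  have hb := intervalIntegrable_beta hp hq
  rw [intervalIntegrable_iff_integrableOn_Ioo_of_le zero_le_one, ← himg,
    integrableOn_image_iff_integrableOn_abs_deriv_smul measurableSet_Ioi hder hinj] at hb
  refine ⟨hb.congr_fun hcongr measurableSet_Ioi, ?_⟩
  rw [← integral_beta hp hq, intervalIntegral.integral_of_le zero_le_one,
    integral_Ioc_eq_integral_Ioo, ← himg,
    integral_image_eq_integral_abs_deriv_smul measurableSet_Ioi hder hinj]
  exact (setIntegral_congr_fun measurableSet_Ioi hcongr).symm

/-- A family `g z` of functions on `(0, ∞)`, separately continuous for `z ∈ S`, with a common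
integrable bound. The sets `S` of interest contain `1`, so that such a bound controls the integrals
up to the diagonal `u = s`, where `z = 1`. -/
def DominatedOn (g : ℝ → ℝ → ℝ) (S : Set ℝ) : Prop :=
  (∀ z ∈ S, ContinuousOn (g z) (Ioi 0)) ∧ (∀ x, 0 < x → ContinuousOn (fun z => g z x) S) ∧
    ∃ b : ℝ → ℝ, IntegrableOn b (Ioi 0) ∧ ∀ z ∈ S, ∀ x, 0 < x → |g z x| ≤ b x

theorem DominatedOn.integrableOn {g : ℝ → ℝ → ℝ} {S : Set ℝ} (hg : DominatedOn g S) {z : ℝ}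
    (hz : z ∈ S) : IntegrableOn (g z) (Ioi 0) := by
  obtain ⟨h1, -, b, hb, hbd⟩ := hg
  refine Integrable.mono' hb ((h1 z hz).aestronglyMeasurable measurableSet_Ioi) ?_
  filter_upwards [ae_restrict_mem measurableSet_Ioi] with x hx
  exact hbd z hz x hx

theorem DominatedOn.intervalIntegrable {g : ℝ → ℝ → ℝ} {S : Set ℝ} (hg : DominatedOn g S)
    {z R : ℝ} (hz : z ∈ S) (hR : 0 ≤ R) : IntervalIntegrable (g z) volume 0 R := by
  rw [intervalIntegrable_iff_integrableOn_Ioc_of_le hR]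
  exact (hg.integrableOn hz).mono_set Ioc_subset_Ioi_self

/-- Dominated convergence for truncated integrals with varying parameter and varying endpoint. -/
theorem DominatedOn.tendsto {g : ℝ → ℝ → ℝ} {S : Set ℝ} (hg : DominatedOn g S) {ι : Type*}
    {l : Filter ι} [l.IsCountablyGenerated] {z R : ι → ℝ} {G : ℝ → ℝ} (hz : ∀ᶠ i in l, z i ∈ S)
    (hR : ∀ᶠ i in l, 0 < R i)
    (hlim : ∀ᵐ x ∂volume.restrict (Ioi 0),
      Tendsto (fun i => (Ioc 0 (R i)).indicator (g (z i)) x) l (𝓝 (G x))) :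
    Tendsto (fun i => ∫ x in (0 : ℝ)..R i, g (z i) x) l (𝓝 (∫ x in Ioi 0, G x)) := by
  obtain ⟨h1, -, b, hb, hbd⟩ := hg
  have key : Tendsto (fun i => ∫ x in Ioi 0, (Ioc 0 (R i)).indicator (g (z i)) x) l
      (𝓝 (∫ x in Ioi 0, G x)) := by
    refine tendsto_integral_filter_of_dominated_convergence b ?_ ?_ hb hlim
    · filter_upwards [hz] with i hi
      exact ((h1 _ hi).aestronglyMeasurable measurableSet_Ioi).indicator measurableSet_Ioc
    · filter_upwards [hz] with i hi
      filter_upwards [ae_restrict_mem measurableSet_Ioi] with x hx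
      exact (norm_indicator_le_norm_self _ _).trans (hbd _ hi x hx)
  refine key.congr' ?_
  filter_upwards [hR] with i hi
  rw [setIntegral_indicator measurableSet_Ioc, inter_eq_self_of_subset_right Ioc_subset_Ioi_self,
    intervalIntegral.integral_of_le hi.le]

theorem DominatedOn.bddContOn {g : ℝ → ℝ → ℝ} {S : Set ℝ} (hg : DominatedOn g S) :
    BddContOn (fun p : ℝ × ℝ => ∫ x in (0 : ℝ)..p.2, g p.1 x) (S ×ˢ Ioi 0) := by
  constructor
  · rintro ⟨z₀, R₀⟩ ⟨hz₀, hR₀⟩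
    have hR₀' : 0 < R₀ := hR₀
    have e : ∫ x in (0 : ℝ)..R₀, g z₀ x = ∫ x in Ioi 0, (Ioc 0 R₀).indicator (g z₀) x := by
      rw [setIntegral_indicator measurableSet_Ioc,
        inter_eq_self_of_subset_right Ioc_subset_Ioi_self,
        intervalIntegral.integral_of_le hR₀'.le]
    rw [ContinuousWithinAt]
    dsimp only
    rw [e]
    have hmem : ∀ᶠ p : ℝ × ℝ in 𝓝[S ×ˢ Ioi 0] (z₀, R₀), p ∈ S ×ˢ Ioi (0 : ℝ) :=
      self_mem_nhdsWithin
    refine hg.tendsto (z := Prod.fst) (R := Prod.snd) (hmem.mono fun p hp => hp.1)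
      (hmem.mono fun p hp => hp.2) ?_
    have hne : ∀ᵐ x : ℝ ∂volume.restrict (Ioi 0), x ≠ R₀ :=
      ae_restrict_of_ae (Measure.ae_ne volume R₀)
    filter_upwards [hne, ae_restrict_mem measurableSet_Ioi] with x hx hx0
    have hx0' : 0 < x := hx0
    have hsnd : Tendsto (Prod.snd : ℝ × ℝ → ℝ) (𝓝[S ×ˢ Ioi 0] (z₀, R₀)) (𝓝 R₀) :=
      (continuous_snd.tendsto (z₀, R₀)).mono_left nhdsWithin_le_nhds
    have hfst : Tendsto (Prod.fst : ℝ × ℝ → ℝ) (𝓝[S ×ˢ Ioi 0] (z₀, R₀)) (𝓝[S] z₀) :=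
      tendsto_nhdsWithin_iff.2 ⟨(continuous_fst.tendsto (z₀, R₀)).mono_left nhdsWithin_le_nhds,
        hmem.mono fun p hp => hp.1⟩
    rcases lt_or_gt_of_ne hx with h | h
    · rw [indicator_of_mem (show x ∈ Ioc 0 R₀ from ⟨hx0', h.le⟩)]
      refine ((hg.2.1 x hx0' z₀ hz₀).tendsto.comp hfst).congr' ?_
      filter_upwards [hsnd.eventually (lt_mem_nhds h)] with p hp
      rw [indicator_of_mem (show x ∈ Ioc 0 p.2 from ⟨hx0', hp.le⟩)]
      rfl
    · rw [indicator_of_notMem (fun hh : x ∈ Ioc 0 R₀ => absurd hh.2 (not_le.2 h))]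
      refine tendsto_const_nhds.congr' ?_
      filter_upwards [hsnd.eventually (gt_mem_nhds h)] with p hp
      rw [indicator_of_notMem (fun hh : x ∈ Ioc 0 p.2 => absurd hh.2 (not_le.2 hp))]
  · obtain ⟨h1, -, b, hb, hbd⟩ := hg
    refine ⟨∫ x in Ioi 0, b x, ?_⟩
    rintro ⟨z, R⟩ ⟨hz, hR⟩
    have hR' : 0 < R := hR
    have hb0 : ∀ x ∈ Ioi (0 : ℝ), 0 ≤ b x := fun x hx => (abs_nonneg _).trans (hbd z hz x hx)
    dsimp only
    rw [intervalIntegral.integral_of_le hR'.le]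
    have hle : ‖∫ x in Ioc 0 R, g z x‖ ≤ ∫ x in Ioc 0 R, b x := by
      refine norm_integral_le_of_norm_le (hb.mono_set Ioc_subset_Ioi_self) ?_
      filter_upwards [ae_restrict_mem measurableSet_Ioc] with x hx
      exact hbd z hz x hx.1
    refine hle.trans (setIntegral_mono_set hb ?_ Ioc_subset_Ioi_self.eventuallyLE)
    · filter_upwards [ae_restrict_mem measurableSet_Ioi] with x hx
      exact hb0 x hx

theorem DominatedOn.tendsto_atTop {g : ℝ → ℝ → ℝ} {S : Set ℝ} (hg : DominatedOn g S) {ι : Type*}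
    {l : Filter ι} [l.IsCountablyGenerated] {z R : ι → ℝ} {z₀ : ℝ} (hz₀ : z₀ ∈ S)
    (hz : Tendsto z l (𝓝[S] z₀)) (hR : Tendsto R l atTop) :
    Tendsto (fun i => ∫ x in (0 : ℝ)..R i, g (z i) x) l (𝓝 (∫ x in Ioi 0, g z₀ x)) := by
  refine hg.tendsto (hz.eventually self_mem_nhdsWithin) (hR.eventually_gt_atTop 0) ?_
  filter_upwards [ae_restrict_mem measurableSet_Ioi] with x hx
  have hx0 : 0 < x := hx
  refine ((hg.2.1 x hx z₀ hz₀).tendsto.comp hz).congr' ?_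
  filter_upwards [hR.eventually_ge_atTop x] with i hi
  rw [indicator_of_mem (show x ∈ Ioc 0 (R i) from ⟨hx0, hi⟩)]
  rfl

theorem BddContOn.mono {X : Type*} [TopologicalSpace X] {f : X → ℝ} {S S' : Set X}
    (hf : BddContOn f S) (h : S' ⊆ S) : BddContOn f S' :=
  ⟨hf.1.mono h, hf.2.imp fun _ hC x hx => hC x (h hx)⟩

theorem BddContOn.congr {X : Type*} [TopologicalSpace X] {f f' : X → ℝ} {S : Set X}
    (hf : BddContOn f S) (h : ∀ x ∈ S, f' x = f x) : BddContOn f' S :=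
  ⟨hf.1.congr h, hf.2.imp fun C hC x hx => by rw [h x hx]; exact hC x hx⟩

theorem BddContOn.mul {X : Type*} [TopologicalSpace X] {f f' : X → ℝ} {S : Set X}
    (hf : BddContOn f S) (hf' : BddContOn f' S) : BddContOn (fun x => f x * f' x) S := by
  obtain ⟨C, hC⟩ := hf.2
  obtain ⟨C', hC'⟩ := hf'.2
  refine ⟨hf.1.mul hf'.1, C * C', fun x hx => ?_⟩
  rw [abs_mul]
  exact mul_le_mul (hC x hx) (hC' x hx) (abs_nonneg _) ((abs_nonneg _).trans (hC x hx))

/-! ### Weights and arguments depending on `w` -/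

theorem one_le_w {z x : ℝ} (hz : z ≤ 1) (hx : 0 ≤ x) : 1 ≤ w z x := by
  have : 0 ≤ (1 - z) * x := mul_nonneg (by linarith) hx
  rw [w]
  linarith

theorem w_le {z x : ℝ} (hz : 0 ≤ z) (hx : 0 ≤ x) : w z x ≤ 1 + x := by
  rw [w]
  nlinarith

theorem div_w_mem {z y x : ℝ} (hz : z ≤ 1) (hy : y ∈ Icc (0 : ℝ) 1) (hx : 0 ≤ x) :
    y / w z x ∈ Icc (0 : ℝ) 1 := by
  have h := one_le_w hz hx
  exact ⟨div_nonneg hy.1 (by linarith), div_le_one_of_le₀ (by linarith [hy.2]) (by linarith)⟩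

theorem one_sub_mul_div_w_le {z x : ℝ} (hz0 : 0 ≤ z) (hz : z ≤ 1) (hx : 0 < x) :
    (1 - z) * x / w z x ≤ x / (1 + x) := by
  have h := one_le_w hz hx.le
  rw [div_le_div_iff₀ (by linarith) (by linarith), w]
  nlinarith [mul_nonneg hz0 hx.le]

theorem abs_sub_div_w_le {z x : ℝ} (hz : z ∈ Icc (0 : ℝ) 1) (hx : 0 < x) :
    |z - z / w z x| ≤ x / (1 + x) := by
  have h := one_le_w hz.2 hx.le
  have e : z - z / w z x = z * ((1 - z) * x / w z x) := by
    have : w z x ≠ 0 := by linarith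
    field_simp
    rw [w]
    ring
  have h1 : 0 ≤ (1 - z) * x / w z x :=
    div_nonneg (mul_nonneg (by linarith [hz.2]) hx.le) (by linarith)
  rw [e, abs_of_nonneg (mul_nonneg hz.1 h1)]
  exact (mul_le_of_le_one_left h1 hz.2).trans (one_sub_mul_div_w_le hz.1 hz.2 hx)

/-- Since `1 ≤ w ≤ 1 + x`, the weight lies between `(1 + x)⁻¹` and `1`. -/
theorem abs_one_sub_weight_le {a b z x : ℝ} (ha : a ≤ 0) (hab : a + b ≤ 0) (ha' : -1 ≤ a)
    (hab' : -1 ≤ a + b) (hz : z ∈ Icc (0 : ℝ) 1) (hx : 0 < x) :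
    |1 - (1 + x) ^ a * w z x ^ b| ≤ x / (1 + x) := by
  have h1 := one_le_w hz.2 hx.le
  have h2 := w_le hz.1 hx.le
  have hP : 1 ≤ 1 + x := by linarith
  have hP0 : 0 < 1 + x := by linarith
  have hle : (1 + x) ^ a * w z x ^ b ≤ 1 ∧ (1 + x)⁻¹ ≤ (1 + x) ^ a * w z x ^ b := by
    rw [← Real.rpow_neg_one]
    rcases le_total 0 b with hb | hb
    · constructor
      · calc (1 + x) ^ a * w z x ^ b ≤ (1 + x) ^ a * (1 + x) ^ b := by
              gcongr
          _ = (1 + x) ^ (a + b) := (Real.rpow_add hP0 a b).symm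
          _ ≤ 1 := Real.rpow_le_one_of_one_le_of_nonpos hP hab
      · calc (1 + x) ^ (-1 : ℝ) ≤ (1 + x) ^ a := Real.rpow_le_rpow_of_exponent_le hP ha'
          _ ≤ (1 + x) ^ a * w z x ^ b :=
            le_mul_of_one_le_right (by positivity) (Real.one_le_rpow h1 hb)
    · constructor
      · exact mul_le_one₀ (Real.rpow_le_one_of_one_le_of_nonpos hP ha)
          (Real.rpow_nonneg (by linarith) _) (Real.rpow_le_one_of_one_le_of_nonpos h1 hb)
      · calc (1 + x) ^ (-1 : ℝ) ≤ (1 + x) ^ (a + b) := Real.rpow_le_rpow_of_exponent_le hP hab'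
          _ = (1 + x) ^ a * (1 + x) ^ b := Real.rpow_add hP0 a b
          _ ≤ (1 + x) ^ a * w z x ^ b := by
            refine mul_le_mul_of_nonneg_left ?_ (by positivity)
            exact Real.rpow_le_rpow_of_nonpos (by linarith) h2 hb
  have e : x / (1 + x) = 1 - (1 + x)⁻¹ := by field_simp; ring
  rw [abs_of_nonneg (by linarith [hle.1]), e]
  linarith [hle.2]

/-- A growing weight is compensated by the factor `1 - z`, because `(1 - z) (1 + x) ≤ w`. -/
theorem one_sub_mul_abs_one_sub_weight_le {a b z x : ℝ} (ha : a ≤ 1)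
    (hb : b ≤ -1) (hab' : -1 ≤ a + b) (hz : z ∈ Icc (0 : ℝ) 1) (hx : 0 < x) :
    (1 - z) * |1 - (1 + x) ^ a * w z x ^ b| ≤ x / (1 + x) := by
  have h1 := one_le_w hz.2 hx.le
  have h2 := w_le hz.1 hx.le
  have hP : 1 ≤ 1 + x := by linarith
  have hP0 : 0 < 1 + x := by linarith
  have hw0 : 0 < w z x := by linarith
  have hz1 : 0 ≤ 1 - z := by linarith [hz.2]
  have hup : (1 + x) ^ a * w z x ^ b ≤ (1 + x) / w z x := by
    rw [div_eq_mul_inv, ← Real.rpow_neg_one (w z x)]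
    refine mul_le_mul ?_ (Real.rpow_le_rpow_of_exponent_le h1 hb) (by positivity) hP0.le
    calc (1 + x) ^ a ≤ (1 + x) ^ (1 : ℝ) := Real.rpow_le_rpow_of_exponent_le hP ha
      _ = 1 + x := Real.rpow_one _
  have hlow : (1 + x)⁻¹ ≤ (1 + x) ^ a * w z x ^ b := by
    rw [← Real.rpow_neg_one]
    calc (1 + x) ^ (-1 : ℝ) ≤ (1 + x) ^ (a + b) := Real.rpow_le_rpow_of_exponent_le hP hab'
      _ = (1 + x) ^ a * (1 + x) ^ b := Real.rpow_add hP0 a b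
      _ ≤ (1 + x) ^ a * w z x ^ b := by
        refine mul_le_mul_of_nonneg_left ?_ (by positivity)
        exact Real.rpow_le_rpow_of_nonpos hw0 h2 (by linarith)
  have e : x / (1 + x) = 1 - (1 + x)⁻¹ := by field_simp; ring
  have hq : 0 ≤ x / (1 + x) := by positivity
  have habs : (1 - z) * |1 - (1 + x) ^ a * w z x ^ b|
      = |(1 - z) * (1 - (1 + x) ^ a * w z x ^ b)| := by rw [abs_mul, abs_of_nonneg hz1]
  rw [habs, abs_le]
  constructor
  · have h3 : (1 - z) * ((1 + x) / w z x - 1) = z * ((1 - z) * x / w z x) := by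
      field_simp
      rw [w]
      ring
    have h4 : 0 ≤ (1 - z) * x / w z x := by positivity
    have h5 := (mul_le_of_le_one_left h4 hz.2).trans (one_sub_mul_div_w_le hz.1 hz.2 hx)
    nlinarith [mul_le_mul_of_nonneg_left hup hz1]
  · have h3 : 1 - (1 + x) ^ a * w z x ^ b ≤ x / (1 + x) := by rw [e]; linarith
    have h4 := mul_le_mul_of_nonneg_left h3 hz1
    have h5 : (1 - z) * (x / (1 + x)) ≤ x / (1 + x) :=
      mul_le_of_le_one_left hq (by linarith [hz.1])
    linarith

theorem continuousOn_weight {a b z : ℝ} (hz : z ≤ 1) :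
    ContinuousOn (fun x => (1 + x) ^ a * w z x ^ b) (Ioi 0) := by
  refine ContinuousOn.mul ?_ ?_
  · exact ContinuousOn.rpow_const (by fun_prop) fun x hx => Or.inl (by
      have : 0 < x := hx
      positivity)
  · refine ContinuousOn.rpow_const (by unfold w; fun_prop) fun x hx => Or.inl ?_
    have := one_le_w hz (le_of_lt (mem_Ioi.1 hx))
    linarith

theorem continuousOn_w_rpow {b x : ℝ} (hx : 0 < x) :
    ContinuousOn (fun z => w z x ^ b) (Ioc 0 1) := by
  refine ContinuousOn.rpow_const (by unfold w; fun_prop) fun z hz => Or.inl ?_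
  have := one_le_w hz.2 hx.le
  linarith

theorem continuousOn_comp_div_w {f : ℝ → ℝ} (hf : ContinuousOn f (Icc 0 1)) {y z : ℝ}
    (hz : z ≤ 1) (hy : y ∈ Icc (0 : ℝ) 1) : ContinuousOn (fun x => f (y / w z x)) (Ioi 0) := by
  refine hf.comp (ContinuousOn.div continuousOn_const (by unfold w; fun_prop) fun x hx => ?_)
    fun x hx => div_w_mem hz hy (le_of_lt hx)
  have := one_le_w hz (le_of_lt (mem_Ioi.1 hx))
  linarith

theorem continuousOn_comp_div_w' {f y : ℝ → ℝ} (hf : ContinuousOn f (Icc 0 1))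
    (hy : Continuous y) (hy1 : ∀ z ∈ Ioc (0 : ℝ) 1, y z ∈ Icc (0 : ℝ) 1) {x : ℝ} (hx : 0 < x) :
    ContinuousOn (fun z => f (y z / w z x)) (Ioc 0 1) := by
  refine hf.comp (ContinuousOn.div hy.continuousOn (by unfold w; fun_prop) fun z hz => ?_)
    fun z hz => div_w_mem hz.2 (hy1 z hz) hx.le
  have := one_le_w hz.2 hx.le
  linarith

/-- The integrals `Ψ`: a Hölder modulus of exponent `σ > γ` beats the singularity
`x ^ (-1 - γ)` at the origin. The common bound is a multiple of
`x ^ (σ - γ - 1) (1 + x) ^ (-σ)`. -/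
theorem dominatedOn_weighted_difference {f c : ℝ → ℝ} {σ γ a b : ℝ} (hγ : 0 < γ) (hσ : γ < σ)
    (hσ1 : σ ≤ 1) (hf : HolderOnUnit σ f) (hc : Continuous c)
    (hc1 : ∀ z ∈ Icc (0 : ℝ) 1, |c z| ≤ 1)
    (hm : ∀ z ∈ Icc (0 : ℝ) 1, ∀ x, 0 < x →
      |c z| * |1 - (1 + x) ^ a * w z x ^ b| ≤ x / (1 + x)) :
    DominatedOn (fun z x => c z *
      (x ^ (-1 - γ) * (f z - (1 + x) ^ a * w z x ^ b * f (z / w z x)))) (Ioc 0 1) := by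
  have hσ0 : 0 < σ := hγ.trans hσ
  obtain ⟨C, hC0, hCb, hC⟩ := hf.exists_const hσ0
  have hfc := hf.continuousOn hσ0
  refine ⟨fun z hz => ?_, fun x hx => ?_,
    fun x => 2 * C * (x ^ (σ - γ - 1) * (1 + x) ^ (-(σ - γ) - γ)),
    (beta_prime (sub_pos.2 hσ) hγ).1.const_mul _, fun z hz x hx => ?_⟩
  · have hz' : z ∈ Icc (0 : ℝ) 1 := ⟨hz.1.le, hz.2⟩
    refine continuousOn_const.mul (ContinuousOn.mul ?_ ?_)
    · exact continuousOn_id.rpow_const fun x hx => Or.inl (ne_of_gt hx)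
    · exact continuousOn_const.sub
        ((continuousOn_weight hz.2).mul (continuousOn_comp_div_w hfc hz.2 hz'))
  · refine hc.continuousOn.mul (continuousOn_const.mul (ContinuousOn.sub ?_ ?_))
    · exact hfc.mono fun z hz => ⟨hz.1.le, hz.2⟩
    · exact (continuousOn_const.mul (continuousOn_w_rpow hx)).mul
        (continuousOn_comp_div_w' hfc continuous_id (fun z hz => ⟨hz.1.le, hz.2⟩) hx)
  · have hz' : z ∈ Icc (0 : ℝ) 1 := ⟨hz.1.le, hz.2⟩
    have hP0 : 0 < 1 + x := by linarith
    set r := x / (1 + x) with hr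
    have hr0 : 0 ≤ r := by positivity
    have hr1 : r ≤ 1 := by rw [hr, div_le_one hP0]; linarith
    have hmem := div_w_mem hz.2 hz' hx.le
    have h1 : |f z - f (z / w z x)| ≤ C * r ^ σ := by
      refine (hC z hz' _ hmem).trans (mul_le_mul_of_nonneg_left ?_ hC0)
      exact Real.rpow_le_rpow (abs_nonneg _) (abs_sub_div_w_le hz' hx) hσ0.le
    have h2 : r ≤ r ^ σ := Real.self_le_rpow_of_le_one hr0 hr1 hσ1
    have h3 : |c z * (f z - (1 + x) ^ a * w z x ^ b * f (z / w z x))| ≤ 2 * C * r ^ σ := by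
      set m := (1 + x) ^ a * w z x ^ b
      calc |c z * (f z - m * f (z / w z x))|
          = |c z * (f z - f (z / w z x)) + c z * (1 - m) * f (z / w z x)| := by congr 1; ring
        _ ≤ |c z| * |f z - f (z / w z x)| + |c z| * |1 - m| * |f (z / w z x)| := by
            refine (abs_add_le _ _).trans ?_
            rw [abs_mul, abs_mul, abs_mul]
        _ ≤ 1 * (C * r ^ σ) + r * C := by
            gcongr
            · exact hc1 z hz'
            · exact hm z hz' x hx
            · exact hCb _ hmem
        _ ≤ 2 * C * r ^ σ := by nlinarith
    dsimp only
    rw [mul_left_comm, abs_mul, abs_of_pos (Real.rpow_pos_of_pos hx _)]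
    refine (mul_le_mul_of_nonneg_left h3 (Real.rpow_nonneg hx.le _)).trans (le_of_eq ?_)
    rw [hr, Real.div_rpow hx.le hP0.le, show σ - γ - 1 = (-1 - γ) + σ by ring, Real.rpow_add hx,
      show -(σ - γ) - γ = -σ by ring, Real.rpow_neg hP0.le]
    ring

/-- The integrals `Λ`, with common bound a multiple of `x ^ (α - 1) (1 + x)⁻¹`. -/
theorem dominatedOn_mul_comp {f : ℝ → ℝ} {h : ℝ → ℝ → ℝ} {α M : ℝ} (hα : α ∈ Ioo (0 : ℝ) 1)
    (hf : ContinuousOn f (Icc 0 1)) (h1 : ∀ z ∈ Ioc (0 : ℝ) 1, ContinuousOn (h z) (Ioi 0))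
    (h2 : ∀ x, 0 < x → ContinuousOn (fun z => h z x) (Ioc 0 1))
    (hh : ∀ z ∈ Ioc (0 : ℝ) 1, ∀ x, 0 < x → |h z x| ≤ M * (x ^ (α - 1) * (1 + x)⁻¹)) :
    DominatedOn (fun z x => h z x * f (1 / w z x)) (Ioc 0 1) := by
  obtain ⟨C, hC⟩ := isCompact_Icc.exists_bound_of_continuousOn hf
  refine ⟨fun z hz => ?_, fun x hx => ?_,
    fun x => M * (x ^ (α - 1) * (1 + x) ^ (-α - (1 - α))) * C,
    ((beta_prime hα.1 (sub_pos.2 hα.2)).1.const_mul M).mul_const C, fun z hz x hx => ?_⟩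
  · exact (h1 z hz).mul (continuousOn_comp_div_w hf hz.2 ⟨zero_le_one, le_rfl⟩)
  · exact (h2 x hx).mul
      (continuousOn_comp_div_w' hf continuous_const (fun z hz => ⟨zero_le_one, le_rfl⟩) hx)
  · have hP0 : 0 < 1 + x := by linarith
    dsimp only
    rw [show -α - (1 - α) = -1 by ring, Real.rpow_neg_one, abs_mul]
    exact mul_le_mul (hh z hz x hx) (hC _ (div_w_mem hz.2 ⟨zero_le_one, le_rfl⟩ hx.le))
      (abs_nonneg _) ((abs_nonneg _).trans (hh z hz x hx))

/-! ### Hölder exponents of the hypergeometric functions -/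

theorem holderOnUnit_of_mul_beta {f : ℝ → ℝ} {p q a r : ℝ} {B : ℝ} (hp : 0 < p) (ha : 0 ≤ a)
    (hq : a < q) (hr : r = q - a) (hr1 : r < 1) (hB : B ≠ 0)
    (hf : ∀ z ∈ Icc (0 : ℝ) 1, f z * B = eulerIntegral p q a z) : HolderOnUnit r f := by
  subst hr
  refine ((holderOnUnit_eulerIntegral hp ha hq hr1).const_mul B⁻¹).congr fun z hz => ?_
  rw [← hf z hz]
  field_simp

section

variable {H₁ H₂ : ℝ} (hH₁ : 1 / 2 < H₁) (hH₁₂ : H₁ < H₂) (hH₂ : H₂ < 1)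
include hH₁ hH₁₂ hH₂

theorem holderOnUnit_F₁ : HolderOnUnit (alpha H₁ H₂) (F₁ H₁ H₂) :=
  holderOnUnit_of_mul_beta (by linarith) (by linarith) (by linarith) (by rw [alpha]; ring)
    (by rw [alpha]; linarith) (ProbabilityTheory.beta_pos (by linarith) (by linarith)).ne'
    fun _ hz => F₁_eq hH₁ hH₁₂ hH₂ hz

theorem holderOnUnit_F₂ : HolderOnUnit (beta H₁ H₂) (F₂ H₁ H₂) :=
  holderOnUnit_of_mul_beta (by linarith) (by linarith) (by linarith) (by rw [beta]; ring)
    (by rw [beta]; linarith) (ProbabilityTheory.beta_pos (by linarith) (by linarith)).ne'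
    fun _ hz => F₂_eq' hH₁ hH₁₂ hH₂ hz

theorem holderOnUnit_F₃ : HolderOnUnit (alpha H₁ H₂) (F₃ H₁ H₂) := by
  have h : HolderOnUnit (alpha H₁ H₂) fun z => F₃ H₁ H₂ (1 - z) :=
    holderOnUnit_of_mul_beta (p := 3 / 2 - H₁) (q := 2 * H₂ - 1) (a := H₁ - 1 / 2)
      (B := ProbabilityTheory.beta (3 / 2 - H₁) (2 * H₂ - 1))
      (by linarith) (by linarith) (by linarith) (by rw [alpha]; ring)
      (by rw [alpha]; linarith) (ProbabilityTheory.beta_pos (by linarith) (by linarith)).ne'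
      fun z hz => by
        rw [F₃_eq hH₁ hH₁₂ hH₂ ⟨by linarith [hz.2], by linarith [hz.1]⟩, sub_sub_cancel]
  simpa using h.comp_one_sub

theorem holderOnUnit_F₄ : HolderOnUnit (beta H₁ H₂) (F₄ H₁ H₂) := by
  have h : HolderOnUnit (beta H₁ H₂) fun z => F₄ H₁ H₂ (1 - z) :=
    holderOnUnit_of_mul_beta (p := 2 * H₂ - 1) (q := 5 / 2 - H₁) (a := 2 * H₂ - 2 * H₁ + 1)
      (B := ProbabilityTheory.beta (2 * H₂ - 1) (5 / 2 - H₁))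
      (by linarith) (by linarith) (by linarith) (by rw [beta]; ring)
      (by rw [beta]; linarith) (ProbabilityTheory.beta_pos (by linarith) (by linarith)).ne'
      fun z hz => by
        rw [F₄_eq' hH₁ hH₁₂ hH₂ ⟨by linarith [hz.2], by linarith [hz.1]⟩, sub_sub_cancel]
  simpa using h.comp_one_sub

theorem holderOnUnit_F₅ : HolderOnUnit (beta H₁ H₂) (F₅ H₁ H₂) :=
  holderOnUnit_of_mul_beta (by linarith) (by linarith) (by linarith) (by rw [beta]; ring)
    (by rw [beta]; linarith) (ProbabilityTheory.beta_pos (by linarith) (by linarith)).ne'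
    fun _ hz => F₅_eq' hH₁ hH₁₂ hH₂ hz

theorem alpha_mem : alpha H₁ H₂ ∈ Ioo (0 : ℝ) 1 := by
  rw [alpha]
  constructor <;> linarith

theorem beta_mem : beta H₁ H₂ ∈ Ioo (0 : ℝ) 1 := by
  rw [beta]
  constructor <;> linarith

end

/-! ### Bounds for `Ψ` and `Λ` -/

theorem DominatedOn.congr {g g' : ℝ → ℝ → ℝ} {S : Set ℝ} (hg : DominatedOn g S)
    (h : ∀ z ∈ S, ∀ x, 0 < x → g' z x = g z x) : DominatedOn g' S := by
  obtain ⟨h1, h2, b, hb, hbd⟩ := hg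
  refine ⟨fun z hz => (h1 z hz).congr fun x hx => h z hz x hx,
    fun x hx => (h2 x hx).congr fun z hz => h z hz x hx, b, hb, fun z hz x hx => ?_⟩
  rw [h z hz x hx]
  exact hbd z hz x hx

theorem div_rpow_half {H x y : ℝ} (hx : 0 < x) :
    y / x ^ (H + 1 / 2) = x ^ (-1 - (H - 1 / 2)) * y := by
  rw [show -1 - (H - 1 / 2) = -(H + 1 / 2) by ring, Real.rpow_neg hx.le]
  ring

section

variable {H₁ H₂ : ℝ} (hH₁ : 1 / 2 < H₁) (hH₁₂ : H₁ < H₂) (hH₂ : H₂ < 1)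
include hH₁ hH₁₂ hH₂

theorem dominatedOn_Psi₁ : DominatedOn (Psi₁Integrand H₁ H₂) (Ioc 0 1) := by
  have hα := alpha_mem hH₁ hH₁₂ hH₂
  refine (dominatedOn_weighted_difference (γ := H₁ - 1 / 2) (a := 2 * H₂ - H₁ - 3 / 2)
    (b := H₁ - 1 / 2) (c := fun _ => 1) (by linarith) (by rw [alpha]; linarith) hα.2.le
    ((holderOnUnit_F₃ hH₁ hH₁₂ hH₂).affine_mul hα.1 hα.2.le (D₃ H₁ H₂) (D₅ H₁ H₂))
    continuous_const (fun z _ => by simp) fun z hz x hx => ?_).congr fun z hz x hx => ?_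
  · rw [abs_one, one_mul]
    exact abs_one_sub_weight_le (by linarith) (by linarith) (by linarith) (by linarith) hz hx
  · rw [Psi₁Integrand, show -H₁ - 1 / 2 = -1 - (H₁ - 1 / 2) by ring]
    ring

theorem dominatedOn_Psi₂ :
    DominatedOn (fun z x => (1 - z) * Psi₂Integrand H₁ H₂ z x) (Ioc 0 1) := by
  have hβ := beta_mem hH₁ hH₁₂ hH₂
  refine (dominatedOn_weighted_difference (γ := H₁ - 1 / 2) (a := 2 * H₂ - H₁ - 1 / 2)
    (b := 2 * H₁ - 2 * H₂ - 1) (c := fun z => 1 - z) (by linarith) (by rw [beta]; linarith) hβ.2.le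
    (holderOnUnit_F₄ hH₁ hH₁₂ hH₂) (by fun_prop) (fun z hz => ?_)
    fun z hz x hx => ?_).congr fun z hz x hx => ?_
  · rw [abs_le]
    constructor <;> linarith [hz.1, hz.2]
  · rw [abs_of_nonneg (by linarith [hz.2] : 0 ≤ 1 - z)]
    exact one_sub_mul_abs_one_sub_weight_le (by linarith) (by linarith) (by linarith) hz hx
  · rw [Psi₂Integrand, div_rpow_half hx]

theorem dominatedOn_Psi₃ : DominatedOn (Psi₃Integrand H₁ H₂) (Ioc 0 1) := by
  have hβ := beta_mem hH₁ hH₁₂ hH₂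
  refine (dominatedOn_weighted_difference (γ := H₁ - 1 / 2) (a := 2 * H₂ - H₁ - 3 / 2)
    (b := 2 * H₁ - 2 * H₂) (c := fun _ => 1) (by linarith) (by rw [beta]; linarith) hβ.2.le
    (holderOnUnit_F₅ hH₁ hH₁₂ hH₂) continuous_const (fun z _ => by simp)
    fun z hz x hx => ?_).congr fun z hz x hx => ?_
  · rw [abs_one, one_mul]
    exact abs_one_sub_weight_le (by linarith) (by linarith) (by linarith) (by linarith) hz hx
  · rw [Psi₃Integrand, div_rpow_half hx, one_mul]

theorem D₃_nonneg : 0 ≤ D₃ H₁ H₂ := by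
  have h := ProbabilityTheory.beta_pos (show 0 < 3 / 2 - H₁ by linarith)
    (show 0 < 2 * H₂ - 1 by linarith)
  rw [D₃]
  nlinarith

theorem D₅_nonneg : 0 ≤ D₅ H₁ H₂ := by
  have h := ProbabilityTheory.beta_pos (show 0 < 3 / 2 - H₁ by linarith)
    (show 0 < 2 * H₂ - 1 by linarith)
  rw [D₅]
  nlinarith

omit hH₁ hH₁₂ hH₂ in
theorem continuousOn_rpow_mul_rpow (p q : ℝ) :
    ContinuousOn (fun x : ℝ => x ^ p * (1 + x) ^ q) (Ioi 0) := by
  refine (continuousOn_id.rpow_const fun x hx => Or.inl (ne_of_gt hx)).mul ?_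
  refine ContinuousOn.rpow_const (by fun_prop) fun x hx => Or.inl ?_
  have : (0 : ℝ) < x := hx
  positivity

omit hH₁ hH₁₂ hH₂ in
theorem continuousOn_w_rpow' {b z : ℝ} (hz : z ≤ 1) :
    ContinuousOn (fun x => w z x ^ b) (Ioi 0) := by
  refine ContinuousOn.rpow_const (by unfold w; fun_prop) fun x hx => Or.inl ?_
  have := one_le_w hz (le_of_lt (mem_Ioi.1 hx))
  linarith

theorem dominatedOn_Lambda₁ : DominatedOn (Lambda₁Integrand H₁ H₂) (Ioc 0 1) := by
  have hα := alpha_mem hH₁ hH₁₂ hH₂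
  have h3 := D₃_nonneg hH₁ hH₁₂ hH₂
  have h5 := D₅_nonneg hH₁ hH₁₂ hH₂
  refine dominatedOn_mul_comp (α := alpha H₁ H₂) (M := D₃ H₁ H₂ + D₅ H₁ H₂) hα
    ((holderOnUnit_F₃ hH₁ hH₁₂ hH₂).continuousOn hα.1) (fun z hz => ?_) (fun x hx => ?_)
    fun z hz x hx => ?_
  · exact ((continuousOn_rpow_mul_rpow _ _).mul (continuousOn_w_rpow' hz.2)).mul (by fun_prop)
  · exact (continuousOn_const.mul (continuousOn_w_rpow hx)).mul (by fun_prop)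
  · have hw := one_le_w hz.2 hx.le
    have hw0 : 0 < w z x := by linarith
    have hw2 := w_le hz.1.le hx.le
    have hP0 : 0 < 1 + x := by linarith
    have hx1 : 0 ≤ (1 - z) * x := mul_nonneg (by linarith [hz.2]) hx.le
    -- the bracket is at most `(D₃ + D₅) w`, which raises the exponent of `w` to `H₁ - 1/2 ≥ 0`
    have e1 : (D₃ H₁ H₂ + D₅ H₁ H₂) + D₃ H₁ H₂ * (1 - z) * x
        ≤ (D₃ H₁ H₂ + D₅ H₁ H₂) * w z x := by
      rw [w]
      nlinarith
    have e0 : 0 ≤ (D₃ H₁ H₂ + D₅ H₁ H₂) + D₃ H₁ H₂ * (1 - z) * x := by nlinarith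
    have e2 : w z x ^ (H₁ - 3 / 2) * w z x ≤ (1 + x) ^ (H₁ - 1 / 2) := by
      nth_rewrite 2 [← Real.rpow_one (w z x)]
      rw [← Real.rpow_add hw0, show H₁ - 3 / 2 + 1 = H₁ - 1 / 2 by ring]
      exact Real.rpow_le_rpow hw0.le hw2 (by linarith)
    have e3 : (1 + x)⁻¹ = (1 + x) ^ (-H₁ - 1 / 2) * (1 + x) ^ (H₁ - 1 / 2) := by
      rw [← Real.rpow_add hP0, ← Real.rpow_neg_one]
      congr 1
      ring
    rw [abs_of_nonneg (by positivity), e3, alpha,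
      show 2 * H₂ - H₁ - 1 / 2 - 1 = 2 * H₂ - H₁ - 3 / 2 by ring]
    calc _ ≤ x ^ (2 * H₂ - H₁ - 3 / 2) * (1 + x) ^ (-H₁ - 1 / 2) * w z x ^ (H₁ - 3 / 2)
            * ((D₃ H₁ H₂ + D₅ H₁ H₂) * w z x) := by gcongr
      _ = (D₃ H₁ H₂ + D₅ H₁ H₂) * (x ^ (2 * H₂ - H₁ - 3 / 2) * ((1 + x) ^ (-H₁ - 1 / 2) *
            (w z x ^ (H₁ - 3 / 2) * w z x))) := by ring
      _ ≤ _ := by gcongr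

theorem dominatedOn_Lambda₂ :
    DominatedOn (fun z x => (1 - z) * Lambda₂Integrand H₁ H₂ z x) (Ioc 0 1) := by
  have hα := alpha_mem hH₁ hH₁₂ hH₂
  refine (dominatedOn_mul_comp (α := alpha H₁ H₂) (M := 1) (h := fun z x => (1 - z) *
    (x ^ (2 * H₂ - H₁ - 1 / 2) * (1 + x) ^ (-H₁ - 1 / 2) * w z x ^ (2 * H₁ - 2 * H₂ - 1))) hα
    ((holderOnUnit_F₄ hH₁ hH₁₂ hH₂).continuousOn (beta_mem hH₁ hH₁₂ hH₂).1)
    (fun z hz => ?_) (fun x hx => ?_) fun z hz x hx => ?_).congr fun z hz x hx => ?_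
  · exact continuousOn_const.mul ((continuousOn_rpow_mul_rpow _ _).mul (continuousOn_w_rpow' hz.2))
  · exact ContinuousOn.mul (by fun_prop) (continuousOn_const.mul (continuousOn_w_rpow hx))
  · have hw := one_le_w hz.2 hx.le
    have hw0 : 0 < w z x := by linarith
    have hP : 1 ≤ 1 + x := by linarith
    have hz1 : 0 ≤ 1 - z := by linarith [hz.2]
    have e1 : w z x ^ (2 * H₁ - 2 * H₂ - 1) ≤ (w z x)⁻¹ := by
      rw [← Real.rpow_neg_one]
      exact Real.rpow_le_rpow_of_exponent_le hw (by linarith)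
    have e2 : (1 + x) ^ (-H₁ - 1 / 2) ≤ (1 + x)⁻¹ := by
      rw [← Real.rpow_neg_one]
      exact Real.rpow_le_rpow_of_exponent_le hP (by linarith)
    have e3 : (1 - z) * x * (w z x)⁻¹ ≤ 1 := by
      rw [← div_eq_mul_inv, div_le_one hw0, w]
      linarith
    have e4 : x ^ (2 * H₂ - H₁ - 1 / 2) = x ^ (alpha H₁ H₂ - 1) * x := by
      nth_rewrite 3 [← Real.rpow_one x]
      rw [← Real.rpow_add hx, alpha]
      congr 1
      ring
    rw [abs_of_nonneg (by positivity), e4]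
    calc _ ≤ (1 - z) * (x ^ (alpha H₁ H₂ - 1) * x * (1 + x)⁻¹ * (w z x)⁻¹) := by gcongr
      _ = ((1 - z) * x * (w z x)⁻¹) * (x ^ (alpha H₁ H₂ - 1) * (1 + x)⁻¹) := by ring
      _ ≤ _ := by gcongr
  · rw [Lambda₂Integrand]
    ring

theorem dominatedOn_Lambda₃ : DominatedOn (Lambda₃Integrand H₁ H₂) (Ioc 0 1) := by
  have hα := alpha_mem hH₁ hH₁₂ hH₂
  refine dominatedOn_mul_comp (α := alpha H₁ H₂) (M := 1) hα
    ((holderOnUnit_F₅ hH₁ hH₁₂ hH₂).continuousOn (beta_mem hH₁ hH₁₂ hH₂).1)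
    (fun z hz => ?_) (fun x hx => ?_) fun z hz x hx => ?_
  · exact (continuousOn_rpow_mul_rpow _ _).mul (continuousOn_w_rpow' hz.2)
  · exact continuousOn_const.mul (continuousOn_w_rpow hx)
  · have hw := one_le_w hz.2 hx.le
    have hw0 : 0 < w z x := by linarith
    have hP : 1 ≤ 1 + x := by linarith
    have e1 : w z x ^ (2 * H₁ - 2 * H₂) ≤ 1 :=
      Real.rpow_le_one_of_one_le_of_nonpos hw (by linarith)
    have e2 : (1 + x) ^ (-H₁ - 1 / 2) ≤ (1 + x)⁻¹ := by
      rw [← Real.rpow_neg_one]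
      exact Real.rpow_le_rpow_of_exponent_le hP (by linarith)
    rw [abs_of_nonneg (by positivity), alpha,
      show 2 * H₂ - H₁ - 1 / 2 - 1 = 2 * H₂ - H₁ - 3 / 2 by ring, one_mul]
    calc _ ≤ x ^ (2 * H₂ - H₁ - 3 / 2) * (1 + x)⁻¹ * 1 := by gcongr
      _ = _ := mul_one _

theorem intervalIntegrable_Psi₂ {z R : ℝ} (hz : z ∈ Ioo (0 : ℝ) 1) (hR : 0 ≤ R) :
    IntervalIntegrable (Psi₂Integrand H₁ H₂ z) volume 0 R := by
  have h := ((dominatedOn_Psi₂ hH₁ hH₁₂ hH₂).intervalIntegrable ⟨hz.1, hz.2.le⟩ hR).const_mul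
    (1 - z)⁻¹
  have hz1 : 1 - z ≠ 0 := by linarith [hz.2]
  simpa [inv_mul_cancel_left₀ hz1] using h

theorem intervalIntegrable_Lambda₂ {z R : ℝ} (hz : z ∈ Ioo (0 : ℝ) 1) (hR : 0 ≤ R) :
    IntervalIntegrable (Lambda₂Integrand H₁ H₂ z) volume 0 R := by
  have h := ((dominatedOn_Lambda₂ hH₁ hH₁₂ hH₂).intervalIntegrable ⟨hz.1, hz.2.le⟩ hR).const_mul
    (1 - z)⁻¹
  have hz1 : 1 - z ≠ 0 := by linarith [hz.2]
  simpa [inv_mul_cancel_left₀ hz1] using h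

omit hH₁ hH₁₂ hH₂ in
/-- Only the product of the integrand with `1 - z` has a bound that is uniform up to `z = 1`. -/
theorem Psi₂_eq (z R : ℝ) : Psi₂ H₁ H₂ z R = D₄ H₁ H₂ * z ^ (2 * H₂ - H₁ - 1 / 2) *
    ∫ x in (0 : ℝ)..R, (1 - z) * Psi₂Integrand H₁ H₂ z x := by
  rw [Psi₂, intervalIntegral.integral_const_mul]
  ring

omit hH₁ hH₁₂ hH₂ in
theorem Lambda₂_eq (z R : ℝ) : Lambda₂ H₁ H₂ z R = D₄ H₁ H₂ *
    ∫ x in (0 : ℝ)..R, (1 - z) * Lambda₂Integrand H₁ H₂ z x := by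
  rw [Lambda₂, intervalIntegral.integral_const_mul]
  ring

omit hH₁ hH₁₂ hH₂ in
theorem bddContOn_const_mul_rpow (c : ℝ) {r : ℝ} (hr : 0 ≤ r) :
    BddContOn (fun p : ℝ × ℝ => c * p.1 ^ r) (Ioc 0 1 ×ˢ Ioi 0) := by
  refine ⟨(continuous_const.mul ((Real.continuous_rpow_const hr).comp
    continuous_fst)).continuousOn, |c|, fun p hp => ?_⟩
  rw [abs_mul, abs_of_nonneg (Real.rpow_nonneg hp.1.1.le _)]
  exact mul_le_of_le_one_right (abs_nonneg c) (Real.rpow_le_one hp.1.1.le hp.1.2 hr)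

theorem bddContOn_Psi₁ :
    BddContOn (fun p : ℝ × ℝ => Psi₁ H₁ H₂ p.1 p.2) (Ioc 0 1 ×ˢ Ioi 0) :=
  (dominatedOn_Psi₁ hH₁ hH₁₂ hH₂).bddContOn

theorem bddContOn_Psi₂ :
    BddContOn (fun p : ℝ × ℝ => Psi₂ H₁ H₂ p.1 p.2) (Ioc 0 1 ×ˢ Ioi 0) :=
  ((bddContOn_const_mul_rpow (D₄ H₁ H₂) (by linarith)).mul
    (dominatedOn_Psi₂ hH₁ hH₁₂ hH₂).bddContOn).congr fun _ _ => Psi₂_eq _ _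

theorem bddContOn_Psi₃ :
    BddContOn (fun p : ℝ × ℝ => Psi₃ H₁ H₂ p.1 p.2) (Ioc 0 1 ×ˢ Ioi 0) :=
  (bddContOn_const_mul_rpow (-D₅ H₁ H₂) (by linarith)).mul
    (dominatedOn_Psi₃ hH₁ hH₁₂ hH₂).bddContOn

theorem bddContOn_Lambda₁ :
    BddContOn (fun p : ℝ × ℝ => Lambda₁ H₁ H₂ p.1 p.2) (Ioc 0 1 ×ˢ Ioi 0) :=
  (dominatedOn_Lambda₁ hH₁ hH₁₂ hH₂).bddContOn

theorem bddContOn_Lambda₂ :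
    BddContOn (fun p : ℝ × ℝ => Lambda₂ H₁ H₂ p.1 p.2) (Ioc 0 1 ×ˢ Ioi 0) :=
  ((bddContOn_const_mul_rpow (D₄ H₁ H₂) le_rfl).mul
    (dominatedOn_Lambda₂ hH₁ hH₁₂ hH₂).bddContOn).congr fun _ _ => by
      rw [Lambda₂_eq, Real.rpow_zero, mul_one]

theorem bddContOn_Lambda₃ :
    BddContOn (fun p : ℝ × ℝ => Lambda₃ H₁ H₂ p.1 p.2) (Ioc 0 1 ×ˢ Ioi 0) :=
  ((bddContOn_const_mul_rpow (-D₅ H₁ H₂) le_rfl).mul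
    (dominatedOn_Lambda₃ hH₁ hH₁₂ hH₂).bddContOn).congr fun _ _ => by
      rw [Lambda₃, Real.rpow_zero, mul_one]

end

/-! ### The integrals `Φ` -/

theorem intervalIntegrable_and_bddContOn_unit {g : ℝ → ℝ → ℝ} {b : ℝ → ℝ} {S : Set ℝ}
    (h1 : ∀ z ∈ S, ContinuousOn (g z) (Ioo 0 1))
    (h2 : ∀ y ∈ Ioo (0 : ℝ) 1, ContinuousOn (fun z => g z y) S)
    (hb : IntervalIntegrable b volume 0 1)
    (hbd : ∀ z ∈ S, ∀ y ∈ Ioo (0 : ℝ) 1, |g z y| ≤ b y) :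
    (∀ z ∈ S, IntervalIntegrable (g z) volume 0 1) ∧
      BddContOn (fun z => ∫ y in (0 : ℝ)..1, g z y) S := by
  rw [intervalIntegrable_iff_integrableOn_Ioo_of_le zero_le_one] at hb
  have e : ∀ z, ∫ y in (0 : ℝ)..1, g z y = ∫ y in Ioo (0 : ℝ) 1, g z y := fun z => by
    rw [intervalIntegral.integral_of_le zero_le_one, integral_Ioc_eq_integral_Ioo]
  have hae : ∀ z ∈ S, ∀ᵐ y ∂volume.restrict (Ioo (0 : ℝ) 1), ‖g z y‖ ≤ b y := fun z hz => by
    filter_upwards [ae_restrict_mem measurableSet_Ioo] with y hy using hbd z hz y hy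
  have hm : ∀ z ∈ S, AEStronglyMeasurable (g z) (volume.restrict (Ioo 0 1)) := fun z hz =>
    (h1 z hz).aestronglyMeasurable measurableSet_Ioo
  refine ⟨fun z hz => ?_, fun z₀ hz₀ => ?_, ∫ y in Ioo (0 : ℝ) 1, b y, fun z hz => ?_⟩
  · rw [intervalIntegrable_iff_integrableOn_Ioo_of_le zero_le_one]
    exact Integrable.mono' hb (hm z hz) (hae z hz)
  · simp only [ContinuousWithinAt, e]
    refine tendsto_integral_filter_of_dominated_convergence b ?_ ?_ hb ?_
    · filter_upwards [self_mem_nhdsWithin] with z hz using hm z hz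
    · filter_upwards [self_mem_nhdsWithin] with z hz using hae z hz
    · filter_upwards [ae_restrict_mem measurableSet_Ioo] with y hy using h2 y hy z₀ hz₀
  · dsimp only
    rw [e]
    exact norm_integral_le_of_norm_le hb (hae z hz)

theorem convex_mem {z y : ℝ} (hz : z ∈ Icc (0 : ℝ) 1) (hy : y ∈ Ioo (0 : ℝ) 1) :
    z + (1 - z) * y ∈ Icc (0 : ℝ) 1 :=
  ⟨by nlinarith [hz.1, hz.2, hy.1], by nlinarith [hz.2, hy.2]⟩

theorem abs_sub_convex_le {z y : ℝ} (hz : z ∈ Icc (0 : ℝ) 1) (hy : y ∈ Ioo (0 : ℝ) 1) :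
    |z - (z + (1 - z) * y)| ≤ y := by
  rw [sub_add_cancel_left, abs_neg, abs_of_nonneg (mul_nonneg (by linarith [hz.2]) hy.1.le)]
  exact mul_le_of_le_one_left hy.1.le (by linarith [hz.1])

/-- Bernoulli's inequality in the form `(1 - y) ^ (-β) - 1 ≤ y (1 - y) ^ (-β)`. -/
theorem abs_one_sub_rpow_le {r y : ℝ} (hr : r ∈ Icc (-1 : ℝ) 0) (hy : y ∈ Ioo (0 : ℝ) 1) :
    |1 - (1 - y) ^ r| ≤ y * (1 - y) ^ r := by
  have h1 : 0 < 1 - y := by linarith [hy.2]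
  have h2 : 1 ≤ (1 - y) ^ r :=
    Real.one_le_rpow_of_pos_of_le_one_of_nonpos h1 (by linarith [hy.1]) hr.2
  have h3 : (1 - y) * (1 - y) ^ r ≤ 1 := by
    nth_rewrite 1 [← Real.rpow_one (1 - y)]
    rw [← Real.rpow_add h1]
    exact Real.rpow_le_one h1.le (by linarith [hy.1]) (by linarith [hr.1])
  rw [abs_of_nonpos (by linarith)]
  linarith

/-- The integrals `Φ`, with weight `(1 - y) ^ r`, `-1 < r ≤ 0`; the common bound is a multiple of
`y ^ (σ - γ - 1) (1 - y) ^ r`. -/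
theorem intervalIntegrable_and_bddContOn_weighted {f : ℝ → ℝ} {σ γ r : ℝ} (hγ : 0 < γ)
    (hσ : γ < σ) (hσ1 : σ ≤ 1) (hr : -1 < r) (hr0 : r ≤ 0) (hf : HolderOnUnit σ f) :
    (∀ z ∈ Icc (0 : ℝ) 1, IntervalIntegrable (fun y =>
      (f z - (1 - y) ^ r * f (z + (1 - z) * y)) / y ^ (1 + γ)) volume 0 1) ∧
    BddContOn (fun z => ∫ y in (0 : ℝ)..1,
      (f z - (1 - y) ^ r * f (z + (1 - z) * y)) / y ^ (1 + γ)) (Icc 0 1) := by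
  have hσ0 : 0 < σ := hγ.trans hσ
  obtain ⟨C, hC0, hCb, hC⟩ := hf.exists_const hσ0
  have hfc := hf.continuousOn hσ0
  refine intervalIntegrable_and_bddContOn_unit
    (b := fun y => 2 * C * (y ^ (σ - γ - 1) * (1 - y) ^ (r + 1 - 1))) (fun z hz => ?_)
    (fun y hy => ?_)
    ((intervalIntegrable_beta (sub_pos.2 hσ) (by linarith)).const_mul _) fun z hz y hy => ?_
  · refine ContinuousOn.div (continuousOn_const.sub (ContinuousOn.mul ?_ ?_)) ?_ ?_
    · exact ContinuousOn.rpow_const (by fun_prop) fun y hy => Or.inl (by linarith [hy.2])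
    · exact hfc.comp (by fun_prop) fun y hy => convex_mem hz hy
    · exact continuousOn_id.rpow_const fun y hy => Or.inl hy.1.ne'
    · exact fun y hy => (Real.rpow_pos_of_pos hy.1 _).ne'
  · refine ContinuousOn.div_const (hfc.sub (continuousOn_const.mul ?_)) _
    exact hfc.comp (by fun_prop) fun z hz => convex_mem hz hy
  · have h1y : 0 < 1 - y := by linarith [hy.2]
    have hmem := convex_mem hz hy
    set m := (1 - y) ^ r with hm
    have hm1 : 1 ≤ m := Real.one_le_rpow_of_pos_of_le_one_of_nonpos h1y (by linarith [hy.1]) hr0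
    have h1 : |f z - f (z + (1 - z) * y)| ≤ C * y ^ σ := by
      refine (hC z hz _ hmem).trans (mul_le_mul_of_nonneg_left ?_ hC0)
      exact Real.rpow_le_rpow (abs_nonneg _) (abs_sub_convex_le hz hy) hσ0.le
    have h2 : y ≤ y ^ σ := Real.self_le_rpow_of_le_one hy.1.le hy.2.le hσ1
    have hyσ : 0 ≤ y ^ σ := Real.rpow_nonneg hy.1.le _
    have h3 : |f z - m * f (z + (1 - z) * y)| ≤ 2 * C * (y ^ σ * m) := by
      calc |f z - m * f (z + (1 - z) * y)|
          = |(f z - f (z + (1 - z) * y)) + (1 - m) * f (z + (1 - z) * y)| := by congr 1; ring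
        _ ≤ |f z - f (z + (1 - z) * y)| + |1 - m| * |f (z + (1 - z) * y)| := by
            refine (abs_add_le _ _).trans ?_
            rw [abs_mul]
        _ ≤ C * y ^ σ * m + (y ^ σ * m) * C := by
            refine add_le_add (h1.trans (le_mul_of_one_le_right (by positivity) hm1)) ?_
            refine mul_le_mul ?_ (hCb _ hmem) (abs_nonneg _) (by positivity)
            exact (abs_one_sub_rpow_le ⟨hr.le, hr0⟩ hy).trans (by gcongr)
        _ = 2 * C * (y ^ σ * m) := by ring
    have hpos : 0 < y ^ (1 + γ) := Real.rpow_pos_of_pos hy.1 _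
    rw [abs_div, abs_of_pos hpos, div_le_iff₀ hpos, add_sub_cancel_right]
    refine h3.trans (le_of_eq ?_)
    rw [show σ - γ - 1 = σ - (1 + γ) by ring, Real.rpow_sub hy.1]
    field_simp
    rfl

section

variable {H₁ H₂ : ℝ} (hH₁ : 1 / 2 < H₁) (hH₁₂ : H₁ < H₂) (hH₂ : H₂ < 1)
include hH₁ hH₁₂ hH₂

theorem intervalIntegrable_and_bddContOn_Phi₁ :
    (∀ z ∈ Icc (0 : ℝ) 1, IntervalIntegrable (Phi₁Integrand H₁ H₂ z) volume 0 1) ∧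
      BddContOn (Phi₁ H₁ H₂) (Icc 0 1) := by
  have hα := alpha_mem hH₁ hH₁₂ hH₂
  have h := intervalIntegrable_and_bddContOn_weighted (γ := H₁ - 1 / 2) (r := 0) (by linarith)
    (by rw [alpha]; linarith) hα.2.le (by norm_num) le_rfl (holderOnUnit_F₁ hH₁ hH₁₂ hH₂)
  simp only [Real.rpow_zero, one_mul, show 1 + (H₁ - 1 / 2) = H₁ + 1 / 2 by ring] at h
  exact h

theorem intervalIntegrable_and_bddContOn_Phi₂ :
    (∀ z ∈ Icc (0 : ℝ) 1, IntervalIntegrable (Phi₂Integrand H₁ H₂ z) volume 0 1) ∧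
      BddContOn (Phi₂ H₁ H₂) (Icc 0 1) := by
  have hβ := beta_mem hH₁ hH₁₂ hH₂
  have h := intervalIntegrable_and_bddContOn_weighted (γ := H₁ - 1 / 2)
    (r := 2 * H₂ - H₁ - 3 / 2) (by linarith)
    (by rw [beta]; linarith) hβ.2.le (by linarith) (by linarith)
    ((holderOnUnit_F₂ hH₁ hH₁₂ hH₂).affine_mul hβ.1 hβ.2.le 0 1)
  have e : ∀ z, Phi₂Integrand H₁ H₂ z = fun y => ((0 + 1 * z) * F₂ H₁ H₂ z
      - (1 - y) ^ (2 * H₂ - H₁ - 3 / 2) * ((0 + 1 * (z + (1 - z) * y)) *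
        F₂ H₁ H₂ (z + (1 - z) * y))) / y ^ (1 + (H₁ - 1 / 2)) := by
    intro z
    funext y
    rw [Phi₂Integrand, show 1 + (H₁ - 1 / 2) = H₁ + 1 / 2 by ring]
    congr 1
    ring
  have e' : Phi₂ H₁ H₂ = fun z => ∫ y in (0 : ℝ)..1, Phi₂Integrand H₁ H₂ z y := rfl
  simp only [e', e]
  exact h

end

/-! ### The factorization of the kernel -/

theorem one_sub_div_w {z x : ℝ} (hw : w z x ≠ 0) : 1 - z / w z x = (1 - z) * (1 + x) / w z x := by
  rw [eq_div_iff hw, sub_mul, div_mul_cancel₀ _ hw, w]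
  ring

/-- The integrand of `K₋` after the substitution `t = u + (u - s) x`, for which `t = u w` and
`s / t = z / w`. -/
theorem rhoProfile_difference (H₁ H₂ : ℝ) {z x : ℝ} (hz : z ∈ Ioo (0 : ℝ) 1) (hx : 0 < x) :
    x ^ (-H₁ - 1 / 2) * (rhoProfile H₁ H₂ z
        - (1 + x) ^ (2 * H₂ - H₁ - 3 / 2) * w z x ^ (H₁ - 1 / 2) * rhoProfile H₁ H₂ (z / w z x))
      = Psi₁Integrand H₁ H₂ z x
        + D₄ H₁ H₂ * z ^ (2 * H₂ - H₁ - 1 / 2) * (1 - z) * Psi₂Integrand H₁ H₂ z x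
        - D₅ H₁ H₂ * z ^ (2 * H₂ - H₁ - 1 / 2) * Psi₃Integrand H₁ H₂ z x := by
  have hw : 0 < w z x := by linarith [one_le_w hz.2.le hx.le]
  have hP : 0 < 1 + x := by linarith
  have e1 : (1 + x) ^ (2 * H₂ - H₁ - 1 / 2) = (1 + x) ^ (2 * H₂ - H₁ - 3 / 2) * (1 + x) := by
    rw [show 2 * H₂ - H₁ - 1 / 2 = 2 * H₂ - H₁ - 3 / 2 + 1 by ring, Real.rpow_add hP,
      Real.rpow_one]
  have e2 : w z x ^ (2 * H₁ - 2 * H₂)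
      = w z x ^ (H₁ - 1 / 2) / w z x ^ (2 * H₂ - H₁ - 1 / 2) := by
    rw [← Real.rpow_sub hw]
    congr 1
    ring
  have e3 : w z x ^ (2 * H₁ - 2 * H₂ - 1)
      = w z x ^ (H₁ - 1 / 2) / w z x ^ (2 * H₂ - H₁ - 1 / 2) / w z x := by
    rw [Real.rpow_sub hw, Real.rpow_one, e2]
  have e4 : -1 - (H₁ - 1 / 2) = -H₁ - 1 / 2 := by ring
  rw [rhoProfile, rhoProfile, Psi₁Integrand, Psi₂Integrand, Psi₃Integrand, div_rpow_half hx,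
    div_rpow_half hx, e4, one_sub_div_w hw.ne', Real.div_rpow hz.1.le hw.le, e1, e2, e3]
  ring

/-- The integrand of the last integral in `K₊` after the substitution `t = s + (s - u) x`, for which
`t = s w` and `s / t = 1 / w`. -/
theorem rhoProfile_one_div (H₁ H₂ : ℝ) {z x : ℝ} (hz : z ∈ Ioo (0 : ℝ) 1) (hx : 0 < x) :
    x ^ (2 * H₂ - H₁ - 3 / 2) * (1 + x) ^ (-H₁ - 1 / 2) * w z x ^ (H₁ - 1 / 2)
        * rhoProfile H₁ H₂ (1 / w z x)
      = Lambda₁Integrand H₁ H₂ z x + D₄ H₁ H₂ * (1 - z) * Lambda₂Integrand H₁ H₂ z x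
        - D₅ H₁ H₂ * Lambda₃Integrand H₁ H₂ z x := by
  have hw : 0 < w z x := by linarith [one_le_w hz.2.le hx.le]
  have e1 : x ^ (2 * H₂ - H₁ - 1 / 2) = x ^ (2 * H₂ - H₁ - 3 / 2) * x := by
    rw [show 2 * H₂ - H₁ - 1 / 2 = 2 * H₂ - H₁ - 3 / 2 + 1 by ring, Real.rpow_add hx,
      Real.rpow_one]
  have e2 : w z x ^ (2 * H₁ - 2 * H₂)
      = w z x ^ (H₁ - 1 / 2) / w z x ^ (2 * H₂ - H₁ - 1 / 2) := by
    rw [← Real.rpow_sub hw]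
    congr 1
    ring
  have e3 : w z x ^ (2 * H₁ - 2 * H₂ - 1)
      = w z x ^ (H₁ - 1 / 2) / w z x ^ (2 * H₂ - H₁ - 1 / 2) / w z x := by
    rw [Real.rpow_sub hw, Real.rpow_one, e2]
  have e4 : w z x ^ (H₁ - 3 / 2) = w z x ^ (H₁ - 1 / 2) / w z x := by
    rw [← Real.rpow_sub_one hw.ne']
    congr 1
    ring
  have e5 : 1 - 1 / w z x = (1 - z) * x / w z x := by
    rw [eq_div_iff hw.ne', sub_mul, div_mul_cancel₀ _ hw.ne', w]
    ring
  have e6 : D₃ H₁ H₂ + D₅ H₁ H₂ + D₃ H₁ H₂ * (1 - z) * x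
      = w z x * (D₃ H₁ H₂ + D₅ H₁ H₂ * (1 / w z x)) := by
    field_simp
    rw [w]
    ring
  rw [rhoProfile, Lambda₁Integrand, Lambda₂Integrand, Lambda₃Integrand, e6, e5,
    Real.div_rpow zero_le_one hw.le, Real.one_rpow, e1, e2, e3, e4]
  field_simp

section

variable {H₁ H₂ : ℝ} (hH₁ : 1 / 2 < H₁) (hH₁₂ : H₁ < H₂) (hH₂ : H₂ < 1)
include hH₁ hH₁₂ hH₂

theorem integral_KminusIntegrand {T u s : ℝ} (hs : 0 < s) (hsu : s < u) (huT : u < T) :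
    IntervalIntegrable (KminusIntegrand H₁ H₂ u s) volume u T ∧
      ∫ t in u..T, KminusIntegrand H₁ H₂ u s t
        = u ^ (H₁ - 1 / 2) * (u - s) ^ (2 * H₂ - 2 * H₁ - 1) *
          (Psi₁ H₁ H₂ (s / u) ((T - u) / (u - s)) + Psi₂ H₁ H₂ (s / u) ((T - u) / (u - s))
            + Psi₃ H₁ H₂ (s / u) ((T - u) / (u - s))) := by
  have hu : 0 < u := hs.trans hsu
  have hus : 0 < u - s := sub_pos.2 hsu
  have hz : s / u ∈ Ioo (0 : ℝ) 1 := ⟨div_pos hs hu, (div_lt_one hu).2 hsu⟩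
  have hz' : s / u ∈ Ioc (0 : ℝ) 1 := ⟨hz.1, hz.2.le⟩
  have hR : 0 ≤ (T - u) / (u - s) := div_nonneg (by linarith) hus.le
  have i1 := (dominatedOn_Psi₁ hH₁ hH₁₂ hH₂).intervalIntegrable hz' hR
  have i2 := (intervalIntegrable_Psi₂ hH₁ hH₁₂ hH₂ hz hR).const_mul
    (D₄ H₁ H₂ * (s / u) ^ (2 * H₂ - H₁ - 1 / 2) * (1 - s / u))
  have i3 := ((dominatedOn_Psi₃ hH₁ hH₁₂ hH₂).intervalIntegrable hz' hR).const_mul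
    (D₅ H₁ H₂ * (s / u) ^ (2 * H₂ - H₁ - 1 / 2))
  have h := integral_affine (f := KminusIntegrand H₁ H₂ u s) (a := u) (b := T) hus.ne' hR
    (by field_simp; ring) ?_
    (((i1.add i2).sub i3).const_mul (u ^ (H₁ - 1 / 2) * (u - s) ^ (2 * H₂ - 2 * H₁ - 2)))
  · refine ⟨h.1, ?_⟩
    rw [h.2, intervalIntegral.integral_const_mul]
    rw [intervalIntegral.integral_sub (i1.add i2) i3, intervalIntegral.integral_add i1 i2,
      intervalIntegral.integral_const_mul, intervalIntegral.integral_const_mul, Psi₁, Psi₂, Psi₃,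
      show 2 * H₂ - 2 * H₁ - 1 = 2 * H₂ - 2 * H₁ - 2 + 1 by ring, Real.rpow_add hus,
      Real.rpow_one]
    ring
  · intro x hx
    have hx0 : 0 < x := hx.1
    have hP : 0 < 1 + x := by linarith
    have hw : 0 < w (s / u) x := by linarith [one_le_w hz.2.le hx0.le]
    have ht : u + (u - s) * x = u * w (s / u) x := by
      rw [w]
      field_simp
    have hst : s < u * w (s / u) x := by
      rw [← ht]
      nlinarith
    have e0 : ∀ v : ℝ, 0 < v → v ^ (2 * H₁ - 1) = v ^ (H₁ - 1 / 2) * v ^ (H₁ - 1 / 2) := by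
      intro v hv
      rw [← Real.rpow_add hv]
      congr 1
      ring
    have e1 : (u - s) ^ (2 * H₂ - 2 * H₁ - 2)
        = (u - s) ^ (2 * H₂ - H₁ - 3 / 2) / (u - s) ^ (H₁ + 1 / 2) := by
      rw [← Real.rpow_sub hus]
      congr 1
      ring
    have hkey := rhoProfile_difference H₁ H₂ hz hx0
    rw [← hkey, KminusIntegrand, add_sub_cancel_left, Real.mul_rpow hus.le hx0.le, ht, e0 u hu,
      e0 _ (mul_pos hu hw), mul_assoc, rho_eq hH₁ hH₁₂ hH₂ hs hsu, mul_assoc,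
      rho_eq hH₁ hH₁₂ hH₂ hs hst, Real.mul_rpow hu.le hw.le, ← div_div s u,
      show u * w (s / u) x - s = (u - s) * (1 + x) by rw [← ht]; ring,
      Real.mul_rpow hus.le hP.le, e1, show -H₁ - 1 / 2 = -(H₁ + 1 / 2) by ring,
      Real.rpow_neg hx0.le]
    have := (Real.rpow_pos_of_pos hx0 (H₁ + 1 / 2)).ne'
    have := (Real.rpow_pos_of_pos hus (H₁ + 1 / 2)).ne'
    field_simp

theorem Kminus_eq {T u s : ℝ} (hs : 0 < s) (hsu : s < u) (huT : u < T) :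
    Kminus H₁ H₂ T u s = (u - s) ^ (2 * H₂ - 2 * H₁ - 1) * Lminus H₁ H₂ T u s := by
  have hu : 0 < u := hs.trans hsu
  have hus : 0 < u - s := sub_pos.2 hsu
  have e1 : (u - s) ^ (2 * H₂ - H₁ - 3 / 2)
      = (u - s) ^ (2 * H₂ - 2 * H₁ - 1) * (u - s) ^ (H₁ - 1 / 2) := by
    rw [← Real.rpow_add hus]
    congr 1
    ring
  have e2 : u ^ (1 / 2 - H₁) * u ^ (H₁ - 1 / 2) = 1 := by
    rw [← Real.rpow_add hu, show 1 / 2 - H₁ + (H₁ - 1 / 2) = 0 by ring, Real.rpow_zero]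
  rw [Kminus, (integral_KminusIntegrand hH₁ hH₁₂ hH₂ hs hsu huT).2, mul_right_comm,
    rho_eq hH₁ hH₁₂ hH₂ hs hsu, e1, Lminus, rhoProfile]
  linear_combination ((H₁ - 1 / 2) * (u - s) ^ (2 * H₂ - 2 * H₁ - 1) *
    (Psi₁ H₁ H₂ (s / u) ((T - u) / (u - s)) + Psi₂ H₁ H₂ (s / u) ((T - u) / (u - s))
      + Psi₃ H₁ H₂ (s / u) ((T - u) / (u - s)))) * e2

theorem integral_KplusIntegrand₁ {u s : ℝ} (hu : 0 < u) (hus : u < s) :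
    IntervalIntegrable (KplusIntegrand₁ H₁ H₂ u s) volume u s ∧
      ∫ t in u..s, KplusIntegrand₁ H₁ H₂ u s t
        = s ^ (2 * H₂ - 2) * (s - u) ^ (1 / 2 - H₁) * (D₁ H₁ * Phi₁ H₁ H₂ (u / s)
          + D₂ H₁ H₂ * (1 - u / s) ^ (2 * H₂ - H₁ - 3 / 2) * Phi₂ H₁ H₂ (u / s)) := by
  have hs : 0 < s := hu.trans hus
  have hsu : 0 < s - u := sub_pos.2 hus
  have hz : u / s ∈ Ioo (0 : ℝ) 1 := ⟨div_pos hu hs, (div_lt_one hs).2 hus⟩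
  have hz' : u / s ∈ Icc (0 : ℝ) 1 := ⟨hz.1.le, hz.2.le⟩
  have i1 := ((intervalIntegrable_and_bddContOn_Phi₁ hH₁ hH₁₂ hH₂).1 _ hz').const_mul (D₁ H₁)
  have i2 := ((intervalIntegrable_and_bddContOn_Phi₂ hH₁ hH₁₂ hH₂).1 _ hz').const_mul
    (D₂ H₁ H₂ * (1 - u / s) ^ (2 * H₂ - H₁ - 3 / 2))
  have h := integral_affine (f := KplusIntegrand₁ H₁ H₂ u s) (a := u) (b := s) hsu.ne'
    zero_le_one (by ring) ?_
    ((i1.add i2).const_mul (s ^ (2 * H₂ - 2) * (s - u) ^ (-1 / 2 - H₁)))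
  · refine ⟨h.1, ?_⟩
    rw [h.2, intervalIntegral.integral_const_mul]
    rw [intervalIntegral.integral_add i1 i2,
      intervalIntegral.integral_const_mul, intervalIntegral.integral_const_mul, Phi₁, Phi₂,
      show 1 / 2 - H₁ = -1 / 2 - H₁ + 1 by ring, Real.rpow_add hsu, Real.rpow_one]
    ring
  · intro y hy
    have hy1 : 0 < 1 - y := by linarith [hy.2]
    have hz1 : 0 < 1 - u / s := by linarith [hz.2]
    have ht0 : 0 < u + (s - u) * y := by nlinarith [hy.1]
    have hts : u + (s - u) * y < s := by nlinarith [hy.2]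
    have hzt : (u + (s - u) * y) / s = u / s + (1 - u / s) * y := by
      field_simp
    have e1 : 1 - (u / s + (1 - u / s) * y) = (1 - u / s) * (1 - y) := by ring
    rw [KplusIntegrand₁, psi_eq hH₁ hH₁₂ hH₂ hu hus, psi_eq hH₁ hH₁₂ hH₂ ht0 hts, hzt, e1,
      add_sub_cancel_left, Real.mul_rpow hsu.le hy.1.le, Real.mul_rpow hz1.le hy1.le,
      Phi₁Integrand, Phi₂Integrand, show -1 / 2 - H₁ = -(H₁ + 1 / 2) by ring,
      Real.rpow_neg hsu.le]
    have := (Real.rpow_pos_of_pos hy.1 (H₁ + 1 / 2)).ne'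
    have := (Real.rpow_pos_of_pos hsu (H₁ + 1 / 2)).ne'
    generalize u / s + (1 - u / s) * y = v
    field_simp
    ring

theorem integral_KplusIntegrand₂ {T u s : ℝ} (hu : 0 < u) (hus : u < s) (hsT : s < T) :
    IntervalIntegrable (KplusIntegrand₂ H₁ H₂ u s) volume s T ∧
      ∫ t in s..T, KplusIntegrand₂ H₁ H₂ u s t
        = s ^ (H₁ - 1 / 2) * (s - u) ^ (2 * H₂ - 2 * H₁ - 1) *
          (Lambda₁ H₁ H₂ (u / s) ((T - s) / (s - u)) + Lambda₂ H₁ H₂ (u / s) ((T - s) / (s - u))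
            + Lambda₃ H₁ H₂ (u / s) ((T - s) / (s - u))) := by
  have hs : 0 < s := hu.trans hus
  have hsu : 0 < s - u := sub_pos.2 hus
  have hz : u / s ∈ Ioo (0 : ℝ) 1 := ⟨div_pos hu hs, (div_lt_one hs).2 hus⟩
  have hz' : u / s ∈ Ioc (0 : ℝ) 1 := ⟨hz.1, hz.2.le⟩
  have hR : 0 ≤ (T - s) / (s - u) := div_nonneg (by linarith) hsu.le
  have i1 := (dominatedOn_Lambda₁ hH₁ hH₁₂ hH₂).intervalIntegrable hz' hR
  have i2 := (intervalIntegrable_Lambda₂ hH₁ hH₁₂ hH₂ hz hR).const_mul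
    (D₄ H₁ H₂ * (1 - u / s))
  have i3 := ((dominatedOn_Lambda₃ hH₁ hH₁₂ hH₂).intervalIntegrable hz' hR).const_mul (D₅ H₁ H₂)
  have h := integral_affine (f := KplusIntegrand₂ H₁ H₂ u s) (a := s) (b := T) hsu.ne' hR
    (by field_simp; ring) ?_
    (((i1.add i2).sub i3).const_mul (s ^ (H₁ - 1 / 2) * (s - u) ^ (2 * H₂ - 2 * H₁ - 2)))
  · refine ⟨h.1, ?_⟩
    rw [h.2, intervalIntegral.integral_const_mul]
    rw [intervalIntegral.integral_sub (i1.add i2) i3, intervalIntegral.integral_add i1 i2,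
      intervalIntegral.integral_const_mul, intervalIntegral.integral_const_mul, Lambda₁, Lambda₂,
      Lambda₃, show 2 * H₂ - 2 * H₁ - 1 = 2 * H₂ - 2 * H₁ - 2 + 1 by ring, Real.rpow_add hsu,
      Real.rpow_one]
    ring
  · intro x hx
    have hx0 : 0 < x := hx.1
    have hP : 0 < 1 + x := by linarith
    have hw : 0 < w (u / s) x := by linarith [one_le_w hz.2.le hx0.le]
    have ht : s + (s - u) * x = s * w (u / s) x := by
      rw [w]
      field_simp
    have hst : s < s * w (u / s) x := by
      rw [← ht]
      nlinarith
    have e0 : (s * w (u / s) x) ^ (2 * H₁ - 1)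
        = (s * w (u / s) x) ^ (H₁ - 1 / 2) * (s * w (u / s) x) ^ (H₁ - 1 / 2) := by
      rw [← Real.rpow_add (mul_pos hs hw)]
      congr 1
      ring
    have e1 : (s - u) ^ (2 * H₂ - 2 * H₁ - 2)
        = (s - u) ^ (2 * H₂ - H₁ - 3 / 2) * (s - u) ^ (-H₁ - 1 / 2) := by
      rw [← Real.rpow_add hsu]
      congr 1
      ring
    have e2 : s + (s - u) * x - u = (s - u) * (1 + x) := by ring
    have hkey := rhoProfile_one_div H₁ H₂ hz hx0
    rw [← hkey, KplusIntegrand₂, e2, ht, mul_assoc, e0, mul_assoc, rho_eq hH₁ hH₁₂ hH₂ hs hst,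
      ← ht, add_sub_cancel_left, ht, Real.mul_rpow hsu.le hx0.le, Real.mul_rpow hsu.le hP.le,
      Real.mul_rpow hs.le hw.le, ← div_div, div_self hs.ne', e1,
      show -1 / 2 - H₁ = -H₁ - 1 / 2 by ring]
    ring

theorem Kplus_eq {T u s : ℝ} (hu : 0 < u) (hus : u < s) (hsT : s < T) :
    Kplus H₁ H₂ T u s = (s - u) ^ (2 * H₂ - 2 * H₁ - 1) * Lplus H₁ H₂ T u s := by
  have hs : 0 < s := hu.trans hus
  have hsu : 0 < s - u := sub_pos.2 hus
  have hA := Real.rpow_pos_of_pos hu (H₁ - 1 / 2)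
  have hS := Real.rpow_pos_of_pos hs (H₁ - 1 / 2)
  have hs' := Real.rpow_pos_of_pos hs (2 * H₂ - 2)
  have hq := Real.rpow_pos_of_pos hsu (H₁ - 1 / 2)
  have hv := Real.rpow_pos_of_pos hsu (2 * H₂ - H₁ - 3 / 2)
  have e1 : u ^ (1 / 2 - H₁) = (u ^ (H₁ - 1 / 2))⁻¹ := by
    rw [← Real.rpow_neg hu.le, neg_sub]
  have e2 : (s - u) ^ (1 / 2 - H₁) = ((s - u) ^ (H₁ - 1 / 2))⁻¹ := by
    rw [← Real.rpow_neg hsu.le, neg_sub]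
  have e3 : (s - u) ^ (2 * H₂ - 2 * H₁ - 1)
      = (s - u) ^ (2 * H₂ - H₁ - 3 / 2) * ((s - u) ^ (H₁ - 1 / 2))⁻¹ := by
    rw [← e2, ← Real.rpow_add hsu]
    congr 1
    ring
  have e4 : (s - u) ^ (3 / 2 + H₁ - 2 * H₂) = ((s - u) ^ (2 * H₂ - H₁ - 3 / 2))⁻¹ := by
    rw [← Real.rpow_neg hsu.le]
    congr 1
    ring
  have e5 : (1 - u / s) ^ (2 * H₂ - H₁ - 3 / 2)
      = (s - u) ^ (2 * H₂ - H₁ - 3 / 2) * (s ^ (H₁ - 1 / 2) * (s ^ (2 * H₂ - 2))⁻¹) := by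
    rw [one_sub_div hs.ne', Real.div_rpow hsu.le hs.le, ← Real.rpow_neg hs.le,
      ← Real.rpow_add hs, div_eq_mul_inv, ← Real.rpow_neg hs.le]
    congr 2
    ring
  have e6 : (u / s) ^ (1 / 2 - H₁) = (u ^ (H₁ - 1 / 2))⁻¹ * s ^ (H₁ - 1 / 2) := by
    rw [Real.div_rpow hu.le hs.le, e1, div_eq_mul_inv, ← Real.rpow_neg hs.le, neg_sub]
  have e7 : (u / s) ^ (3 / 2 - H₁) = u / s * ((u ^ (H₁ - 1 / 2))⁻¹ * s ^ (H₁ - 1 / 2)) := by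
    rw [← e6, show 3 / 2 - H₁ = 1 + (1 / 2 - H₁) by ring, Real.rpow_add (div_pos hu hs),
      Real.rpow_one]
  have e8 : u ^ (H₁ - 1 / 2) * psi H₁ H₂ u s
      = (u ^ (H₁ - 1 / 2))⁻¹ * (u ^ (2 * H₁ - 1) * psi H₁ H₂ u s) := by
    rw [← e1, ← mul_assoc, ← Real.rpow_add hu]
    congr 2
    ring
  rw [Kplus, mul_right_comm _ _ (psi H₁ H₂ u s), e8, psi_eq hH₁ hH₁₂ hH₂ hu hus,
    (integral_KplusIntegrand₁ hH₁ hH₁₂ hH₂ hu hus).2,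
    (integral_KplusIntegrand₂ hH₁ hH₁₂ hH₂ hu hus hsT).2, Lplus, e5, e7, e6, e4, e3, e2, e1]
  field_simp
  ring

end

/-! ### The limit constants -/

theorem integrableOn_rpow_mul_one_sub {γ β : ℝ} (hγ : γ ∈ Ioo (0 : ℝ) 1) (hβ : β ∈ Ioo (0 : ℝ) 1) :
    IntegrableOn (fun x : ℝ => x ^ (-1 - γ) * (1 - (1 + x) ^ (-β))) (Ioi 0) := by
  have hb := (beta_prime (sub_pos.2 hγ.2) hγ.1).1
  refine Integrable.mono' hb (ContinuousOn.aestronglyMeasurable ?_ measurableSet_Ioi) ?_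
  · refine (continuousOn_id.rpow_const fun x hx => Or.inl (ne_of_gt hx)).mul
      (continuousOn_const.sub (ContinuousOn.rpow_const (by fun_prop) fun x hx => Or.inl ?_))
    have : (0 : ℝ) < x := hx
    positivity
  · filter_upwards [ae_restrict_mem measurableSet_Ioi] with x hx
    have hx0 : 0 < x := hx
    have hP : 0 < 1 + x := by linarith
    have h := abs_one_sub_weight_le (a := -β) (b := 0) (z := 0) (by linarith [hβ.1])
      (by linarith [hβ.1]) (by linarith [hβ.2]) (by linarith [hβ.2]) ⟨le_rfl, zero_le_one⟩ hx0
    rw [Real.rpow_zero, mul_one] at h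
    rw [Real.norm_eq_abs, abs_mul, abs_of_pos (Real.rpow_pos_of_pos hx0 _)]
    refine (mul_le_mul_of_nonneg_left h (Real.rpow_nonneg hx0.le _)).trans (le_of_eq ?_)
    rw [show -(1 - γ) - γ = -1 by ring, show 1 - γ - 1 = -1 - γ + 1 by ring, Real.rpow_add hx0,
      Real.rpow_one, Real.rpow_neg_one]
    ring

theorem tendsto_rpow_nhdsGT_zero {r : ℝ} (hr : 0 < r) :
    Tendsto (fun x : ℝ => x ^ r) (𝓝[>] 0) (𝓝 0) := by
  have h := ((Real.continuous_rpow_const hr.le).tendsto 0).mono_left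
    (nhdsWithin_le_nhds (s := Ioi 0))
  rwa [Real.zero_rpow hr.ne'] at h

/-- Integration by parts, with boundary terms vanishing at both ends. -/
theorem integral_rpow_mul_one_sub {γ β : ℝ} (hγ : γ ∈ Ioo (0 : ℝ) 1) (hβ : β ∈ Ioo (0 : ℝ) 1) :
    γ * ∫ x in Ioi (0 : ℝ), x ^ (-1 - γ) * (1 - (1 + x) ^ (-β))
      = β * ProbabilityTheory.beta (1 - γ) (β + γ) := by
  have hb := beta_prime (sub_pos.2 hγ.2) (add_pos hβ.1 hγ.1)
  have hγ0 := hγ.1.ne'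
  have hbound : ∀ x : ℝ, 0 < x → 0 ≤ 1 - (1 + x) ^ (-β) ∧ 1 - (1 + x) ^ (-β) ≤ x ∧
      1 - (1 + x) ^ (-β) ≤ 1 := by
    intro x hx
    have h := abs_one_sub_weight_le (a := -β) (b := 0) (z := 0) (by linarith [hβ.1])
      (by linarith [hβ.1]) (by linarith [hβ.2]) (by linarith [hβ.2]) ⟨le_rfl, zero_le_one⟩ hx
    rw [Real.rpow_zero, mul_one] at h
    have h1 : (1 + x) ^ (-β) ≤ 1 :=
      Real.rpow_le_one_of_one_le_of_nonpos (by linarith) (by linarith [hβ.1])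
    have h2 : 0 ≤ (1 + x) ^ (-β) := Real.rpow_nonneg (by linarith) _
    have h3 : x / (1 + x) ≤ x := div_le_self hx.le (by linarith)
    exact ⟨by linarith, ((le_abs_self _).trans h).trans h3, by linarith⟩
  have key := integral_Ioi_mul_deriv_eq_deriv_mul (a := (0 : ℝ)) (a' := (0 : ℝ)) (b' := (0 : ℝ))
    (u := fun x : ℝ => 1 - (1 + x) ^ (-β)) (u' := fun x => β * (1 + x) ^ (-β - 1))
    (v := fun x : ℝ => -(x ^ (-γ) / γ)) (v' := fun x => x ^ (-1 - γ)) ?_ ?_ ?_ ?_ ?_ ?_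
  · have e1 : ∀ x : ℝ, (1 - (1 + x) ^ (-β)) * x ^ (-1 - γ) = x ^ (-1 - γ) * (1 - (1 + x) ^ (-β)) :=
      fun x => mul_comm _ _
    have e2 : ∀ x : ℝ, β * (1 + x) ^ (-β - 1) * -(x ^ (-γ) / γ)
        = -(β / γ) * (x ^ (1 - γ - 1) * (1 + x) ^ (-(1 - γ) - (β + γ))) := by
      intro x
      rw [show 1 - γ - 1 = -γ by ring, show -(1 - γ) - (β + γ) = -β - 1 by ring]
      ring
    simp only [e1, e2] at key
    rw [integral_const_mul, hb.2] at key
    rw [key]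
    field_simp
    ring
  · intro x hx
    have hx0 : (0 : ℝ) < x := hx
    have h3 : HasDerivAt (fun x : ℝ => 1 + x) 1 x := by
      simpa using (hasDerivAt_id x).const_add 1
    refine ((h3.rpow_const (p := -β) (Or.inl (by positivity))).const_sub 1).congr_deriv ?_
    ring
  · intro x hx
    have hx0 : (0 : ℝ) < x := hx
    refine (((Real.hasDerivAt_rpow_const (p := -γ) (Or.inl hx0.ne')).div_const γ).neg).congr_deriv ?_
    rw [show -γ - 1 = -1 - γ by ring]
    field_simp
  · exact (integrableOn_rpow_mul_one_sub hγ hβ).congr_fun (fun x _ => mul_comm _ _)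
      measurableSet_Ioi
  · have h : IntegrableOn (fun x : ℝ => -(β / γ) *
        (x ^ (1 - γ - 1) * (1 + x) ^ (-(1 - γ) - (β + γ)))) (Ioi 0) := hb.1.const_mul _
    refine h.congr_fun (fun x _ => ?_) measurableSet_Ioi
    simp only [Pi.mul_apply]
    rw [show 1 - γ - 1 = -γ by ring, show -(1 - γ) - (β + γ) = -β - 1 by ring]
    ring
  · have h0 := (tendsto_rpow_nhdsGT_zero (sub_pos.2 hγ.2)).div_const γ
    rw [zero_div] at h0
    refine squeeze_zero_norm' ?_ h0
    filter_upwards [self_mem_nhdsWithin] with x hx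
    have hx0 : (0 : ℝ) < x := hx
    obtain ⟨b1, b2, -⟩ := hbound x hx0
    have hxγ := Real.rpow_nonneg hx0.le (-γ)
    rw [Pi.mul_apply, norm_mul, norm_neg, Real.norm_of_nonneg b1,
      Real.norm_of_nonneg (div_nonneg hxγ hγ.1.le), ← mul_div_assoc]
    refine div_le_div_of_nonneg_right ?_ hγ.1.le
    rw [show 1 - γ = 1 + -γ by ring, Real.rpow_add hx0, Real.rpow_one]
    exact mul_le_mul_of_nonneg_right b2 hxγ
  · have h0 := (tendsto_rpow_neg_atTop hγ.1).div_const γ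
    rw [zero_div] at h0
    refine squeeze_zero_norm' ?_ h0
    filter_upwards [eventually_gt_atTop 0] with x hx0
    obtain ⟨b1, -, b2⟩ := hbound x hx0
    have hxγ := div_nonneg (Real.rpow_nonneg hx0.le (-γ)) hγ.1.le
    rw [Pi.mul_apply, norm_mul, norm_neg, Real.norm_of_nonneg b1, Real.norm_of_nonneg hxγ]
    exact mul_le_of_le_one_left hxγ b2

/-- The antiderivative `y ^ (-γ) (1 - (1 - y) ^ (1 - β))` runs from `0` to `1`; plain integration
by parts would leave a divergent boundary term at `1`. -/
theorem integral_one_sub_rpow_div {γ β : ℝ} (hγ : γ ∈ Ioo (0 : ℝ) 1) (hβ : β ∈ Ioo (0 : ℝ) 1) :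
    1 + γ * ∫ y in (0 : ℝ)..1, (1 - (1 - y) ^ (-β)) / y ^ (1 + γ)
      = (1 - β - γ) * ProbabilityTheory.beta (1 - γ) (1 - β) := by
  have hj : IntervalIntegrable (fun y : ℝ => (1 - (1 - y) ^ (-β)) / y ^ (1 + γ)) volume 0 1 := by
    have h := (intervalIntegrable_and_bddContOn_weighted (f := fun _ => (1 : ℝ)) (σ := 1) (γ := γ)
      (r := -β) hγ.1 hγ.2 le_rfl (by linarith [hβ.2]) (by linarith [hβ.1])
      ⟨0, fun x _ y _ => by simp⟩).1 0 ⟨le_rfl, zero_le_one⟩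
    simpa using h
  have hb := intervalIntegrable_beta (sub_pos.2 hγ.2) (sub_pos.2 hβ.2)
  have key := intervalIntegral.integral_eq_sub_of_hasDerivAt_of_tendsto (a := (0 : ℝ)) (b := 1)
    (f := fun y : ℝ => y ^ (-γ) * (1 - (1 - y) ^ (1 - β)))
    (f' := fun y => -γ * ((1 - (1 - y) ^ (-β)) / y ^ (1 + γ))
      + (1 - β - γ) * (y ^ (1 - γ - 1) * (1 - y) ^ (1 - β - 1))) (fa := 0) (fb := 1) zero_lt_one
    (fun y hy => ?_) ((hj.const_mul _).add (hb.const_mul _)) ?_ ?_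
  · rw [intervalIntegral.integral_add (hj.const_mul _) (hb.const_mul _),
      intervalIntegral.integral_const_mul, intervalIntegral.integral_const_mul,
      integral_beta (sub_pos.2 hγ.2) (sub_pos.2 hβ.2)] at key
    linarith
  · have h1 : 0 < 1 - y := by linarith [hy.2]
    have h3 : HasDerivAt (fun y : ℝ => 1 - y) (-1) y := by
      simpa using (hasDerivAt_id y).const_sub 1
    refine ((Real.hasDerivAt_rpow_const (p := -γ) (Or.inl hy.1.ne')).mul
      ((h3.rpow_const (p := 1 - β) (Or.inl h1.ne')).const_sub 1)).congr_deriv ?_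
    have e1 : y ^ (-γ - 1) = (y ^ (1 + γ))⁻¹ := by
      rw [← Real.rpow_neg hy.1.le]
      congr 1
      ring
    have e2 : y ^ (-γ) = (y ^ (1 + γ))⁻¹ * y := by
      rw [← e1, Real.rpow_sub_one hy.1.ne', div_mul_cancel₀ _ hy.1.ne']
    rw [show 1 - γ - 1 = -γ by ring, show 1 - β - 1 = -β by ring,
      show 1 - β = 1 + -β by ring, Real.rpow_add h1, Real.rpow_one, e1, e2]
    ring
  · refine squeeze_zero_norm' ?_ (tendsto_rpow_nhdsGT_zero (sub_pos.2 hγ.2))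
    filter_upwards [Ioo_mem_nhdsGT zero_lt_one] with y hy
    have h1 : 0 < 1 - y := by linarith [hy.2]
    have h2 : (1 - y) ^ (1 - β) ≤ 1 :=
      Real.rpow_le_one h1.le (by linarith [hy.1]) (by linarith [hβ.2])
    have h3 : 1 - y ≤ (1 - y) ^ (1 - β) :=
      Real.self_le_rpow_of_le_one h1.le (by linarith [hy.1]) (by linarith [hβ.1])
    have hyγ := Real.rpow_nonneg hy.1.le (-γ)
    rw [Real.norm_of_nonneg (mul_nonneg hyγ (by linarith)), show 1 - γ = -γ + 1 by ring,
      Real.rpow_add hy.1, Real.rpow_one]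
    exact mul_le_mul_of_nonneg_left (by linarith) hyγ
  · have h : ContinuousAt (fun y : ℝ => y ^ (-γ) * (1 - (1 - y) ^ (1 - β))) 1 := by
      refine (continuousAt_id.rpow_const (Or.inl one_ne_zero)).mul (continuousAt_const.sub ?_)
      exact ContinuousAt.rpow_const (by fun_prop) (Or.inr (by linarith [hβ.2]))
    have h2 := h.tendsto.mono_left (nhdsWithin_le_nhds (s := Iio 1))
    rwa [sub_self, Real.zero_rpow (by linarith [hβ.2]), Real.one_rpow, sub_zero, one_mul] at h2

theorem mul_beta_eq {p q r : ℝ} (hr : r ≠ 0) (h : p + q = r + 1) :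
    r * ProbabilityTheory.beta p q = Real.Gamma p * Real.Gamma q / Real.Gamma r := by
  rw [ProbabilityTheory.beta, h, Real.Gamma_add_one hr]
  field_simp

/-- By the reflection formula this reduces to `sin² (π β) - sin² (π γ) = sin (π δ) sin (π (β + γ))`
with `β = δ + γ`. -/
theorem beta_identity {γ δ : ℝ} (hγ : 0 < γ) (hδ : 0 < δ) (h : δ + 2 * γ < 1) :
    ((1 - δ - γ) * ProbabilityTheory.beta (1 - γ) (1 - δ)
        - γ * ProbabilityTheory.beta (1 - δ) (δ + γ)) *
      ((δ + γ) * ProbabilityTheory.beta (1 - γ) (δ + 2 * γ)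
        + γ * ProbabilityTheory.beta (1 - δ - γ) (δ + 2 * γ))
    = (δ * ProbabilityTheory.beta (1 - γ) (δ + γ)) *
      ((1 - δ - 2 * γ) * ProbabilityTheory.beta (1 - γ) (1 - δ - γ)) := by
  rw [mul_beta_eq (by linarith) (by ring), mul_beta_eq hγ.ne' (by ring),
    mul_beta_eq (by linarith) (by ring), mul_beta_eq hγ.ne' (by ring),
    mul_beta_eq hδ.ne' (by ring), mul_beta_eq (by linarith) (by ring)]
  have hsin : ∀ x : ℝ, 0 < x → x < 1 → 0 < Real.sin (Real.pi * x) := fun x h0 h1 =>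
    Real.sin_pos_of_pos_of_lt_pi (by positivity) (by nlinarith [Real.pi_pos])
  have r1 := Real.Gamma_mul_Gamma_one_sub γ
  have r2 := Real.Gamma_mul_Gamma_one_sub (δ + γ)
  have r3 := Real.Gamma_mul_Gamma_one_sub δ
  have r4 := Real.Gamma_mul_Gamma_one_sub (δ + 2 * γ)
  rw [show 1 - (δ + γ) = 1 - δ - γ by ring] at r2
  rw [show 1 - (δ + 2 * γ) = 1 - δ - 2 * γ by ring] at r4
  have s1 := hsin γ hγ (by linarith)
  have s2 := hsin (δ + γ) (by linarith) (by linarith)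
  have s3 := hsin δ hδ (by linarith)
  have s4 := hsin (δ + 2 * γ) (by linarith) h
  have hs : Real.sin (Real.pi * (δ + γ)) ^ 2 - Real.sin (Real.pi * γ) ^ 2
      = Real.sin (Real.pi * δ) * Real.sin (Real.pi * (δ + 2 * γ)) := by
    rw [show Real.pi * δ = Real.pi * (δ + γ) - Real.pi * γ by ring,
      show Real.pi * (δ + 2 * γ) = Real.pi * (δ + γ) + Real.pi * γ by ring,
      Real.sin_sub, Real.sin_add]
    linear_combination Real.sin (Real.pi * γ) ^ 2 * Real.sin_sq_add_cos_sq (Real.pi * (δ + γ))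
      - Real.sin (Real.pi * (δ + γ)) ^ 2 * Real.sin_sq_add_cos_sq (Real.pi * γ)
  have g1 := Real.Gamma_pos_of_pos hγ
  have g2 := Real.Gamma_pos_of_pos (show 0 < δ + γ by linarith)
  have g3 := Real.Gamma_pos_of_pos hδ
  have g4 := Real.Gamma_pos_of_pos (show 0 < δ + 2 * γ by linarith)
  have hpi := Real.pi_pos
  replace r1 := eq_div_of_mul_eq g1.ne' ((mul_comm _ _).trans r1)
  replace r2 := eq_div_of_mul_eq g2.ne' ((mul_comm _ _).trans r2)
  replace r3 := eq_div_of_mul_eq g3.ne' ((mul_comm _ _).trans r3)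
  replace r4 := eq_div_of_mul_eq g4.ne' ((mul_comm _ _).trans r4)
  rw [r1, r2, r3, r4]
  generalize Real.sin (Real.pi * γ) = x1 at *
  generalize Real.sin (Real.pi * (δ + γ)) = x2 at *
  generalize Real.sin (Real.pi * δ) = x3 at *
  generalize Real.sin (Real.pi * (δ + 2 * γ)) = x4 at *
  generalize Real.Gamma γ = y1 at *
  generalize Real.Gamma (δ + γ) = y2 at *
  generalize Real.Gamma δ = y3 at *
  generalize Real.Gamma (δ + 2 * γ) = y4 at *
  field_simp
  linear_combination hs

/-! ### The limit on the diagonal -/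

theorem w_one (x : ℝ) : w 1 x = 1 := by simp [w]

theorem F₃_one (H₁ H₂ : ℝ) : F₃ H₁ H₂ 1 = 1 := by
  rw [F₃, sub_self, ordinaryHypergeometric_zero]

section

variable {H₁ H₂ : ℝ} (hH₁ : 1 / 2 < H₁) (hH₁₂ : H₁ < H₂) (hH₂ : H₂ < 1)
include hH₁ hH₁₂ hH₂

theorem F₂_one : D₂ H₁ H₂ * F₂ H₁ H₂ 1
    = (2 - 2 * H₂) * ProbabilityTheory.beta (3 / 2 - H₁) (3 / 2 - 2 * H₂ + H₁) := by
  rw [F₂_eq hH₁ hH₁₂ hH₂ ⟨zero_le_one, le_rfl⟩, eulerIntegral_one (by linarith) (by linarith)]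
  congr 2
  ring

theorem F₅_one : D₅ H₁ H₂ * F₅ H₁ H₂ 1
    = (H₁ - 1 / 2) * ProbabilityTheory.beta (2 * H₂ - 1) (3 / 2 - 2 * H₂ + H₁) := by
  rw [F₅_eq hH₁ hH₁₂ hH₂ ⟨zero_le_one, le_rfl⟩, eulerIntegral_one (by linarith) (by linarith)]
  congr 2
  ring

/-- At `z = 1` the integrals `Ψ₁` and `Ψ₃` are multiples of one integral, while `Ψ₂`
vanishes with its factor `1 - z`. -/
theorem tendsto_Psi {ι : Type*} {l : Filter ι} [l.IsCountablyGenerated] {z R : ι → ℝ}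
    (hz : Tendsto z l (𝓝[Ioc 0 1] 1)) (hR : Tendsto R l atTop) :
    Tendsto (fun i => (H₁ - 1 / 2) * (Psi₁ H₁ H₂ (z i) (R i) + Psi₂ H₁ H₂ (z i) (R i)
      + Psi₃ H₁ H₂ (z i) (R i))) l
      (𝓝 ((D₃ H₁ H₂ + D₅ H₁ H₂ - D₅ H₁ H₂ * F₅ H₁ H₂ 1) * ((3 / 2 - 2 * H₂ + H₁) *
        ProbabilityTheory.beta (3 / 2 - H₁) (1 + 2 * H₁ - 2 * H₂)))) := by
  have h1 : (1 : ℝ) ∈ Ioc (0 : ℝ) 1 := ⟨zero_lt_one, le_rfl⟩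
  have hz' : Tendsto z l (𝓝 1) := hz.mono_right nhdsWithin_le_nhds
  have hzα : Tendsto (fun i => z i ^ (2 * H₂ - H₁ - 1 / 2)) l (𝓝 1) := by
    simpa using hz'.rpow_const (p := 2 * H₂ - H₁ - 1 / 2) (Or.inl one_ne_zero)
  have t1 := (dominatedOn_Psi₁ hH₁ hH₁₂ hH₂).tendsto_atTop h1 hz hR
  have t2 := (hzα.const_mul (D₄ H₁ H₂)).mul
    ((dominatedOn_Psi₂ hH₁ hH₁₂ hH₂).tendsto_atTop h1 hz hR)
  have t3 := (hzα.const_mul (-D₅ H₁ H₂)).mul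
    ((dominatedOn_Psi₃ hH₁ hH₁₂ hH₂).tendsto_atTop h1 hz hR)
  have key := ((t1.add t2).add t3).const_mul (H₁ - 1 / 2)
  have hI := integral_rpow_mul_one_sub (γ := H₁ - 1 / 2) (β := 3 / 2 - 2 * H₂ + H₁)
    ⟨by linarith, by linarith⟩ ⟨by linarith, by linarith⟩
  rw [show 1 - (H₁ - 1 / 2) = 3 / 2 - H₁ by ring,
    show 3 / 2 - 2 * H₂ + H₁ + (H₁ - 1 / 2) = 1 + 2 * H₁ - 2 * H₂ by ring] at hI
  have e1 : ∫ x in Ioi (0 : ℝ), Psi₁Integrand H₁ H₂ 1 x = (D₃ H₁ H₂ + D₅ H₁ H₂) *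
      ∫ x in Ioi (0 : ℝ), x ^ (-1 - (H₁ - 1 / 2)) * (1 - (1 + x) ^ (-(3 / 2 - 2 * H₂ + H₁))) := by
    rw [← integral_const_mul]
    refine setIntegral_congr_fun measurableSet_Ioi fun x _ => ?_
    rw [Psi₁Integrand, w_one, F₃_one, div_one, F₃_one, Real.one_rpow,
      show -(3 / 2 - 2 * H₂ + H₁) = 2 * H₂ - H₁ - 3 / 2 by ring,
      show -1 - (H₁ - 1 / 2) = -H₁ - 1 / 2 by ring]
    ring
  have e3 : ∫ x in Ioi (0 : ℝ), Psi₃Integrand H₁ H₂ 1 x = F₅ H₁ H₂ 1 *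
      ∫ x in Ioi (0 : ℝ), x ^ (-1 - (H₁ - 1 / 2)) * (1 - (1 + x) ^ (-(3 / 2 - 2 * H₂ + H₁))) := by
    rw [← integral_const_mul]
    refine setIntegral_congr_fun measurableSet_Ioi fun x hx => ?_
    rw [Psi₃Integrand, div_rpow_half hx, w_one, div_one, Real.one_rpow,
      show -(3 / 2 - 2 * H₂ + H₁) = 2 * H₂ - H₁ - 3 / 2 by ring]
    ring
  have e : (H₁ - 1 / 2) * ((∫ x in Ioi (0 : ℝ), Psi₁Integrand H₁ H₂ 1 x)
      + D₄ H₁ H₂ * 1 * (∫ x in Ioi (0 : ℝ), (1 - 1) * Psi₂Integrand H₁ H₂ 1 x)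
      + -D₅ H₁ H₂ * 1 * ∫ x in Ioi (0 : ℝ), Psi₃Integrand H₁ H₂ 1 x)
      = (D₃ H₁ H₂ + D₅ H₁ H₂ - D₅ H₁ H₂ * F₅ H₁ H₂ 1) * ((3 / 2 - 2 * H₂ + H₁) *
        ProbabilityTheory.beta (3 / 2 - H₁) (1 + 2 * H₁ - 2 * H₂)) := by
    rw [e1, e3, ← hI]
    simp only [sub_self, zero_mul, integral_zero]
    ring
  rw [e] at key
  refine key.congr fun i => ?_
  rw [Psi₁, Psi₂_eq, Psi₃]

theorem tendsto_Lambda {ι : Type*} {l : Filter ι} [l.IsCountablyGenerated] {z R : ι → ℝ}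
    (hz : Tendsto z l (𝓝[Ioc 0 1] 1)) (hR : Tendsto R l atTop) :
    Tendsto (fun i => Lambda₁ H₁ H₂ (z i) (R i) + Lambda₂ H₁ H₂ (z i) (R i)
      + Lambda₃ H₁ H₂ (z i) (R i)) l
      (𝓝 ((D₃ H₁ H₂ + D₅ H₁ H₂ - D₅ H₁ H₂ * F₅ H₁ H₂ 1) *
        ProbabilityTheory.beta (2 * H₂ - H₁ - 1 / 2) (1 + 2 * H₁ - 2 * H₂))) := by
  have h1 : (1 : ℝ) ∈ Ioc (0 : ℝ) 1 := ⟨zero_lt_one, le_rfl⟩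
  have t1 := (dominatedOn_Lambda₁ hH₁ hH₁₂ hH₂).tendsto_atTop h1 hz hR
  have t2 := ((dominatedOn_Lambda₂ hH₁ hH₁₂ hH₂).tendsto_atTop h1 hz hR).const_mul (D₄ H₁ H₂)
  have t3 := ((dominatedOn_Lambda₃ hH₁ hH₁₂ hH₂).tendsto_atTop h1 hz hR).const_mul (-D₅ H₁ H₂)
  have key := (t1.add t2).add t3
  have hI := (beta_prime (p := 2 * H₂ - H₁ - 1 / 2) (q := 1 + 2 * H₁ - 2 * H₂)
    (by linarith) (by linarith)).2
  rw [show 2 * H₂ - H₁ - 1 / 2 - 1 = 2 * H₂ - H₁ - 3 / 2 by ring,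
    show -(2 * H₂ - H₁ - 1 / 2) - (1 + 2 * H₁ - 2 * H₂) = -H₁ - 1 / 2 by ring] at hI
  have e1 : ∫ x in Ioi (0 : ℝ), Lambda₁Integrand H₁ H₂ 1 x = (D₃ H₁ H₂ + D₅ H₁ H₂) *
      ∫ x in Ioi (0 : ℝ), x ^ (2 * H₂ - H₁ - 3 / 2) * (1 + x) ^ (-H₁ - 1 / 2) := by
    rw [← integral_const_mul]
    refine setIntegral_congr_fun measurableSet_Ioi fun x _ => ?_
    rw [Lambda₁Integrand, w_one, div_one, F₃_one, Real.one_rpow]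
    ring
  have e3 : ∫ x in Ioi (0 : ℝ), Lambda₃Integrand H₁ H₂ 1 x = F₅ H₁ H₂ 1 *
      ∫ x in Ioi (0 : ℝ), x ^ (2 * H₂ - H₁ - 3 / 2) * (1 + x) ^ (-H₁ - 1 / 2) := by
    rw [← integral_const_mul]
    refine setIntegral_congr_fun measurableSet_Ioi fun x _ => ?_
    rw [Lambda₃Integrand, w_one, div_one, Real.one_rpow]
    ring
  rw [e1, e3, hI] at key
  simp only [sub_self, zero_mul, integral_zero, mul_zero, add_zero] at key
  rw [show (D₃ H₁ H₂ + D₅ H₁ H₂ - D₅ H₁ H₂ * F₅ H₁ H₂ 1) *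
      ProbabilityTheory.beta (2 * H₂ - H₁ - 1 / 2) (1 + 2 * H₁ - 2 * H₂)
      = (D₃ H₁ H₂ + D₅ H₁ H₂) *
        ProbabilityTheory.beta (2 * H₂ - H₁ - 1 / 2) (1 + 2 * H₁ - 2 * H₂)
      + -D₅ H₁ H₂ * (F₅ H₁ H₂ 1 *
        ProbabilityTheory.beta (2 * H₂ - H₁ - 1 / 2) (1 + 2 * H₁ - 2 * H₂)) by ring]
  refine key.congr fun i => ?_
  rw [Lambda₁, Lambda₂_eq, Lambda₃]

/-- At `z = 1` the argument `z + (1 - z) y` no longer depends on `y`, so `Φ₂(1)` is `F₂(1)` times an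
elementary integral. -/
theorem Phi₂_one : D₂ H₁ H₂ * F₂ H₁ H₂ 1 + (H₁ - 1 / 2) * (D₂ H₁ H₂ * Phi₂ H₁ H₂ 1)
    = D₂ H₁ H₂ * F₂ H₁ H₂ 1 * ((2 * H₂ - 2 * H₁) *
      ProbabilityTheory.beta (3 / 2 - H₁) (2 * H₂ - H₁ - 1 / 2)) := by
  have hJ := integral_one_sub_rpow_div (γ := H₁ - 1 / 2) (β := 3 / 2 - 2 * H₂ + H₁)
    ⟨by linarith, by linarith⟩ ⟨by linarith, by linarith⟩
  rw [show 1 - (H₁ - 1 / 2) = 3 / 2 - H₁ by ring,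
    show 1 - (3 / 2 - 2 * H₂ + H₁) = 2 * H₂ - H₁ - 1 / 2 by ring,
    show 2 * H₂ - H₁ - 1 / 2 - (H₁ - 1 / 2) = 2 * H₂ - 2 * H₁ by ring] at hJ
  rw [← hJ]
  have e : Phi₂ H₁ H₂ 1 = F₂ H₁ H₂ 1 * ∫ y in (0 : ℝ)..1,
      (1 - (1 - y) ^ (-(3 / 2 - 2 * H₂ + H₁))) / y ^ (1 + (H₁ - 1 / 2)) := by
    rw [Phi₂, ← intervalIntegral.integral_const_mul]
    congr 1
    funext y
    rw [Phi₂Integrand, sub_self, zero_mul, add_zero,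
      show -(3 / 2 - 2 * H₂ + H₁) = 2 * H₂ - H₁ - 3 / 2 by ring,
      show 1 + (H₁ - 1 / 2) = H₁ + 1 / 2 by ring]
    ring
  rw [e]
  ring

/-- The one-sided limits of `L` on the diagonal coincide. -/
theorem limit_eq :
    D₂ H₁ H₂ * F₂ H₁ H₂ 1 + (H₁ - 1 / 2) * (D₂ H₁ H₂ * Phi₂ H₁ H₂ 1)
      - (H₁ - 1 / 2) * ((D₃ H₁ H₂ + D₅ H₁ H₂ - D₅ H₁ H₂ * F₅ H₁ H₂ 1) *
        ProbabilityTheory.beta (2 * H₂ - H₁ - 1 / 2) (1 + 2 * H₁ - 2 * H₂))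
    = (D₃ H₁ H₂ + D₅ H₁ H₂ - D₅ H₁ H₂ * F₅ H₁ H₂ 1) * ((3 / 2 - 2 * H₂ + H₁) *
        ProbabilityTheory.beta (3 / 2 - H₁) (1 + 2 * H₁ - 2 * H₂)) := by
  have h := beta_identity (γ := H₁ - 1 / 2) (δ := 2 - 2 * H₂) (by linarith) (by linarith)
    (by linarith)
  rw [show 1 - (2 - 2 * H₂) - (H₁ - 1 / 2) = 2 * H₂ - H₁ - 1 / 2 by ring,
    show 1 - (H₁ - 1 / 2) = 3 / 2 - H₁ by ring, show 1 - (2 - 2 * H₂) = 2 * H₂ - 1 by ring,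
    show 2 - 2 * H₂ + (H₁ - 1 / 2) = 3 / 2 - 2 * H₂ + H₁ by ring,
    show 2 - 2 * H₂ + 2 * (H₁ - 1 / 2) = 1 + 2 * H₁ - 2 * H₂ by ring,
    show 2 * H₂ - 1 - 2 * (H₁ - 1 / 2) = 2 * H₂ - 2 * H₁ by ring] at h
  rw [Phi₂_one hH₁ hH₁₂ hH₂, F₂_one hH₁ hH₁₂ hH₂, F₅_one hH₁ hH₁₂ hH₂, D₃, D₅]
  linear_combination -h

omit hH₁ hH₁₂ hH₂ in
theorem tendsto_div_sub_atTop {T t : ℝ} (ht : t < T) {l : Filter (ℝ × ℝ)} {a b : ℝ × ℝ → ℝ}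
    (ha : Tendsto a l (𝓝 t)) (hb : Tendsto b l (𝓝 t)) (hab : ∀ᶠ p in l, b p < a p) :
    Tendsto (fun p => (T - a p) / (a p - b p)) l atTop := by
  have h0 : Tendsto (fun p => a p - b p) l (𝓝[>] 0) := by
    refine tendsto_nhdsWithin_iff.2 ⟨by simpa using ha.sub hb, ?_⟩
    filter_upwards [hab] with p hp
    exact sub_pos.2 hp
  exact (ha.const_sub T).pos_mul_atTop (sub_pos.2 ht) h0.inv_tendsto_nhdsGT_zero

omit hH₁ hH₁₂ hH₂ in
theorem tendsto_div_nhdsWithin {t : ℝ} (ht : 0 < t) {l : Filter (ℝ × ℝ)} {a b : ℝ × ℝ → ℝ}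
    (ha : Tendsto a l (𝓝 t)) (hb : Tendsto b l (𝓝 t)) (hab : ∀ᶠ p in l, 0 < b p ∧ b p < a p) :
    Tendsto (fun p => b p / a p) l (𝓝[Ioc 0 1] 1) := by
  refine tendsto_nhdsWithin_iff.2 ⟨div_self ht.ne' ▸ hb.div ha ht.ne', ?_⟩
  filter_upwards [hab] with p hp
  have h : 0 < a p := hp.1.trans hp.2
  exact ⟨div_pos hp.1 h, (div_le_one h).2 hp.2.le⟩

omit hH₁ hH₁₂ hH₂ in
theorem tendsto_sub_rpow {r t : ℝ} (hr : 0 < r) {l : Filter (ℝ × ℝ)} {a b : ℝ × ℝ → ℝ}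
    (ha : Tendsto a l (𝓝 t)) (hb : Tendsto b l (𝓝 t)) :
    Tendsto (fun p => (a p - b p) ^ r) l (𝓝 0) := by
  have h := (ha.sub hb).rpow_const (p := r) (Or.inr hr.le)
  rwa [sub_self, Real.zero_rpow hr.ne'] at h

omit hH₁ hH₁₂ hH₂ in
theorem tendsto_comp_unit {f : ℝ → ℝ} (hf : ContinuousOn f (Icc 0 1)) {ι : Type*} {l : Filter ι}
    {z : ι → ℝ} (hz : Tendsto z l (𝓝[Ioc 0 1] 1)) : Tendsto (fun i => f (z i)) l (𝓝 (f 1)) :=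
  (hf 1 ⟨zero_le_one, le_rfl⟩).tendsto.comp
    (hz.mono_right (nhdsWithin_mono _ fun _ hx => ⟨hx.1.le, hx.2⟩))

theorem continuousOn_rhoProfile : ContinuousOn (rhoProfile H₁ H₂) (Icc 0 1) := by
  have hα := alpha_mem hH₁ hH₁₂ hH₂
  have hβ := beta_mem hH₁ hH₁₂ hH₂
  have h3 := (holderOnUnit_F₃ hH₁ hH₁₂ hH₂).continuousOn hα.1
  have h4 := (holderOnUnit_F₄ hH₁ hH₁₂ hH₂).continuousOn hβ.1
  have h5 := (holderOnUnit_F₅ hH₁ hH₁₂ hH₂).continuousOn hβ.1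
  have hz : ContinuousOn (fun z : ℝ => z ^ (2 * H₂ - H₁ - 1 / 2)) (Icc 0 1) :=
    (Real.continuous_rpow_const (by linarith)).continuousOn
  unfold rhoProfile
  fun_prop

/-- The bracket in `L₋` stays bounded and its prefactor `(u - s) ^ (H₁ - 1/2)` tends to `0`, so only
the integrals `Ψ` contribute. -/
theorem tendsto_Lminus {T t : ℝ} (ht : t ∈ Ioo 0 T) :
    Tendsto (fun p : ℝ × ℝ => Lminus H₁ H₂ T p.1 p.2)
      (𝓝[{p : ℝ × ℝ | 0 < p.2 ∧ p.2 < p.1 ∧ p.1 < T}] (t, t))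
      (𝓝 ((D₃ H₁ H₂ + D₅ H₁ H₂ - D₅ H₁ H₂ * F₅ H₁ H₂ 1) * ((3 / 2 - 2 * H₂ + H₁) *
        ProbabilityTheory.beta (3 / 2 - H₁) (1 + 2 * H₁ - 2 * H₂)))) := by
  set l := 𝓝[{p : ℝ × ℝ | 0 < p.2 ∧ p.2 < p.1 ∧ p.1 < T}] (t, t) with hl
  have h1 : Tendsto (Prod.fst : ℝ × ℝ → ℝ) l (𝓝 t) :=
    (continuous_fst.tendsto (t, t)).mono_left nhdsWithin_le_nhds
  have h2 : Tendsto (Prod.snd : ℝ × ℝ → ℝ) l (𝓝 t) :=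
    (continuous_snd.tendsto (t, t)).mono_left nhdsWithin_le_nhds
  have hmem : ∀ᶠ p in l, 0 < p.2 ∧ p.2 < p.1 ∧ p.1 < T := self_mem_nhdsWithin
  have hz := tendsto_div_nhdsWithin ht.1 h1 h2 (hmem.mono fun p hp => ⟨hp.1, hp.2.1⟩)
  have hR := tendsto_div_sub_atTop ht.2 h1 h2 (hmem.mono fun p hp => hp.2.1)
  have hP := tendsto_Psi hH₁ hH₁₂ hH₂ hz hR
  have hG := tendsto_comp_unit (continuousOn_rhoProfile hH₁ hH₁₂ hH₂) hz
  have hT := (h1.const_sub T).rpow_const (p := 1 / 2 - H₁) (Or.inl (by linarith [ht.2]))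
  have hd := tendsto_sub_rpow (r := H₁ - 1 / 2) (by linarith) h1 h2
  have key := ((hT.mul hd).mul hG).add hP
  rw [mul_zero, zero_mul, zero_add] at key
  exact key

/-- The term with `F₁` and `Φ₁` carries the factor `(s - u) ^ β`, hence does not contribute to the
limit. -/
theorem tendsto_Lplus {T t : ℝ} (ht : t ∈ Ioo 0 T) :
    Tendsto (fun p : ℝ × ℝ => Lplus H₁ H₂ T p.1 p.2)
      (𝓝[{p : ℝ × ℝ | 0 < p.1 ∧ p.1 < p.2 ∧ p.2 < T}] (t, t))
      (𝓝 ((D₃ H₁ H₂ + D₅ H₁ H₂ - D₅ H₁ H₂ * F₅ H₁ H₂ 1) * ((3 / 2 - 2 * H₂ + H₁) *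
        ProbabilityTheory.beta (3 / 2 - H₁) (1 + 2 * H₁ - 2 * H₂)))) := by
  set l := 𝓝[{p : ℝ × ℝ | 0 < p.1 ∧ p.1 < p.2 ∧ p.2 < T}] (t, t) with hl
  have h1 : Tendsto (Prod.fst : ℝ × ℝ → ℝ) l (𝓝 t) :=
    (continuous_fst.tendsto (t, t)).mono_left nhdsWithin_le_nhds
  have h2 : Tendsto (Prod.snd : ℝ × ℝ → ℝ) l (𝓝 t) :=
    (continuous_snd.tendsto (t, t)).mono_left nhdsWithin_le_nhds
  have hmem : ∀ᶠ p in l, 0 < p.1 ∧ p.1 < p.2 ∧ p.2 < T := self_mem_nhdsWithin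
  have hz := tendsto_div_nhdsWithin ht.1 h2 h1 (hmem.mono fun p hp => ⟨hp.1, hp.2.1⟩)
  have hR := tendsto_div_sub_atTop ht.2 h2 h1 (hmem.mono fun p hp => hp.2.1)
  have hz' : Tendsto (fun p : ℝ × ℝ => p.1 / p.2) l (𝓝 1) := hz.mono_right nhdsWithin_le_nhds
  have hzr : ∀ r : ℝ, Tendsto (fun p : ℝ × ℝ => (p.1 / p.2) ^ r) l (𝓝 1) := fun r => by
    simpa using hz'.rpow_const (p := r) (Or.inl one_ne_zero)
  have hΛ := tendsto_Lambda hH₁ hH₁₂ hH₂ hz hR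
  have hF₁ := tendsto_comp_unit ((holderOnUnit_F₁ hH₁ hH₁₂ hH₂).continuousOn
    (alpha_mem hH₁ hH₁₂ hH₂).1) hz
  have hF₂ := tendsto_comp_unit ((holderOnUnit_F₂ hH₁ hH₁₂ hH₂).continuousOn
    (beta_mem hH₁ hH₁₂ hH₂).1) hz
  have hΦ₁ := tendsto_comp_unit (intervalIntegrable_and_bddContOn_Phi₁ hH₁ hH₁₂ hH₂).2.1 hz
  have hΦ₂ := tendsto_comp_unit (intervalIntegrable_and_bddContOn_Phi₂ hH₁ hH₁₂ hH₂).2.1 hz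
  have hd := tendsto_sub_rpow (r := 3 / 2 + H₁ - 2 * H₂) (by linarith) h2 h1
  have hu := (h1.rpow_const (p := 1 / 2 - H₁) (Or.inl ht.1.ne')).const_mul (D₁ H₁)
  have hs := h2.rpow_const (p := 2 * H₂ - 2) (Or.inl ht.1.ne')
  have key := (((((hu.mul hs).mul hd).mul (hF₁.add (hΦ₁.const_mul (H₁ - 1 / 2)))).add
    (((hzr (3 / 2 - H₁)).const_mul (D₂ H₁ H₂)).mul hF₂)).add
    (((hzr (1 / 2 - H₁)).const_mul ((H₁ - 1 / 2) * D₂ H₁ H₂)).mul hΦ₂)).sub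
    (((hzr (1 / 2 - H₁)).const_mul (H₁ - 1 / 2)).mul hΛ)
  rw [← limit_eq hH₁ hH₁₂ hH₂]
  simp only [mul_zero, zero_mul, zero_add, mul_one] at key
  rw [← mul_assoc (H₁ - 1 / 2) (D₂ H₁ H₂)]
  exact key

/-! ### Continuity of `L` -/

theorem continuousOn_Lminus (T : ℝ) : ContinuousOn (fun p : ℝ × ℝ => Lminus H₁ H₂ T p.1 p.2)
    {p : ℝ × ℝ | 0 < p.2 ∧ p.2 < p.1 ∧ p.1 < T} := by
  set S := {p : ℝ × ℝ | 0 < p.2 ∧ p.2 < p.1 ∧ p.1 < T} with hS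
  have hz : ContinuousOn (fun p : ℝ × ℝ => p.2 / p.1) S :=
    continuousOn_snd.div continuousOn_fst fun p hp => (hp.1.trans hp.2.1).ne'
  have hzm : ∀ p ∈ S, p.2 / p.1 ∈ Ioc (0 : ℝ) 1 := fun p hp =>
    ⟨div_pos hp.1 (hp.1.trans hp.2.1), (div_le_one (hp.1.trans hp.2.1)).2 hp.2.1.le⟩
  have hR : ContinuousOn (fun p : ℝ × ℝ => (T - p.1) / (p.1 - p.2)) S :=
    ContinuousOn.div (by fun_prop) (by fun_prop) fun p hp => (sub_pos.2 hp.2.1).ne'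
  have hzR : ContinuousOn (fun p : ℝ × ℝ => (p.2 / p.1, (T - p.1) / (p.1 - p.2))) S :=
    hz.prodMk hR
  have hzRm : MapsTo (fun p : ℝ × ℝ => (p.2 / p.1, (T - p.1) / (p.1 - p.2))) S
      (Ioc 0 1 ×ˢ Ioi 0) := fun p hp =>
    ⟨hzm p hp, div_pos (sub_pos.2 hp.2.2) (sub_pos.2 hp.2.1)⟩
  have p1 := (bddContOn_Psi₁ hH₁ hH₁₂ hH₂).1.comp hzR hzRm
  have p2 := (bddContOn_Psi₂ hH₁ hH₁₂ hH₂).1.comp hzR hzRm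
  have p3 := (bddContOn_Psi₃ hH₁ hH₁₂ hH₂).1.comp hzR hzRm
  have hG := (continuousOn_rhoProfile hH₁ hH₁₂ hH₂).comp hz
    fun p hp => ⟨(hzm p hp).1.le, (hzm p hp).2⟩
  have hT : ContinuousOn (fun p : ℝ × ℝ => (T - p.1) ^ (1 / 2 - H₁)) S :=
    ContinuousOn.rpow_const (by fun_prop) fun p hp => Or.inl (sub_pos.2 hp.2.2).ne'
  have hd : ContinuousOn (fun p : ℝ × ℝ => (p.1 - p.2) ^ (H₁ - 1 / 2)) S :=
    ContinuousOn.rpow_const (by fun_prop) fun p hp => Or.inl (sub_pos.2 hp.2.1).ne'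
  exact ((hT.mul hd).mul hG).add (continuousOn_const.mul ((p1.add p2).add p3))

theorem continuousOn_Lplus (T : ℝ) : ContinuousOn (fun p : ℝ × ℝ => Lplus H₁ H₂ T p.1 p.2)
    {p : ℝ × ℝ | 0 < p.1 ∧ p.1 < p.2 ∧ p.2 < T} := by
  set S := {p : ℝ × ℝ | 0 < p.1 ∧ p.1 < p.2 ∧ p.2 < T} with hS
  have hz : ContinuousOn (fun p : ℝ × ℝ => p.1 / p.2) S :=
    continuousOn_fst.div continuousOn_snd fun p hp => (hp.1.trans hp.2.1).ne'
  have hzm : ∀ p ∈ S, p.1 / p.2 ∈ Ioc (0 : ℝ) 1 := fun p hp =>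
    ⟨div_pos hp.1 (hp.1.trans hp.2.1), (div_le_one (hp.1.trans hp.2.1)).2 hp.2.1.le⟩
  have hzm' : MapsTo (fun p : ℝ × ℝ => p.1 / p.2) S (Icc 0 1) := fun p hp =>
    ⟨(hzm p hp).1.le, (hzm p hp).2⟩
  have hR : ContinuousOn (fun p : ℝ × ℝ => (T - p.2) / (p.2 - p.1)) S :=
    ContinuousOn.div (by fun_prop) (by fun_prop) fun p hp => (sub_pos.2 hp.2.1).ne'
  have hzR : ContinuousOn (fun p : ℝ × ℝ => (p.1 / p.2, (T - p.2) / (p.2 - p.1))) S :=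
    hz.prodMk hR
  have hzRm : MapsTo (fun p : ℝ × ℝ => (p.1 / p.2, (T - p.2) / (p.2 - p.1))) S
      (Ioc 0 1 ×ˢ Ioi 0) := fun p hp =>
    ⟨hzm p hp, div_pos (sub_pos.2 hp.2.2) (sub_pos.2 hp.2.1)⟩
  have l1 := (bddContOn_Lambda₁ hH₁ hH₁₂ hH₂).1.comp hzR hzRm
  have l2 := (bddContOn_Lambda₂ hH₁ hH₁₂ hH₂).1.comp hzR hzRm
  have l3 := (bddContOn_Lambda₃ hH₁ hH₁₂ hH₂).1.comp hzR hzRm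
  have hF₁ := ((holderOnUnit_F₁ hH₁ hH₁₂ hH₂).continuousOn (alpha_mem hH₁ hH₁₂ hH₂).1).comp hz hzm'
  have hF₂ := ((holderOnUnit_F₂ hH₁ hH₁₂ hH₂).continuousOn (beta_mem hH₁ hH₁₂ hH₂).1).comp hz hzm'
  have hΦ₁ := (intervalIntegrable_and_bddContOn_Phi₁ hH₁ hH₁₂ hH₂).2.1.comp hz hzm'
  have hΦ₂ := (intervalIntegrable_and_bddContOn_Phi₂ hH₁ hH₁₂ hH₂).2.1.comp hz hzm'
  have hu : ContinuousOn (fun p : ℝ × ℝ => p.1 ^ (1 / 2 - H₁)) S :=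
    continuousOn_fst.rpow_const fun p hp => Or.inl hp.1.ne'
  have hs : ContinuousOn (fun p : ℝ × ℝ => p.2 ^ (2 * H₂ - 2)) S :=
    continuousOn_snd.rpow_const fun p hp => Or.inl (hp.1.trans hp.2.1).ne'
  have hd : ContinuousOn (fun p : ℝ × ℝ => (p.2 - p.1) ^ (3 / 2 + H₁ - 2 * H₂)) S :=
    ContinuousOn.rpow_const (by fun_prop) fun p hp => Or.inl (sub_pos.2 hp.2.1).ne'
  have hzr : ∀ r : ℝ, ContinuousOn (fun p : ℝ × ℝ => (p.1 / p.2) ^ r) S := fun r =>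
    hz.rpow_const fun p hp => Or.inl (hzm p hp).1.ne'
  exact ((((((continuousOn_const.mul hu).mul hs).mul hd).mul
    (hF₁.add (continuousOn_const.mul hΦ₁))).add ((continuousOn_const.mul (hzr _)).mul hF₂)).add
    ((continuousOn_const.mul (hzr _)).mul hΦ₂)).sub
    ((continuousOn_const.mul (hzr _)).mul ((l1.add l2).add l3))

end

/-- Two functions, continuous on the two sides of the diagonal of a square and with the same limit
`ℓ` along it, glue to a continuous function on the square. -/
theorem continuousOn_glue {f g : ℝ × ℝ → ℝ} {T ℓ : ℝ}
    (hf : ContinuousOn f {p : ℝ × ℝ | 0 < p.2 ∧ p.2 < p.1 ∧ p.1 < T})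
    (hg : ContinuousOn g {p : ℝ × ℝ | 0 < p.1 ∧ p.1 < p.2 ∧ p.2 < T})
    (hlf : ∀ t ∈ Ioo 0 T,
      Tendsto f (𝓝[{p : ℝ × ℝ | 0 < p.2 ∧ p.2 < p.1 ∧ p.1 < T}] (t, t)) (𝓝 ℓ))
    (hlg : ∀ t ∈ Ioo 0 T,
      Tendsto g (𝓝[{p : ℝ × ℝ | 0 < p.1 ∧ p.1 < p.2 ∧ p.2 < T}] (t, t)) (𝓝 ℓ)) :
    ContinuousOn (fun p : ℝ × ℝ => if p.1 = p.2 then ℓ else if p.2 < p.1 then f p else g p)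
      (Ioo 0 T ×ˢ Ioo 0 T) := by
  set F : ℝ × ℝ → ℝ := fun p => if p.1 = p.2 then ℓ else if p.2 < p.1 then f p else g p with hF
  have hFf : ∀ p : ℝ × ℝ, p.2 < p.1 → F p = f p := fun p hp => by
    simp only [hF, if_neg hp.ne', if_pos hp]
  have hFg : ∀ p : ℝ × ℝ, p.1 < p.2 → F p = g p := fun p hp => by
    simp only [hF, if_neg hp.ne, if_neg (not_lt.2 hp.le)]
  have hFd : ∀ p : ℝ × ℝ, p.1 = p.2 → F p = ℓ := fun p hp => by simp only [hF, if_pos hp]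
  have ho₁ : IsOpen {p : ℝ × ℝ | 0 < p.2 ∧ p.2 < p.1 ∧ p.1 < T} :=
    (isOpen_lt continuous_const continuous_snd).inter
      ((isOpen_lt continuous_snd continuous_fst).inter
        (isOpen_lt continuous_fst continuous_const))
  have ho₂ : IsOpen {p : ℝ × ℝ | 0 < p.1 ∧ p.1 < p.2 ∧ p.2 < T} :=
    (isOpen_lt continuous_const continuous_fst).inter
      ((isOpen_lt continuous_fst continuous_snd).inter
        (isOpen_lt continuous_snd continuous_const))
  rintro ⟨u, s⟩ ⟨hu, hs⟩
  refine ContinuousAt.continuousWithinAt ?_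
  rcases lt_trichotomy s u with h | h | h
  · have hmem := ho₁.mem_nhds (show (u, s) ∈ {p : ℝ × ℝ | 0 < p.2 ∧ p.2 < p.1 ∧ p.1 < T} from
      ⟨hs.1, h, hu.2⟩)
    refine (hf.continuousAt hmem).congr ?_
    filter_upwards [hmem] with p hp
    exact (hFf p hp.2.1).symm
  · subst h
    have hsq : Ioo 0 T ×ˢ Ioo 0 T ∈ 𝓝 (s, s) := prod_mem_nhds (Ioo_mem_nhds hs.1 hs.2)
      (Ioo_mem_nhds hs.1 hs.2)
    have hcover : {p : ℝ × ℝ | 0 < p.2 ∧ p.2 < p.1 ∧ p.1 < T} ∪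
        ({p : ℝ × ℝ | 0 < p.1 ∧ p.1 < p.2 ∧ p.2 < T} ∪ {p : ℝ × ℝ | p.1 = p.2}) ∈ 𝓝 (s, s) := by
      filter_upwards [hsq] with p hp
      rcases lt_trichotomy p.2 p.1 with h | h | h
      · exact Or.inl ⟨hp.2.1, h, hp.1.2⟩
      · exact Or.inr (Or.inr h.symm)
      · exact Or.inr (Or.inl ⟨hp.1.1, h, hp.2.2⟩)
    rw [ContinuousAt, hFd (s, s) rfl, ← nhdsWithin_eq_nhds.2 hcover, nhdsWithin_union,
      nhdsWithin_union]
    refine Tendsto.sup ?_ (Tendsto.sup ?_ ?_)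
    · refine (hlf s hs).congr' ?_
      filter_upwards [self_mem_nhdsWithin] with p hp
      exact (hFf p hp.2.1).symm
    · refine (hlg s hs).congr' ?_
      filter_upwards [self_mem_nhdsWithin] with p hp
      exact (hFg p hp.2.1).symm
    · refine tendsto_const_nhds.congr' ?_
      filter_upwards [self_mem_nhdsWithin] with p hp
      exact (hFd p hp).symm
  · have hmem := ho₂.mem_nhds (show (u, s) ∈ {p : ℝ × ℝ | 0 < p.1 ∧ p.1 < p.2 ∧ p.2 < T} from
      ⟨hu.1, h, hs.2⟩)
    refine (hg.continuousAt hmem).congr ?_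
    filter_upwards [hmem] with p hp
    exact (hFg p hp.2.1).symm

end TwoFBM

theorem theorem4p6 (H₁ H₂ T : ℝ) (hH₁ : 1 / 2 < H₁) (hH₁₂ : H₁ < H₂) (hH₂ : H₂ < 1)
    (hT : 0 < T) :
    -- the derivatives and integrals that define the kernel exist
    (∀ u s : ℝ, 0 < u → u < s → s < T →
      IntervalIntegrable
        (fun t => (u - t) ^ (1 / 2 - H₁) * t ^ (1 / 2 - H₁) * (s - t) ^ (2 * H₂ - 2)) volume 0 u ∧
      DifferentiableAt ℝ (fun v => psiInner H₁ H₂ v s) u ∧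
      IntervalIntegrable (KplusIntegrand₁ H₁ H₂ u s) volume u s ∧
      IntervalIntegrable (KplusIntegrand₂ H₁ H₂ u s) volume s T) ∧
    (∀ u s : ℝ, 0 < s → s < u → u < T →
      IntervalIntegrable
        (fun t => (u - t) ^ (1 / 2 - H₁) * t ^ (1 / 2 - H₁) * (t - s) ^ (2 * H₂ - 2)) volume s u ∧
      IntervalIntegrable
        (fun t => (u - t) ^ (1 / 2 - H₁) * t ^ (1 / 2 - H₁) * (s - t) ^ (2 * H₂ - 2)) volume 0 s ∧
      DifferentiableAt ℝ (fun v => phiInner H₁ H₂ v s) u ∧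
      DifferentiableAt ℝ (fun v => tauInner H₁ H₂ v s) u ∧
      IntervalIntegrable (KminusIntegrand H₁ H₂ u s) volume u T) ∧
    -- the hypergeometric functions are Hölder continuous on `[0,1]`
    (alpha H₁ H₂ ∈ Ioo (0 : ℝ) 1 ∧ beta H₁ H₂ ∈ Ioo (0 : ℝ) 1 ∧
      HolderOnUnit (alpha H₁ H₂) (F₁ H₁ H₂) ∧ HolderOnUnit (beta H₁ H₂) (F₂ H₁ H₂) ∧
      HolderOnUnit (alpha H₁ H₂) (F₃ H₁ H₂) ∧ HolderOnUnit (beta H₁ H₂) (F₄ H₁ H₂) ∧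
      HolderOnUnit (beta H₁ H₂) (F₅ H₁ H₂)) ∧
    -- the auxiliary integrals converge and define bounded continuous functions
    (∀ z ∈ Icc (0 : ℝ) 1,
      IntervalIntegrable (Phi₁Integrand H₁ H₂ z) volume 0 1 ∧
      IntervalIntegrable (Phi₂Integrand H₁ H₂ z) volume 0 1) ∧
    (∀ z ∈ Ioo (0 : ℝ) 1, ∀ R ∈ Ioi (0 : ℝ),
      IntervalIntegrable (Psi₁Integrand H₁ H₂ z) volume 0 R ∧
      IntervalIntegrable (Psi₂Integrand H₁ H₂ z) volume 0 R ∧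
      IntervalIntegrable (Psi₃Integrand H₁ H₂ z) volume 0 R ∧
      IntervalIntegrable (Lambda₁Integrand H₁ H₂ z) volume 0 R ∧
      IntervalIntegrable (Lambda₂Integrand H₁ H₂ z) volume 0 R ∧
      IntervalIntegrable (Lambda₃Integrand H₁ H₂ z) volume 0 R) ∧
    (BddContOn (Phi₁ H₁ H₂) (Icc 0 1) ∧ BddContOn (Phi₂ H₁ H₂) (Icc 0 1)) ∧
    (BddContOn (fun p : ℝ × ℝ => Psi₁ H₁ H₂ p.1 p.2) (Ioo 0 1 ×ˢ Ioi 0) ∧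
      BddContOn (fun p : ℝ × ℝ => Psi₂ H₁ H₂ p.1 p.2) (Ioo 0 1 ×ˢ Ioi 0) ∧
      BddContOn (fun p : ℝ × ℝ => Psi₃ H₁ H₂ p.1 p.2) (Ioo 0 1 ×ˢ Ioi 0) ∧
      BddContOn (fun p : ℝ × ℝ => Lambda₁ H₁ H₂ p.1 p.2) (Ioo 0 1 ×ˢ Ioi 0) ∧
      BddContOn (fun p : ℝ × ℝ => Lambda₂ H₁ H₂ p.1 p.2) (Ioo 0 1 ×ˢ Ioi 0) ∧
      BddContOn (fun p : ℝ × ℝ => Lambda₃ H₁ H₂ p.1 p.2) (Ioo 0 1 ×ˢ Ioi 0)) ∧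
    -- the factorization
    (∀ u ∈ Ioo 0 T, ∀ s ∈ Ioo 0 T, u ≠ s →
      K H₁ H₂ T u s = |u - s| ^ (2 * H₂ - 2 * H₁ - 1) * L H₁ H₂ T u s) ∧
    -- the one-sided limits on the diagonal exist, do not depend on `t`, and coincide
    (∃ l : ℝ, ∀ t ∈ Ioo 0 T,
      Tendsto (fun p : ℝ × ℝ => Lminus H₁ H₂ T p.1 p.2)
        (𝓝[{p : ℝ × ℝ | 0 < p.2 ∧ p.2 < p.1 ∧ p.1 < T}] (t, t)) (𝓝 l) ∧
      Tendsto (fun p : ℝ × ℝ => Lplus H₁ H₂ T p.1 p.2)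
        (𝓝[{p : ℝ × ℝ | 0 < p.1 ∧ p.1 < p.2 ∧ p.2 < T}] (t, t)) (𝓝 l)) ∧
    -- `L` extends continuously across the diagonal
    (∃ Lext : ℝ × ℝ → ℝ, ContinuousOn Lext (Ioo 0 T ×ˢ Ioo 0 T) ∧
      ∀ u ∈ Ioo 0 T, ∀ s ∈ Ioo 0 T, u ≠ s → Lext (u, s) = L H₁ H₂ T u s) := by
  have hα := alpha_mem hH₁ hH₁₂ hH₂
  have hβ := beta_mem hH₁ hH₁₂ hH₂
  have hsub : Ioo (0 : ℝ) 1 ×ˢ Ioi (0 : ℝ) ⊆ Ioc 0 1 ×ˢ Ioi 0 :=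
    prod_mono Ioo_subset_Ioc_self Subset.rfl
  refine ⟨fun u s hu hus hsT => ?_, fun u s hs hsu huT => ?_,
    ⟨hα, hβ, holderOnUnit_F₁ hH₁ hH₁₂ hH₂, holderOnUnit_F₂ hH₁ hH₁₂ hH₂,
      holderOnUnit_F₃ hH₁ hH₁₂ hH₂, holderOnUnit_F₄ hH₁ hH₁₂ hH₂, holderOnUnit_F₅ hH₁ hH₁₂ hH₂⟩,
    fun z hz => ⟨(intervalIntegrable_and_bddContOn_Phi₁ hH₁ hH₁₂ hH₂).1 z hz,
      (intervalIntegrable_and_bddContOn_Phi₂ hH₁ hH₁₂ hH₂).1 z hz⟩,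
    fun z hz R hR => ?_,
    ⟨(intervalIntegrable_and_bddContOn_Phi₁ hH₁ hH₁₂ hH₂).2,
      (intervalIntegrable_and_bddContOn_Phi₂ hH₁ hH₁₂ hH₂).2⟩,
    ⟨(bddContOn_Psi₁ hH₁ hH₁₂ hH₂).mono hsub, (bddContOn_Psi₂ hH₁ hH₁₂ hH₂).mono hsub,
      (bddContOn_Psi₃ hH₁ hH₁₂ hH₂).mono hsub, (bddContOn_Lambda₁ hH₁ hH₁₂ hH₂).mono hsub,
      (bddContOn_Lambda₂ hH₁ hH₁₂ hH₂).mono hsub, (bddContOn_Lambda₃ hH₁ hH₁₂ hH₂).mono hsub⟩,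
    fun u hu s hs hne => ?_,
    ⟨_, fun t ht => ⟨tendsto_Lminus hH₁ hH₁₂ hH₂ ht, tendsto_Lplus hH₁ hH₁₂ hH₂ ht⟩⟩,
    ⟨_, continuousOn_glue (continuousOn_Lminus hH₁ hH₁₂ hH₂ T) (continuousOn_Lplus hH₁ hH₁₂ hH₂ T)
      (fun t ht => tendsto_Lminus hH₁ hH₁₂ hH₂ ht) fun t ht => tendsto_Lplus hH₁ hH₁₂ hH₂ ht,
      fun u _ s _ hne => ?_⟩⟩
  · exact ⟨(psiInner_eq H₂ (by linarith) hu hus).1,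
      (hasDerivAt_psiInner hH₁ hH₁₂ hH₂ hu hus).differentiableAt,
      (integral_KplusIntegrand₁ hH₁ hH₁₂ hH₂ hu hus).1,
      (integral_KplusIntegrand₂ hH₁ hH₁₂ hH₂ hu hus hsT).1⟩
  · exact ⟨(phiInner_eq (by linarith) (by linarith) hs hsu).1,
      (tauInner_eq (by linarith) (by linarith) hs hsu).1,
      (hasDerivAt_phiInner hH₁ hH₁₂ hH₂ hs hsu).differentiableAt,
      (hasDerivAt_tauInner hH₁ hH₁₂ hH₂ hs hsu).differentiableAt,
      (integral_KminusIntegrand hH₁ hH₁₂ hH₂ hs hsu huT).1⟩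
  · have hz' : z ∈ Ioc (0 : ℝ) 1 := ⟨hz.1, hz.2.le⟩
    have hR' : 0 ≤ R := le_of_lt hR
    exact ⟨(dominatedOn_Psi₁ hH₁ hH₁₂ hH₂).intervalIntegrable hz' hR',
      intervalIntegrable_Psi₂ hH₁ hH₁₂ hH₂ hz hR',
      (dominatedOn_Psi₃ hH₁ hH₁₂ hH₂).intervalIntegrable hz' hR',
      (dominatedOn_Lambda₁ hH₁ hH₁₂ hH₂).intervalIntegrable hz' hR',
      intervalIntegrable_Lambda₂ hH₁ hH₁₂ hH₂ hz hR',
      (dominatedOn_Lambda₃ hH₁ hH₁₂ hH₂).intervalIntegrable hz' hR'⟩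
  · rcases lt_or_gt_of_ne hne with h | h
    · rw [K, L, if_neg (not_lt.2 h.le), if_neg (not_lt.2 h.le), abs_sub_comm,
        abs_of_pos (sub_pos.2 h), Kplus_eq hH₁ hH₁₂ hH₂ hu.1 h hs.2]
    · rw [K, L, if_pos h, if_pos h, abs_of_pos (sub_pos.2 h),
        Kminus_eq hH₁ hH₁₂ hH₂ hs.1 h hu.2]
  · simp only [if_neg hne, L]
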